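/- Let $\Sigma_P=\{0,\dots,n_P-1\}$ and $\Sigma_T=\{0,\dots,n_T-1\}$ be a pattern and a text alphabet and let $\Delta:\Sigma_P\times\Sigma_T\to\{0,1\}$. Its $0/1$-matrix $M_\Delta$ has rows indexed by $\Sigma_P$ and columns indexed by $\Sigma_T$. We say that $M_\Delta$ contains the wildcard matrix if some two distinct rows and two distinct columns of $M_\Delta$, taken in a suitable order, form the submatrix $\begin{pmatrix}1&1\\1&0\end{pmatrix}$. For a pattern $P\in\Sigma_P^m$ and a text stream $T=T[0]T[1]T[2]\cdots$ over $\Sigma_T$, put $$\mathrm{LocalPM}_{(\wedge,\Delta)}(P,T)(i)=\bigwedge_{j=0}^{m-1}\Delta(P[j],T[i+j])\qquad(i\ge 0).$$ A randomised online algorithm consists of two random access programs with fair coin flips. One preprocesses the pattern; it can read $P$ and evaluate $\Delta$, starts with $m,n_P,n_T$ in its memory, and its working space is not counted. The other is run on each arriving text symbol; it can evaluate $\Delta$ but can no longer read $P$, and it produces an output for each symbol. Both always halt. The algorithm solves $\mathrm{LocalPM}_{(\wedge,\Delta)}$ for pattern length $m$ in $B$ bits of space with error $\varepsilon$ if there are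 $k,w$ with $kw\le B$ such that for every $P\in\Sigma_P^m$ and every text stream $T$, whatever the coin flips are, at all times from the end of the preprocessing on (also while a symbol is being processed) the memory consists of at most $k$ words of $w$ bits each, and, for each $i\ge0$, the output given on the arrival of $T[i+m-1]$ equals $\mathrm{LocalPM}_{(\wedge,\Delta)}(P,T)(i)$ with probability at least $1-\varepsilon$. **Theorem.** For every natural number $c$ and every real $\varepsilon>0$ there are a randomised online algorithm $A$ and a constant $C$ such that, for all $m\ge2$, all $n_P,n_T\le m^c$ and all $\Delta:\Sigma_P\times\Sigma_T\to\{0,1\}$ for which $M_\Delta$ does not contain the wildcard matrix, $A$ solves $\mathrm{LocalPM}_{(\wedge,\Delta)}$ for pattern length $m$ in $C\lfloor\log_2 m\rfloor^2=O(\log^2 m)$ bits of space with error $\varepsilon$. -/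

import Mathlib

namespace OnlinePM

/-! ### The pattern matching problem -/

/-- The `0/1`-matrix `M_Δ` of a relation `Δ` between the pattern alphabet `{0, …, nP - 1}` (rows)
and the text alphabet `{0, …, nT - 1}` (columns). -/
def relMatrix {nP nT : ℕ} (Δ : Fin nP → Fin nT → Bool) : Matrix (Fin nP) (Fin nT) ℕ :=
  Matrix.of fun x a => (Δ x a).toNat

/-- The wildcard matrix. -/
def wildcardMatrix : Matrix (Fin 2) (Fin 2) ℕ := !![1, 1; 1, 0]

/-- `M` contains the wildcard matrix: some choice of two distinct rows and two distinct columns,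
taken in any order, gives the wildcard matrix. -/
def ContainsWildcard {nP nT : ℕ} (M : Matrix (Fin nP) (Fin nT) ℕ) : Prop :=
  ∃ (r : Fin 2 → Fin nP) (c : Fin 2 → Fin nT),
    Function.Injective r ∧ Function.Injective c ∧ M.submatrix r c = wildcardMatrix

/-- `LocalPM_(∧,Δ)` at alignment `i`: the conjunction of `Δ(P[j], T[i+j])` over `0 ≤ j < m`. -/
def localPMAnd {m nP nT : ℕ} (Δ : Fin nP → Fin nT → Bool) (P : Fin m → Fin nP)
    (T : ℕ → Fin nT) (i : ℕ) : Bool :=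
  decide (∀ j : Fin m, Δ (P j) (T (i + j)) = true)

/-! ### Randomised random access programs -/

/-- The arithmetic and comparison operations of the machine. -/
inductive Op : Type
  | add
  | sub
  | mul
  | div
  | mod
  | lt
  | eq

/-- Subtraction is truncated, division rounds down, comparisons return `1` (true) or `0`. -/
def Op.eval : Op → ℕ → ℕ → ℕ
  | .add, x, y => x + y
  | .sub, x, y => x - y
  | .mul, x, y => x * y
  | .div, x, y => x / y
  | .mod, x, y => x % y
  | .lt, x, y => if x < y then 1 else 0
  | .eq, x, y => if x = y then 1 else 0

/-- Expressions: constants, memory access at a computed address, read access to the pattern,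
evaluation of `Δ` at two symbols, and operations. -/
inductive Expr : Type
  | const (n : ℕ)
  | load (addr : Expr)
  | pat (pos : Expr)
  | rel (x a : Expr)
  | op (o : Op) (e f : Expr)

/-- Commands. The command `flip addr` writes a fresh fair random bit at the given address. -/
inductive Cmd : Type
  | skip
  | store (addr val : Expr)
  | flip (addr : Expr)
  | seq (c d : Cmd)
  | ite (e : Expr) (c d : Cmd)
  | while (e : Expr) (c : Cmd)

/-- The memory: the content of every cell. -/
abbrev Mem : Type := ℕ → ℕ

/-- What a program can read besides its memory. -/
structure Env : Type where
  /-- the symbol of the pattern at a position -/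
  pat : ℕ → ℕ
  /-- the value of `Δ` at a pattern symbol and a text symbol -/
  rel : ℕ → ℕ → ℕ

/-- The value of an expression. -/
def Expr.eval (E : Env) (σ : Mem) : Expr → ℕ
  | .const n => n
  | .load e => σ (e.eval E σ)
  | .pat e => E.pat (e.eval E σ)
  | .rel e f => E.rel (e.eval E σ) (f.eval E σ)
  | .op o e f => o.eval (e.eval E σ) (f.eval E σ)

/-- `Runs E ok c σ μ`: the command `c`, started with memory `σ`, always halts, every memory content
that it produces on the way satisfies `ok`, whatever the random bits are, and the final memory
has distribution `μ`. A number is true iff it is not `0`. -/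
inductive Runs (E : Env) (ok : Mem → Prop) : Cmd → Mem → PMF Mem → Prop
  | skip (σ : Mem) : Runs E ok .skip σ (PMF.pure σ)
  | store (addr val : Expr) (σ : Mem)
      (h : ok (Function.update σ (addr.eval E σ) (val.eval E σ))) :
      Runs E ok (.store addr val) σ
        (PMF.pure (Function.update σ (addr.eval E σ) (val.eval E σ)))
  | flip (addr : Expr) (σ : Mem)
      (h : ∀ b : Bool, ok (Function.update σ (addr.eval E σ) b.toNat)) :
      Runs E ok (.flip addr) σ
        ((PMF.uniformOfFintype Bool).map fun b => Function.update σ (addr.eval E σ) b.toNat)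
  | seq (c d : Cmd) (σ : Mem) (μ : PMF Mem) (ν : Mem → PMF Mem)
      (hc : Runs E ok c σ μ) (hd : ∀ τ ∈ μ.support, Runs E ok d τ (ν τ)) :
      Runs E ok (.seq c d) σ (μ.bind ν)
  | ite_true (e : Expr) (c d : Cmd) (σ : Mem) (μ : PMF Mem)
      (he : e.eval E σ ≠ 0) (hc : Runs E ok c σ μ) : Runs E ok (.ite e c d) σ μ
  | ite_false (e : Expr) (c d : Cmd) (σ : Mem) (μ : PMF Mem)
      (he : e.eval E σ = 0) (hd : Runs E ok d σ μ) : Runs E ok (.ite e c d) σ μ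
  | while_false (e : Expr) (c : Cmd) (σ : Mem)
      (he : e.eval E σ = 0) : Runs E ok (.while e c) σ (PMF.pure σ)
  | while_true (e : Expr) (c : Cmd) (σ : Mem) (μ : PMF Mem) (ν : Mem → PMF Mem)
      (he : e.eval E σ ≠ 0) (hc : Runs E ok c σ μ)
      (hw : ∀ τ ∈ μ.support, Runs E ok (.while e c) τ (ν τ)) :
      Runs E ok (.while e c) σ (μ.bind ν)

/-- The memory consists of `k` words of `w` bits each (everything beyond the first `k` cells is
blank), so `k * w` bits are in use. -/
def Fits (k w : ℕ) (σ : Mem) : Prop :=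
  (∀ a, σ a < 2 ^ w) ∧ ∀ a, k ≤ a → σ a = 0

/-! ### Online algorithms -/

/-- An online algorithm: a program that preprocesses the pattern, and a program that is run each
time a text symbol arrives. -/
structure OnlineAlgorithm : Type where
  pre : Cmd
  step : Cmd

/-- `Δ` as a function of symbol numbers, `0` outside the alphabets. -/
def relFun {nP nT : ℕ} (Δ : Fin nP → Fin nT → Bool) (x a : ℕ) : ℕ :=
  if h : x < nP ∧ a < nT then (Δ ⟨x, h.1⟩ ⟨a, h.2⟩).toNat else 0

/-- While the pattern is preprocessed, both the pattern and `Δ` can be read. -/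
def preEnv {m nP nT : ℕ} (Δ : Fin nP → Fin nT → Bool) (P : Fin m → Fin nP) : Env where
  pat j := if h : j < m then P ⟨j, h⟩ else 0
  rel := relFun Δ

/-- While the text is read, the pattern is no longer available. -/
def stepEnv {nP nT : ℕ} (Δ : Fin nP → Fin nT → Bool) : Env where
  pat _ := 0
  rel := relFun Δ

/-- At the start the memory holds only the three numbers `m`, `nP`, `nT`. -/
def initMem (m nP nT : ℕ) : Mem := fun a =>
  if a = 0 then m else if a = 1 then nP else if a = 2 then nT else 0

/-- `Reaches A Δ P T k w n μ`: after preprocessing `P` and reading `n` symbols of the text `T`, the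
memory of `A` has distribution `μ`, and from the end of the preprocessing on, the memory always
consisted of at most `k` words of `w` bits. An arriving symbol is placed in cell `0`. -/
inductive Reaches (A : OnlineAlgorithm) {m nP nT : ℕ} (Δ : Fin nP → Fin nT → Bool)
    (P : Fin m → Fin nP) (T : ℕ → Fin nT) (k w : ℕ) : ℕ → PMF Mem → Prop
  | zero (μ : PMF Mem)
      (hrun : Runs (preEnv Δ P) (fun _ => True) A.pre (initMem m nP nT) μ)
      (hfits : ∀ σ ∈ μ.support, Fits k w σ) :
      Reaches A Δ P T k w 0 μ
  | succ (n : ℕ) (μ : PMF Mem) (ν : Mem → PMF Mem)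
      (hprev : Reaches A Δ P T k w n μ)
      (hfits : ∀ σ ∈ μ.support, Fits k w (Function.update σ 0 (T n : ℕ)))
      (hrun : ∀ σ ∈ μ.support,
        Runs (stepEnv Δ) (Fits k w) A.step (Function.update σ 0 (T n : ℕ)) (ν σ)) :
      Reaches A Δ P T k w (n + 1) (μ.bind ν)

/-- The output of an algorithm is found in cell `0`. -/
def output (σ : Mem) : Bool := decide (σ 0 ≠ 0)

/-- `A` solves `LocalPM_(∧,Δ)` online for patterns of length `m` in `B` bits of space with error
probability at most `ε`: for every pattern, every text stream and every alignment `i`, the output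
given on arrival of the last symbol `T[i+m-1]` is wrong with probability at most `ε`. -/
def SolvesLocalPMAnd (A : OnlineAlgorithm) {nP nT : ℕ} (Δ : Fin nP → Fin nT → Bool)
    (m : ℕ) (ε : ℝ) (B : ℕ) : Prop :=
  ∃ k w : ℕ, k * w ≤ B ∧
    ∀ (P : Fin m → Fin nP) (T : ℕ → Fin nT) (i : ℕ),
      ∃ μ : PMF Mem, Reaches A Δ P T k w (i + m) μ ∧
        μ.toOuterMeasure {σ | output σ ≠ localPMAnd Δ P T i} ≤ ENNReal.ofReal ε

end OnlinePM

namespace OnlinePM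

/-! ### Deterministic runs -/

/-! If `M_Δ` does not contain the wildcard matrix, two rows with a common `1` are equal, so the
relation is a disjoint union of complete bipartite graphs. Replacing every symbol by a code of its
component turns the problem into exact matching (`patCode_eq_textCode_iff`), and the codes can be
computed on the fly by evaluating `Δ`.

Exact matching is done with fingerprints, in the manner of Porat and Porat. Level `j` keeps the
positions at which the prefix of length `min (2^j) m` is known to occur, from the time this prefix
is complete until the next prefix length is reached. Then the position leaves, the longer prefix is
tested by one comparison of fingerprints, and on success the position enters the next level; what
leaves the last level is a match. The positions of a level lie closer together than the length of
their common prefix, so by periodicity they form an arithmetic progression (`Occ.gap_eq`), and the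
text between two neighbours is always the same prefix of the pattern. Hence a level needs only six
numbers (`Level.Rep.push`, `Level.Rep.pop_of_expires`), and `O(log m)` words suffice.

The numbers must stay polynomial in `m` although the stream is infinite. So two copies of the
matcher run, each restarted after `2m` symbols and shifted by `m` against the other; at any time one
of them has read at least `m` symbols. A restart also erases the effect of earlier collisions, so
that an output depends only on collisions in a window of `4m` symbols.

A fixed pair of distinct words of length at most `m` collides for at most `m` evaluation points, the
roots of a polynomial over `ZMod p`. A union bound gives at most `4m³` bad points for a window
(`card_collision_le`). The point is drawn from at least `4sm³` values with `s > 1/ε`, so the error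
is at most `ε` (`algorithm_error`). Only this draw is random; all other commands run
deterministically and are handled by a weakest-precondition calculus (`Wp`). The space bounds never
rely on the absence of collisions. -/

theorem Runs.mono {E : Env} {ok ok' : Mem → Prop} (h : ∀ σ, ok σ → ok' σ) {c : Cmd} {σ : Mem}
    {μ : PMF Mem} (hr : Runs E ok c σ μ) : Runs E ok' c σ μ := by
  induction hr with
  | skip σ => exact .skip σ
  | store addr val σ h1 => exact .store addr val σ (h _ h1)
  | flip addr σ h1 => exact .flip addr σ fun b => h _ (h1 b)
  | seq c d σ μ ν _ _ ih1 ih2 => exact .seq c d σ μ ν ih1 ih2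
  | ite_true e c d σ μ he _ ih => exact .ite_true e c d σ μ he ih
  | ite_false e c d σ μ he _ ih => exact .ite_false e c d σ μ he ih
  | while_false e c σ he => exact .while_false e c σ he
  | while_true e c σ μ ν he _ _ ih1 ih2 => exact .while_true e c σ μ ν he ih1 ih2

theorem Fits.update {k w : ℕ} {σ : Mem} (h : Fits k w σ) {a v : ℕ} (ha : a < k) (hv : v < 2 ^ w) :
    Fits k w (Function.update σ a v) := by
  refine ⟨fun b => ?_, fun b hb => ?_⟩
  · by_cases hba : b = a
    · subst hba; simpa using hv
    · simpa [Function.update_of_ne hba] using h.1 b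
  · have hba : b ≠ a := by omega
    simpa [Function.update_of_ne hba] using h.2 b hb

theorem upd_eq (σ : Mem) (a v : ℕ) : Function.update σ a v a = v := Function.update_self ..

theorem upd_ne {σ : Mem} {a b v : ℕ} (h : b ≠ a) : Function.update σ a v b = σ b :=
  Function.update_of_ne h ..

/-- Started in a memory of `k` words of `w` bits, the command `c` runs deterministically within
this space and ends in a memory that satisfies `Q`. -/
def Wp (E : Env) (k w : ℕ) (c : Cmd) (Q : Mem → Prop) (σ : Mem) : Prop :=
  Fits k w σ → ∃ τ, Runs E (Fits k w) c σ (PMF.pure τ) ∧ Fits k w τ ∧ Q τ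

section Wp

variable {E : Env} {k w : ℕ} {Q : Mem → Prop} {σ : Mem}

theorem Wp.of_fits {c : Cmd} (h : Fits k w σ → Wp E k w c Q σ) : Wp E k w c Q σ :=
  fun hf => h hf hf

theorem Wp.skip (h : Q σ) : Wp E k w .skip Q σ := fun hf => ⟨σ, .skip σ, hf, h⟩

theorem Wp.store {addr val : Expr} (ha : addr.eval E σ < k) (hv : val.eval E σ < 2 ^ w)
    (h : Q (Function.update σ (addr.eval E σ) (val.eval E σ))) :
    Wp E k w (.store addr val) Q σ := fun hf =>
  ⟨_, .store addr val σ (hf.update ha hv), hf.update ha hv, h⟩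

theorem Wp.seq {c d : Cmd} (h : Wp E k w c (Wp E k w d Q) σ) : Wp E k w (.seq c d) Q σ := by
  intro hf
  obtain ⟨τ, h1, h2, h3⟩ := h hf
  obtain ⟨υ, h4, h5, h6⟩ := h3 h2
  refine ⟨υ, ?_, h5, h6⟩
  have := Runs.seq c d σ (PMF.pure τ) (fun _ => PMF.pure υ) h1 (by
    intro τ' hτ'
    rw [PMF.support_pure, Set.mem_singleton_iff] at hτ'
    rwa [hτ'])
  rwa [PMF.pure_bind] at this

/-- The first command of a sequence is an assignment. -/
theorem Wp.seq_store {addr val : Expr} {d : Cmd} (ha : addr.eval E σ < k)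
    (hv : val.eval E σ < 2 ^ w)
    (h : Wp E k w d Q (Function.update σ (addr.eval E σ) (val.eval E σ))) :
    Wp E k w (.seq (.store addr val) d) Q σ :=
  .seq (.store ha hv h)

theorem Wp.ite {e : Expr} {c d : Cmd} (h1 : e.eval E σ ≠ 0 → Wp E k w c Q σ)
    (h2 : e.eval E σ = 0 → Wp E k w d Q σ) : Wp E k w (.ite e c d) Q σ := by
  intro hf
  by_cases he : e.eval E σ = 0
  · obtain ⟨τ, h3, h4⟩ := h2 he hf
    exact ⟨τ, .ite_false e c d σ _ he h3, h4⟩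
  · obtain ⟨τ, h3, h4⟩ := h1 he hf
    exact ⟨τ, .ite_true e c d σ _ he h3, h4⟩

/-- `I` is the loop invariant and `f` the decreasing measure; since `Runs` contains termination, a
measure is indispensable. -/
theorem Wp.while {e : Expr} {c : Cmd} (I : Mem → Prop) (f : Mem → ℕ) (h0 : I σ)
    (hstep : ∀ τ, I τ → e.eval E τ ≠ 0 → Wp E k w c (fun υ => I υ ∧ f υ < f τ) τ)
    (hend : ∀ τ, I τ → e.eval E τ = 0 → Q τ) : Wp E k w (.while e c) Q σ := by
  generalize hn : f σ = n
  induction n using Nat.strong_induction_on generalizing σ with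
  | _ n ih =>
    intro hf
    by_cases he : e.eval E σ = 0
    · exact ⟨σ, .while_false e c σ he, hf, hend σ h0 he⟩
    · obtain ⟨τ, h1, h2, h3, h4⟩ := hstep σ h0 he hf
      obtain ⟨υ, h5, h6, h7⟩ := ih (f τ) (hn ▸ h4) h3 rfl h2
      refine ⟨υ, ?_, h6, h7⟩
      have := Runs.while_true e c σ (PMF.pure τ) (fun _ => PMF.pure υ) he h1 (by
        intro τ' hτ'
        rw [PMF.support_pure, Set.mem_singleton_iff] at hτ'
        rwa [hτ'])
      rwa [PMF.pure_bind] at this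

end Wp

/-! ### Programming shorthands -/

/-- The content of the cell with a fixed address. -/
abbrev var (a : ℕ) : Expr := .load (.const a)

/-- Assignment to the cell with a fixed address. -/
abbrev set (a : ℕ) (e : Expr) : Cmd := .store (.const a) e

theorem Op.arith_eval (x y : ℕ) :
    Op.eval .add x y = x + y ∧ Op.eval .sub x y = x - y ∧ Op.eval .mul x y = x * y ∧
      Op.eval .mod x y = x % y :=
  ⟨rfl, rfl, rfl, rfl⟩

theorem Op.eval_lt_eq (x y : ℕ) : Op.eval .lt x y = if x < y then 1 else 0 := rfl

theorem Op.eval_eq_eq (x y : ℕ) : Op.eval .eq x y = if x = y then 1 else 0 := rfl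

theorem Op.eval_eq_le (x y : ℕ) : Op.eval .eq x y ≤ 1 := by
  rw [Op.eval_eq_eq]
  split_ifs <;> omega

theorem Op.eval_lt_eq_zero {x y : ℕ} : Op.eval .lt x y = 0 ↔ y ≤ x := by
  rw [Op.eval_lt_eq]
  simp

theorem Op.eval_eq_eq_zero {x y : ℕ} : Op.eval .eq x y = 0 ↔ x ≠ y := by
  rw [Op.eval_eq_eq]
  simp


/-! ### Occurrences of prefixes of the pattern -/

/-- The prefix of length `L` of the pattern `P` occurs in the text `U` at position `i`. -/
def Occ (U P : ℕ → ℕ) (i L : ℕ) : Prop := ∀ k < L, U (i + k) = P k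

theorem Occ.mono {U P : ℕ → ℕ} {i L L' : ℕ} (h : Occ U P i L) (hL : L' ≤ L) : Occ U P i L' :=
  fun k hk => h k (by omega)

theorem Occ.period {U P : ℕ → ℕ} {i d L : ℕ} (h : Occ U P i L) (h' : Occ U P (i + d) L)
    {k : ℕ} (hk : k + d < L) : P (k + d) = P k := by
  rw [← h (k + d) hk, ← h' k (by omega)]
  congr 1
  omega

/-- Three consecutive occurrences of a word that overlap are equally spaced. -/
theorem Occ.gap_eq {U P : ℕ → ℕ} {x d e L : ℕ} (hx : Occ U P x L) (hy : Occ U P (x + d) L)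
    (hz : Occ U P (x + d + e) L) (hde : d + e ≤ L)
    (hxy : ∀ i, x < i → i < x + d → ¬ Occ U P i L)
    (hyz : ∀ i, x + d < i → i < x + d + e → ¬ Occ U P i L) (hd : 0 < d) (he : 0 < e) :
    e = d := by
  have pd : ∀ k, k + d < L → P (k + d) = P k := fun k => hx.period hy
  have pe : ∀ k, k + e < L → P (k + e) = P k := fun k => hy.period hz
  -- If `d < e`, the word also occurs at `x + 2d`, strictly between the last two occurrences:
  -- indices with `k + d < L` are read off the second occurrence, the others satisfy `k ≥ L - d ≥ e`
  -- and are read off the third. If `e < d`, the same argument yields an occurrence at `x + d - e`.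
  rcases lt_trichotomy d e with h | h | h
  · refine absurd ?_ (hyz (x + d + d) (by omega) (by omega))
    intro k hk
    by_cases h1 : k + d < L
    · rw [← pd k h1, ← hy (k + d) h1]
      congr 1
      omega
    · obtain ⟨l, rfl⟩ : ∃ l, k = l + e := ⟨k - e, by omega⟩
      rw [pe l hk, ← pd l (by omega), ← hz (l + d) (by omega)]
      congr 1
      omega
  · exact h.symm
  · refine absurd ?_ (hxy (x + d - e) (by omega) (by omega))
    intro k hk
    by_cases h1 : k + d < L
    · rw [← pd k h1]
      have : P (k + d - e) = P (k + d) := by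
        have := pe (k + d - e) (by omega)
        rw [← this]
        congr 1
        omega
      rw [← this, ← hx (k + d - e) (by omega)]
      congr 1
      omega
    · obtain ⟨l, rfl⟩ : ∃ l, k = l + e := ⟨k - e, by omega⟩
      rw [pe l hk, ← hy l (by omega)]
      congr 1
      omega

/-! ### Fingerprints -/

/-- The fingerprint of the first `n` symbols of `U`, by Horner's rule at `r` modulo `p`. -/
def fingerprint (p r : ℕ) (U : ℕ → ℕ) : ℕ → ℕ
  | 0 => 0
  | n + 1 => (fingerprint p r U n * r + U n) % p

theorem fingerprint_lt {p : ℕ} (hp : 0 < p) (r : ℕ) (U : ℕ → ℕ) (n : ℕ) :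
    fingerprint p r U n < p := by
  cases n with
  | zero => exact hp
  | succ n => exact Nat.mod_lt _ hp

theorem fingerprint_congr {p r : ℕ} {U V : ℕ → ℕ} {n : ℕ} (h : ∀ k < n, U k = V k) :
    fingerprint p r U n = fingerprint p r V n := by
  induction n with
  | zero => rfl
  | succ n ih =>
    rw [fingerprint, fingerprint, ih fun k hk => h k (by omega), h n (by omega)]

/-- Under Horner's rule, appending `n` symbols multiplies the old value by `r ^ n`. The power
appears reduced modulo `p` because this is the number that the machine stores. -/
theorem fingerprint_add {p : ℕ} (hp : 0 < p) (r : ℕ) (U : ℕ → ℕ) (i n : ℕ) :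
    fingerprint p r U (i + n) =
      (fingerprint p r U i * (r ^ n % p) + fingerprint p r (fun k => U (i + k)) n) % p := by
  suffices h : fingerprint p r U (i + n) ≡
      fingerprint p r U i * r ^ n + fingerprint p r (fun k => U (i + k)) n [MOD p] by
    rw [← Nat.mod_eq_of_lt (fingerprint_lt hp r U (i + n))]
    exact h.trans (((Nat.mod_modEq _ _).symm.mul_left _).add_right _)
  induction n with
  | zero => simp [fingerprint, Nat.ModEq]
  | succ n ih =>
    calc fingerprint p r U (i + (n + 1))
        ≡ fingerprint p r U (i + n) * r + U (i + n) [MOD p] := Nat.mod_modEq _ _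
      _ ≡ (fingerprint p r U i * r ^ n + fingerprint p r (fun k => U (i + k)) n) * r + U (i + n)
          [MOD p] := (ih.mul_right _).add_right _
      _ = fingerprint p r U i * r ^ (n + 1) +
          (fingerprint p r (fun k => U (i + k)) n * r + U (i + n)) := by ring
      _ ≡ _ [MOD p] := (Nat.mod_modEq _ _).symm.add_left _

theorem Occ.fingerprint_eq {U P : ℕ → ℕ} {i L : ℕ} (h : Occ U P i L) (p r : ℕ) :
    fingerprint p r (fun k => U (i + k)) L = fingerprint p r P L :=
  fingerprint_congr h

theorem Occ.fingerprint_add {p : ℕ} (hp : 0 < p) {r : ℕ} {U P : ℕ → ℕ} {i L : ℕ}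
    (h : Occ U P i L) :
    fingerprint p r U (i + L) =
      (fingerprint p r U i * (r ^ L % p) + fingerprint p r P L) % p := by
  rw [OnlinePM.fingerprint_add hp, h.fingerprint_eq]

/-- No subword of the first `N` symbols of `U` has the fingerprint of a prefix of `P` of length at
most `m` by coincidence. -/
def NoCollision (p r : ℕ) (U P : ℕ → ℕ) (m N : ℕ) : Prop :=
  ∀ i L, i + L ≤ N → L ≤ m →
    fingerprint p r (fun k => U (i + k)) L = fingerprint p r P L → Occ U P i L

/-- The test needs only the fingerprints of the text before the position and up to now, and the
stored data of the prefix. Cancelling the common summand leaves the fingerprint of the subword, so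
`r` need not be invertible. -/
theorem NoCollision.test_iff {p : ℕ} (hp : 0 < p) {r : ℕ} {U P : ℕ → ℕ} {m N : ℕ}
    (h : NoCollision p r U P m N) {i L : ℕ} (hN : i + L ≤ N) (hL : L ≤ m) :
    (fingerprint p r U i * (r ^ L % p) + fingerprint p r P L) % p = fingerprint p r U (i + L) ↔
      Occ U P i L := by
  refine ⟨fun he => h i L hN hL ?_, fun ho => (ho.fingerprint_add hp).symm⟩
  rw [fingerprint_add hp] at he
  have h1 : fingerprint p r P L ≡ fingerprint p r (fun k => U (i + k)) L [MOD p] :=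
    Nat.ModEq.add_left_cancel' _ he
  exact (h1.eq_of_lt_of_lt (fingerprint_lt hp ..) (fingerprint_lt hp ..)).symm

/-! ### Levels -/

/-- A compressed set of positions: the arithmetic progression of length `cnt` with first element
`fst` and difference `gap`, with the fingerprint `fp` of the text before `fst`, the power
`gapPow = r ^ gap`, and the fingerprint `gapFp` of the text between two consecutive elements. -/
@[ext]
structure Level : Type where
  cnt : ℕ
  fst : ℕ
  fp : ℕ
  gap : ℕ
  gapPow : ℕ
  gapFp : ℕ

/-- A position that may be handed on from a level to the next one (if `flag` is not `0`), with the
fingerprint of the text before it. -/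
@[ext]
structure Cand : Type where
  flag : ℕ
  pos : ℕ
  fp : ℕ

/-- Removal of the first position. -/
def Level.pop (p : ℕ) (l : Level) : Level where
  cnt := l.cnt - 1
  fst := l.fst + l.gap
  fp := (l.fp * l.gapPow + l.gapFp) % p
  gap := l.gap
  gapPow := l.gapPow
  gapFp := l.gapFp

/-- Insertion of a position. -/
def Level.push (p r : ℕ) (l : Level) (c : Cand) : Level :=
  if c.flag = 0 then l
  else if l.cnt = 0 then { l with cnt := 1, fst := c.pos, fp := c.fp }
  else if l.cnt = 1 then
    { l with
      cnt := 2
      gap := c.pos - l.fst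
      gapPow := r ^ (c.pos - l.fst) % p
      -- Subtraction of naturals is truncated; `p - x % p` plays the role of `-x` modulo `p`.
      gapFp := (c.fp + (p - l.fp * (r ^ (c.pos - l.fst) % p) % p)) % p }
  else { l with cnt := l.cnt + 1 }

/-- At time `t`, the first position leaves the level whose positions have age less than `b`. -/
def Level.Expires (b t : ℕ) (l : Level) : Prop := 0 < l.cnt ∧ l.fst + b = t

instance (b t : ℕ) (l : Level) : Decidable (l.Expires b t) :=
  inferInstanceAs (Decidable (_ ∧ _))

/-- The first position of a level, flagged if the fingerprint `F` of the whole text shows that the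
prefix of the pattern with fingerprint `H` occurs there. -/
def Level.cand (p H R F : ℕ) (l : Level) : Cand where
  flag := if (l.fp * R + H) % p = F then 1 else 0
  pos := l.fst
  fp := l.fp

/-- What happens to a level at time `t`. -/
def Level.next (p r b t : ℕ) (l : Level) (c : Cand) : Level :=
  (if l.Expires b t then l.pop p else l).push p r c

/-- What a level hands on at time `t`. -/
def Level.out (p b H R F t : ℕ) (l : Level) : Cand :=
  if l.Expires b t then l.cand p H R F else ⟨0, 0, 0⟩

/-- The level represents the set `S` of positions. -/
structure Level.Rep (p r : ℕ) (U P : ℕ → ℕ) (S : ℕ → Prop) (l : Level) : Prop where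
  mem : ∀ i, S i ↔ ∃ k < l.cnt, i = l.fst + k * l.gap
  fp : 0 < l.cnt → l.fp = fingerprint p r U l.fst
  gap_pos : 1 < l.cnt → 0 < l.gap
  gapPow : 1 < l.cnt → l.gapPow = r ^ l.gap % p
  gapFp : 1 < l.cnt → l.gapFp = fingerprint p r P l.gap

/-- The candidate is flagged iff the prefix of length `L` occurs as a suffix at time `t`. -/
structure Cand.Rep (p r : ℕ) (U P : ℕ → ℕ) (t L : ℕ) (c : Cand) : Prop where
  flag : c.flag ≠ 0 ↔ L ≤ t ∧ Occ U P (t - L) L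
  pos : c.flag ≠ 0 → c.pos + L = t
  fp : c.flag ≠ 0 → c.fp = fingerprint p r U c.pos

/-- The positions with age from `a` up to `b` at which the prefix of length `a` occurs. -/
def Window (U P : ℕ → ℕ) (a b t i : ℕ) : Prop := i + a ≤ t ∧ t < i + b ∧ Occ U P i a

/-- The positions of `Window` that are not due at time `t + 1`. -/
def Kept (U P : ℕ → ℕ) (a b t i : ℕ) : Prop := i + a ≤ t ∧ t + 1 < i + b ∧ Occ U P i a

section Level

variable {p r m N a b t : ℕ} {U P : ℕ → ℕ} {l : Level} {c : Cand}

theorem Level.Rep.fst_mem {S : ℕ → Prop} (h : l.Rep p r U P S) (hc : 0 < l.cnt) : S l.fst :=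
  (h.mem _).2 ⟨0, hc, by simp⟩

theorem Level.Rep.snd_mem {S : ℕ → Prop} (h : l.Rep p r U P S) (hc : 1 < l.cnt) :
    S (l.fst + l.gap) :=
  (h.mem _).2 ⟨1, hc, by simp⟩

/-- All positions of the window satisfy `t < i + b` and `fst` is the least of them, so only `fst`
can be due. -/
theorem Level.Rep.expires_iff (h : l.Rep p r U P (Window U P a b t)) :
    l.Expires b (t + 1) ↔ ∃ i, Window U P a b t i ∧ i + b = t + 1 := by
  constructor
  · exact fun he => ⟨l.fst, h.fst_mem he.1, he.2⟩
  · rintro ⟨i, hi, hib⟩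
    obtain ⟨k, hk, rfl⟩ := (h.mem i).1 hi
    have hc : 0 < l.cnt := by omega
    have := (h.fst_mem hc).2.1
    exact ⟨hc, by omega⟩

theorem Level.Rep.pop_of_expires (hp : 0 < p) (h : l.Rep p r U P (Window U P a b t))
    (hab : b ≤ 2 * a) (he : l.Expires b (t + 1)) : (l.pop p).Rep p r U P (Kept U P a b t) where
  mem i := by
    have hK : Kept U P a b t i ↔ Window U P a b t i ∧ i ≠ l.fst := by
      have := he.2
      unfold Kept Window
      constructor
      · rintro ⟨h1, h2, h3⟩
        exact ⟨⟨h1, by omega, h3⟩, by omega⟩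
      · rintro ⟨⟨h1, h2, h3⟩, h4⟩
        exact ⟨h1, by omega, h3⟩
    rw [hK, h.mem]
    constructor
    · rintro ⟨⟨k, hk, rfl⟩, h2⟩
      obtain ⟨k, rfl⟩ : ∃ l, k = l + 1 := by
        refine ⟨k - 1, ?_⟩
        rcases Nat.eq_zero_or_pos k with rfl | h3
        · simp at h2
        · omega
      exact ⟨k, by simp only [pop]; omega, by simp only [pop]; ring⟩
    · rintro ⟨k, hk, rfl⟩
      simp only [pop] at hk ⊢
      refine ⟨⟨k + 1, by omega, by ring⟩, ?_⟩
      have := h.gap_pos (by omega)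
      have := Nat.zero_le (k * l.gap)
      omega
  fp hc := by
    simp only [pop] at hc ⊢
    have h1 : 1 < l.cnt := by omega
    have hs := h.snd_mem h1
    have hf := h.fst_mem he.1
    -- Two elements of the window differ by less than `b - a ≤ a`, so the text between the first two
    -- is a prefix of the pattern whose occurrence is already known. Its fingerprint is `gapFp`,
    -- which therefore advances `fp` to the next element.
    have ho : Occ U P l.fst l.gap := hf.2.2.mono (by have := hs.1; have := hf.2.1; omega)
    rw [ho.fingerprint_add hp, h.fp he.1, h.gapPow h1, h.gapFp h1]
  gap_pos hc := h.gap_pos (by simp only [pop] at hc; omega)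
  gapPow hc := h.gapPow (by simp only [pop] at hc; omega)
  gapFp hc := h.gapFp (by simp only [pop] at hc; omega)

theorem Level.Rep.kept_of_not_expires (h : l.Rep p r U P (Window U P a b t))
    (he : ¬ l.Expires b (t + 1)) : l.Rep p r U P (Kept U P a b t) := by
  refine { h with mem := fun i => ?_ }
  rw [← h.mem]
  rw [h.expires_iff] at he
  constructor
  · exact fun ⟨h1, h2, h3⟩ => ⟨h1, by omega, h3⟩
  · exact fun hw => ⟨hw.1, lt_of_le_of_ne hw.2.1 fun h3 => he ⟨i, hw, h3.symm⟩, hw.2.2⟩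

/-- No occurrence of the longer prefix is lost: it is also an occurrence of the shorter one, hence
was in the window just before its age reached `b`. Conversely the fingerprint test is exact when
there are no collisions. -/
theorem Level.Rep.out (hp : 0 < p) (hg : NoCollision p r U P m N)
    (h : l.Rep p r U P (Window U P a b t)) (hab : a < b) (hbm : b ≤ m) (ht : t + 1 ≤ N) :
    (l.out p b (fingerprint p r P b) (r ^ b % p) (fingerprint p r U (t + 1)) (t + 1)).Rep
      p r U P (t + 1) b := by
  unfold Level.out
  split_ifs with he
  · have hf := h.fst_mem he.1
    have h1 := hg.test_iff hp (i := l.fst) (L := b) (by have := he.2; omega) hbm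
    rw [he.2] at h1
    have h2 : t + 1 - b = l.fst := by have := he.2; omega
    refine ⟨?_, fun _ => he.2, fun _ => h.fp he.1⟩
    simp only [Level.cand, h.fp he.1, h2]
    have := he.2
    by_cases ho : Occ U P l.fst b
    · rw [if_pos (h1.2 ho)]
      simp only [ho, and_true, ne_eq, one_ne_zero, not_false_iff, true_iff]
      omega
    · rw [if_neg fun h3 => ho (h1.1 h3)]
      simp [ho]
  · refine ⟨?_, by simp, by simp⟩
    rw [h.expires_iff] at he
    simp only [ne_eq, not_true, false_iff]
    rintro ⟨h1, h2⟩
    refine he ⟨t + 1 - b, ⟨by omega, by omega, h2.mono hab.le⟩, by omega⟩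

/-- The second position fixes the gap. For every later one only the counter changes, because
`Occ.gap_eq` forces it to continue the progression. The expired position has to be gone before the
insertion: only then is the spread of all positions less than `b - a ≤ a`. -/
theorem Level.Rep.push (hp : 0 < p) (h : l.Rep p r U P (Kept U P a b t))
    (hc : c.Rep p r U P (t + 1) a) (hab : a < b) (hb : b ≤ 2 * a) :
    (l.push p r c).Rep p r U P (Window U P a b (t + 1)) := by
  have hW : ∀ i, Window U P a b (t + 1) i ↔ Kept U P a b t i ∨ (c.flag ≠ 0 ∧ i = c.pos) := by
    intro i
    constructor
    · rintro ⟨h1, h2, h3⟩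
      by_cases h4 : i + a = t + 1
      · have h5 : c.flag ≠ 0 := hc.flag.2 ⟨by omega, by rwa [show t + 1 - a = i by omega]⟩
        exact Or.inr ⟨h5, by have := hc.pos h5; omega⟩
      · exact Or.inl ⟨by omega, h2, h3⟩
    · rintro (⟨h1, h2, h3⟩ | ⟨h1, rfl⟩)
      · exact ⟨by omega, h2, h3⟩
      · have h2 := hc.pos h1
        refine ⟨by omega, by omega, ?_⟩
        have := (hc.flag.1 h1).2
        rwa [show t + 1 - a = c.pos by omega] at this
  unfold Level.push
  split_ifs with h0 h1 h2
  · exact { h with mem := fun i => by rw [hW, ← h.mem]; simp [h0] }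
  · refine ⟨fun i => ?_, fun _ => hc.fp h0, by simp, by simp, by simp⟩
    rw [hW, h.mem, h1]
    simp [h0]
  · have hcl : 0 < l.cnt := by omega
    have hf := h.fst_mem hcl
    have hpos := hc.pos h0
    have hlt : l.fst < c.pos := by have := hf.1; omega
    have hgap : l.fst + (c.pos - l.fst) = c.pos := by omega
    have ho : Occ U P l.fst (c.pos - l.fst) := hf.2.2.mono (by have := hf.2.1; omega)
    refine ⟨fun i => ?_, fun _ => h.fp hcl, fun _ => by simp only; omega, fun _ => rfl, fun _ => ?_⟩
    · rw [hW, h.mem, h2]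
      constructor
      · rintro (⟨k, hk, rfl⟩ | ⟨-, rfl⟩)
        · exact ⟨0, by simp, by simp [show k = 0 by omega]⟩
        · exact ⟨1, by simp, by simp only; omega⟩
      · rintro ⟨k, hk, rfl⟩
        simp only at hk
        rcases (by omega : k = 0 ∨ k = 1) with rfl | rfl
        · exact Or.inl ⟨0, by omega, by simp⟩
        · exact Or.inr ⟨h0, by simp only; omega⟩
    · simp only
      have h3 := ho.fingerprint_add (r := r) hp
      rw [hgap, ← hc.fp h0, ← h.fp hcl] at h3
      set x := l.fp * (r ^ (c.pos - l.fst) % p)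
      rw [h3]
      have h4 : x % p ≤ p := (Nat.mod_lt _ hp).le
      -- The fingerprint of the new position is that of `fst`, advanced over the gap; undoing this
      -- leaves the fingerprint of the pattern prefix of length `gap`.
      have h5 : (x + fingerprint p r P (c.pos - l.fst)) % p + (p - x % p) ≡
          fingerprint p r P (c.pos - l.fst) [MOD p] := by
        refine Nat.ModEq.add_left_cancel' (x % p) ?_
        calc x % p + ((x + fingerprint p r P (c.pos - l.fst)) % p + (p - x % p))
            = (x + fingerprint p r P (c.pos - l.fst)) % p + p := by omega
          _ ≡ (x + fingerprint p r P (c.pos - l.fst)) % p [MOD p] := by simp [Nat.ModEq]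
          _ ≡ x + fingerprint p r P (c.pos - l.fst) [MOD p] := Nat.mod_modEq _ _
          _ ≡ x % p + fingerprint p r P (c.pos - l.fst) [MOD p] :=
            (Nat.mod_modEq _ _).symm.add_right _
      rw [h5, Nat.mod_eq_of_lt (fingerprint_lt hp ..)]
  · have hcl : 1 < l.cnt := by omega
    refine ⟨fun i => ?_, fun _ => h.fp (by omega), fun _ => h.gap_pos hcl, fun _ => h.gapPow hcl,
      fun _ => h.gapFp hcl⟩
    have hgp := h.gap_pos hcl
    have hf := h.fst_mem (by omega)
    have hpos := hc.pos h0
    obtain ⟨n, hn⟩ : ∃ n, l.cnt = n + 2 := ⟨l.cnt - 2, by omega⟩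
    have hx : Kept U P a b t (l.fst + n * l.gap) := (h.mem _).2 ⟨n, by omega, rfl⟩
    have hy : Kept U P a b t (l.fst + n * l.gap + l.gap) :=
      (h.mem _).2 ⟨n + 1, by omega, by ring⟩
    set x := l.fst + n * l.gap with hxdef
    have hz := ((hW c.pos).2 (Or.inr ⟨h0, rfl⟩)).2.2
    have hzz : x + l.gap + (c.pos - (x + l.gap)) = c.pos := by have := hy.1; omega
    -- The last two stored positions and the new one are consecutive occurrences: anything between
    -- them would be in `Kept` and so a term of the progression.
    have key : c.pos - (x + l.gap) = l.gap := by
      refine hx.2.2.gap_eq hy.2.2 (by rwa [hzz]) ?_ ?_ ?_ hgp ?_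
      · have := hx.2.1; have := hy.1; omega
      · intro i h3 h4 h5
        obtain ⟨k, hk, rfl⟩ := (h.mem i).1 ⟨by have := hy.1; omega, by have := hx.2.1; omega, h5⟩
        have h6 : n < k := by
          by_contra h7
          have := Nat.mul_le_mul_right l.gap (show k ≤ n by omega)
          omega
        have := Nat.mul_le_mul_right l.gap (show n + 1 ≤ k by omega)
        rw [Nat.add_mul] at this
        omega
      · intro i h3 h4 h5
        obtain ⟨k, hk, rfl⟩ := (h.mem i).1 ⟨by omega, by have := hx.2.1; omega, h5⟩
        have := Nat.mul_le_mul_right l.gap (show k ≤ n + 1 by omega)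
        rw [Nat.add_mul] at this
        omega
      · have := hy.1; omega
    have hcpos : c.pos = l.fst + l.cnt * l.gap := by
      rw [hn, Nat.add_mul]
      omega
    rw [hW, h.mem]
    constructor
    · rintro (⟨k, hk, rfl⟩ | ⟨-, rfl⟩)
      · exact ⟨k, by simp only; omega, rfl⟩
      · exact ⟨l.cnt, by simp, hcpos⟩
    · rintro ⟨k, hk, rfl⟩
      simp only at hk
      rcases (by omega : k < l.cnt ∨ k = l.cnt) with h3 | rfl
      · exact Or.inl ⟨k, h3, rfl⟩
      · exact Or.inr ⟨h0, hcpos.symm⟩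

theorem Level.Rep.next (hp : 0 < p) (h : l.Rep p r U P (Window U P a b t))
    (hc : c.Rep p r U P (t + 1) a) (hab : a < b) (hb : b ≤ 2 * a) :
    (l.next p r b (t + 1) c).Rep p r U P (Window U P a b (t + 1)) := by
  unfold Level.next
  split_ifs with he
  · exact (h.pop_of_expires hp hb he).push hp hc hab hb
  · exact (h.kept_of_not_expires he).push hp hc hab hb

end Level


/-! ### Collisions are rare -/

open Polynomial in
/-- The polynomial whose value at `r` is the difference of the fingerprints of `u` and `v`. -/
noncomputable def diffPoly (p : ℕ) (u v : ℕ → ℕ) : ℕ → (ZMod p)[X]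
  | 0 => 0
  | n + 1 => diffPoly p u v n * X + C ((u n : ZMod p) - v n)

theorem diffPoly_eval (p r : ℕ) (u v : ℕ → ℕ) (n : ℕ) :
    (diffPoly p u v n).eval (r : ZMod p) =
      (fingerprint p r u n : ZMod p) - fingerprint p r v n := by
  induction n with
  | zero => simp [diffPoly, fingerprint]
  | succ n ih =>
    simp only [diffPoly, fingerprint, Polynomial.eval_add, Polynomial.eval_mul, ih,
      Polynomial.eval_X, Polynomial.eval_C, ZMod.natCast_mod, Nat.cast_add, Nat.cast_mul]
    ring

theorem diffPoly_natDegree_le (p : ℕ) (u v : ℕ → ℕ) (n : ℕ) :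
    (diffPoly p u v n).natDegree ≤ n := by
  induction n with
  | zero => simp [diffPoly]
  | succ n ih =>
    refine Polynomial.natDegree_add_le_of_degree_le ?_ ?_
    · exact Polynomial.natDegree_mul_le.trans (add_le_add ih Polynomial.natDegree_X_le)
    · exact (Polynomial.natDegree_C _).le.trans (Nat.zero_le _)

/-- The coefficients are the differences of the symbols modulo `p`, and symbols below `p` are
determined by their residues. -/
theorem eq_of_diffPoly_eq_zero {p : ℕ} {u v : ℕ → ℕ} {n : ℕ} (hu : ∀ k, u k < p)
    (hv : ∀ k, v k < p) (h : diffPoly p u v n = 0) : ∀ k < n, u k = v k := by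
  induction n with
  | zero => intro k hk; omega
  | succ n ih =>
    have h0 : ((u n : ZMod p) - v n) = 0 := by
      have := congrArg (fun q => Polynomial.coeff q 0) h
      simpa [diffPoly] using this
    have h1 : diffPoly p u v n = 0 := by
      ext i
      have := congrArg (fun q => Polynomial.coeff q (i + 1)) h
      simpa [diffPoly, Polynomial.coeff_C_succ] using this
    intro k hk
    rcases (by omega : k < n ∨ k = n) with h2 | rfl
    · exact ih h1 k h2
    · rw [sub_eq_zero, ZMod.natCast_eq_natCast_iff] at h0
      exact h0.eq_of_lt_of_lt (hu k) (hv k)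

/-- The evaluation points where the fingerprints agree are roots of a nonzero polynomial of degree
at most `n` over a field; `B ≤ p` keeps the points distinct modulo `p`. -/
theorem card_fingerprint_eq_le {p : ℕ} (hp : p.Prime) {B : ℕ} (hB : B ≤ p) {u v : ℕ → ℕ} {n : ℕ}
    (hu : ∀ k, u k < p) (hv : ∀ k, v k < p) (h : ¬ ∀ k < n, u k = v k) :
    ((Finset.range B).filter fun r => fingerprint p r u n = fingerprint p r v n).card ≤ n := by
  have : Fact p.Prime := ⟨hp⟩
  have hne : diffPoly p u v n ≠ 0 := fun h0 => h (eq_of_diffPoly_eq_zero hu hv h0)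
  calc _ ≤ (diffPoly p u v n).roots.toFinset.card := by
        refine Finset.card_le_card_of_injOn (fun r => (r : ZMod p)) ?_ ?_
        · intro r hr
          simp only [Finset.coe_filter, Finset.mem_range, Set.mem_ofPred_eq] at hr
          simp only [Finset.mem_coe, Multiset.mem_toFinset, Polynomial.mem_roots hne,
            Polynomial.IsRoot.def, diffPoly_eval, hr.2, sub_self]
        · intro r hr s hs hrs
          simp only [Finset.coe_filter, Finset.mem_range, Set.mem_ofPred_eq] at hr hs
          rw [ZMod.natCast_eq_natCast_iff] at hrs
          exact hrs.eq_of_lt_of_lt (by omega) (by omega)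
    _ ≤ _ := Multiset.toFinset_card_le _
    _ ≤ _ := Polynomial.card_roots' _
    _ ≤ n := diffPoly_natDegree_le ..

-- Union bound over at most `N * m` pairs of a position and a length, each spoiled by at most `m`
-- evaluation points.
open Classical in
theorem card_collision_le {p : ℕ} (hp : p.Prime) {B : ℕ} (hB : B ≤ p) {U P : ℕ → ℕ}
    (hU : ∀ k, U k < p) (hP : ∀ k, P k < p) (m N : ℕ) :
    ((Finset.range B).filter fun r => ¬ NoCollision p r U P m N).card ≤ N * m * m := by
  let bad : ℕ × ℕ → Finset ℕ := fun x => (Finset.range B).filter fun r =>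
    fingerprint p r (fun k => U (x.1 + k)) x.2 = fingerprint p r P x.2 ∧ ¬ Occ U P x.1 x.2
  have hbad : ∀ x ∈ Finset.range N ×ˢ Finset.Icc 1 m, (bad x).card ≤ m := by
    intro x hx
    simp only [Finset.mem_product, Finset.mem_Icc] at hx
    by_cases ho : Occ U P x.1 x.2
    · simp [bad, ho]
    · simp only [bad, ho, not_false_iff, and_true]
      exact (card_fingerprint_eq_le hp hB (fun k => hU _) hP ho).trans hx.2.2
  calc _ ≤ ((Finset.range N ×ˢ Finset.Icc 1 m).biUnion bad).card := by
        refine Finset.card_le_card fun r hr => ?_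
        simp only [Finset.mem_filter, NoCollision, not_forall] at hr
        obtain ⟨hrB, i, L, h1, h2, h3, h4⟩ := hr
        -- The empty prefix occurs everywhere and cannot collide, so lengths start at `1` and
        -- positions stay below `N`.
        have hL : L ≠ 0 := by
          rintro rfl
          exact h4 fun k hk => by omega
        simp only [Finset.mem_biUnion, Finset.mem_product, Finset.mem_range, Finset.mem_Icc]
        exact ⟨(i, L), ⟨by omega, by omega, h2⟩, by simp [bad, h3, h4, Finset.mem_range.1 hrB]⟩
    _ ≤ ∑ x ∈ Finset.range N ×ˢ Finset.Icc 1 m, (bad x).card := Finset.card_biUnion_le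
    _ ≤ ∑ x ∈ Finset.range N ×ˢ Finset.Icc 1 m, m := Finset.sum_le_sum hbad
    _ = N * m * m := by simp

/-! ### Reduction to exact matching -/

theorem exists_le_or (f : ℕ → ℕ) (n : ℕ) : ∃ i, n ≤ i ∨ f i ≠ 0 := ⟨n, Or.inl le_rfl⟩

/-- The first `i < n` with `f i ≠ 0`, or `n` if there is none. -/
def firstIdx (f : ℕ → ℕ) (n : ℕ) : ℕ := Nat.find (exists_le_or f n)

theorem firstIdx_le (f : ℕ → ℕ) (n : ℕ) : firstIdx f n ≤ n := Nat.find_le (Or.inl le_rfl)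

theorem apply_firstIdx {f : ℕ → ℕ} {n : ℕ} (h : firstIdx f n < n) : f (firstIdx f n) ≠ 0 :=
  (Nat.find_spec (exists_le_or f n)).resolve_left (by unfold firstIdx at h; omega)

theorem firstIdx_lt {f : ℕ → ℕ} {n i : ℕ} (hi : i < n) (h : f i ≠ 0) : firstIdx f n < n :=
  (Nat.find_le (Or.inr h)).trans_lt hi

theorem firstIdx_eq {f : ℕ → ℕ} {n i : ℕ} (hi : i ≤ n) (hlt : ∀ j < i, f j = 0)
    (h : n ≤ i ∨ f i ≠ 0) : firstIdx f n = i :=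
  (Nat.find_eq_iff _).2 ⟨h, fun j hj => by have := hlt j hj; omega⟩

/-- The code of a text symbol: the number, plus one, of the first pattern symbol that matches it. -/
def textCode (rel : ℕ → ℕ → ℕ) (nP a : ℕ) : ℕ := firstIdx (fun x => rel x a) nP + 1

/-- The code of a pattern symbol: the code of the first text symbol that it matches; symbols that
match nothing have a code of their own. -/
def patCode (rel : ℕ → ℕ → ℕ) (nP nT x : ℕ) : ℕ :=
  textCode rel nP (firstIdx (rel x) nT) + if firstIdx (rel x) nT = nT then 1 else 0

theorem textCode_pos (rel : ℕ → ℕ → ℕ) (nP a : ℕ) : 0 < textCode rel nP a := Nat.succ_pos _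

theorem textCode_le (rel : ℕ → ℕ → ℕ) (nP a : ℕ) : textCode rel nP a ≤ nP + 1 :=
  Nat.succ_le_succ (firstIdx_le ..)

theorem patCode_le (rel : ℕ → ℕ → ℕ) (nP nT x : ℕ) : patCode rel nP nT x ≤ nP + 2 := by
  have := textCode_le rel nP (firstIdx (rel x) nT)
  unfold patCode
  split_ifs <;> omega

theorem patCode_pos (rel : ℕ → ℕ → ℕ) (nP nT x : ℕ) : 0 < patCode rel nP nT x :=
  Nat.add_pos_left (textCode_pos ..) _

/-! ### Relations without the wildcard matrix. -/

section Rel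

variable {nP nT : ℕ} {Δ : Fin nP → Fin nT → Bool}

theorem relFun_ne_zero {x a : ℕ} :
    relFun Δ x a ≠ 0 ↔ ∃ (hx : x < nP) (ha : a < nT), Δ ⟨x, hx⟩ ⟨a, ha⟩ = true := by
  unfold relFun
  split_ifs with h
  · simp [h.1, h.2]
  · simp only [ne_eq, not_true, false_iff]
    rintro ⟨hx, ha, -⟩
    exact h ⟨hx, ha⟩

/-- Without the wildcard matrix, matching is a union of complete bipartite graphs. -/
theorem rel_of_not_containsWildcard (h : ¬ ContainsWildcard (relMatrix Δ)) {x y a b : ℕ}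
    (hxa : relFun Δ x a ≠ 0) (hxb : relFun Δ x b ≠ 0) (hya : relFun Δ y a ≠ 0) :
    relFun Δ y b ≠ 0 := by
  obtain ⟨hx, ha, h1⟩ := relFun_ne_zero.1 hxa
  obtain ⟨_, hb, h2⟩ := relFun_ne_zero.1 hxb
  obtain ⟨hy, _, h3⟩ := relFun_ne_zero.1 hya
  refine relFun_ne_zero.2 ⟨hy, hb, ?_⟩
  by_contra h4
  rw [Bool.not_eq_true] at h4
  have hxy : (⟨x, hx⟩ : Fin nP) ≠ ⟨y, hy⟩ := fun he => by rw [he, h4] at h2; simp at h2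
  have hab : (⟨a, ha⟩ : Fin nT) ≠ ⟨b, hb⟩ := fun he => by rw [he, h4] at h3; simp at h3
  refine h ⟨![⟨x, hx⟩, ⟨y, hy⟩], ![⟨a, ha⟩, ⟨b, hb⟩], ?_, ?_, ?_⟩
  · intro i j hij
    fin_cases i <;> fin_cases j <;> simp_all
  · intro i j hij
    fin_cases i <;> fin_cases j <;> simp_all
  · ext i j
    fin_cases i <;> fin_cases j <;> simp [relMatrix, wildcardMatrix, h1, h2, h3, h4]

theorem patCode_eq_textCode_iff (h : ¬ ContainsWildcard (relMatrix Δ)) (x : Fin nP) (a : Fin nT) :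
    patCode (relFun Δ) nP nT x = textCode (relFun Δ) nP a ↔ Δ x a = true := by
  have hΔ : Δ x a = true ↔ relFun Δ x a ≠ 0 := by
    rw [relFun_ne_zero]
    exact ⟨fun h1 => ⟨x.2, a.2, h1⟩, fun ⟨_, _, h1⟩ => h1⟩
  rw [hΔ]
  set b := firstIdx (relFun Δ x) nT with hb
  unfold patCode
  rw [← hb]
  constructor
  · intro he
    -- If `x` matches nothing, then `b = nT` lies outside the text alphabet, where `relFun`
    -- vanishes. The code of `x` is then `nP + 2`, larger than every text code.
    by_cases hbT : b = nT
    · have h1 : firstIdx (fun y => relFun Δ y b) nP = nP := by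
        refine firstIdx_eq le_rfl (fun y _ => ?_) (Or.inl le_rfl)
        by_contra h2
        obtain ⟨-, h3, -⟩ := relFun_ne_zero.1 h2
        omega
      have h2 := textCode_le (relFun Δ) nP a
      rw [if_pos hbT, textCode, h1] at he
      omega
    · have hxb : relFun Δ x b ≠ 0 := apply_firstIdx (by have := firstIdx_le (relFun Δ x) nT; omega)
      rw [if_neg hbT, textCode, textCode, add_zero, add_left_inj] at he
      have h1 : firstIdx (fun y => relFun Δ y b) nP < nP :=
        firstIdx_lt (f := fun y => relFun Δ y b) x.2 hxb
      -- Equal codes give one pattern symbol that matches both `b` and `a`. As `x` matches `b`, it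
      -- lies in the same component and matches `a`.
      have h2 := apply_firstIdx h1
      have h3 := apply_firstIdx (he ▸ h1)
      rw [← he] at h3
      exact rel_of_not_containsWildcard h h2 h3 hxb
  · intro hxa
    have h1 : b < nT := firstIdx_lt a.2 hxa
    have hxb : relFun Δ x b ≠ 0 := apply_firstIdx h1
    rw [if_neg h1.ne, add_zero, textCode, textCode, add_left_inj]
    set y := firstIdx (fun y => relFun Δ y (a : ℕ)) nP with hy
    have hyP : y < nP := firstIdx_lt (f := fun y => relFun Δ y (a : ℕ)) x.2 hxa
    refine firstIdx_eq hyP.le (fun z hz => ?_) (Or.inr ?_)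
    · by_contra hzb
      have h2 := rel_of_not_containsWildcard h hxb hxa hzb
      exact Nat.find_min (exists_le_or (fun y => relFun Δ y (a : ℕ)) nP) hz (Or.inr h2)
    · exact rel_of_not_containsWildcard h hxa hxb (apply_firstIdx hyP)

end Rel


/-! ### Memory layout

Cell `0` holds the input and the output, and the cells `1`, …, `7` hold `nP`, `nT`, `m`, the modulus,
the evaluation point, the code of the first pattern symbol and the number of levels. Cell `8` holds
the code of the current text symbol. The algorithm runs two copies `b = 0, 1` of the matcher; the
cells `9 + 2 * b` and `10 + 2 * b` hold the time and the fingerprint of the text of copy `b`.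
The cells from `13` to `31` are for temporary use: `13` holds the number of a level, `14`–`16` the
candidate for this level, `17`–`19` that for the next level, `20` the new fingerprint of the text.
From cell `32` on, sixteen cells belong to each level: six for each copy, then the length of the
prefix that is tested when a position leaves the level, its fingerprint, and a power of the
evaluation point. -/

/-- The address of the cell with number `i` of level `j`. -/
abbrev cell (i j : ℕ) : ℕ := 32 + i + 16 * j

/-- Level `j` of copy `b`. -/
def lvl (σ : Mem) (b j : ℕ) : Level :=
  ⟨σ (cell (6 * b) j), σ (cell (6 * b + 1) j), σ (cell (6 * b + 2) j), σ (cell (6 * b + 3) j),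
    σ (cell (6 * b + 4) j), σ (cell (6 * b + 5) j)⟩

/-- The address `a` is not in level `j` of copy `b`. -/
def OffLevel (b j a : ℕ) : Prop := a < cell (6 * b) j ∨ cell (6 * b) j + 6 ≤ a

/-- The number of the cell `i` of the level whose number is in cell `13`. -/
abbrev arr (i : ℕ) : Expr := .op .add (.const (32 + i)) (.op .mul (.const 16) (var 13))

/-- The content of that cell. -/
abbrev get (i : ℕ) : Expr := .load (arr i)

section Programs

variable {E : Env} {k w : ℕ} {Q : Mem → Prop} {σ : Mem}

/-! ### Powers -/

/-- The power of the evaluation point whose exponent is in cell `22`, in cell `21`. -/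
def powCmd : Cmd :=
  .seq (set 21 (.const 1)) <|
  .while (var 22) <|
    .seq (set 21 (.op .mod (.op .mul (var 21) (var 5)) (var 4))) <|
    set 22 (.op .sub (var 22) (.const 1))

theorem powCmd_wp (hk : 23 ≤ k) (hp : 1 < σ 4)
    (h : Q (Function.update (Function.update σ 21 (σ 5 ^ σ 22 % σ 4)) 22 0)) :
    Wp E k w powCmd Q σ := by
  refine Wp.of_fits fun hf => ?_
  have hw := hf.1 4
  refine Wp.seq_store (by simp only [Expr.eval]; omega) (by simp only [Expr.eval]; omega) ?_
  simp only [Expr.eval]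
  -- Here `e` is the number of multiplications still to be done.
  refine Wp.while (fun τ => ∃ e ≤ σ 22,
    τ = Function.update (Function.update σ 21 (σ 5 ^ (σ 22 - e) % σ 4)) 22 e)
    (fun τ => τ 22) ?_ ?_ ?_
  · refine ⟨σ 22, le_rfl, ?_⟩
    rw [Nat.sub_self, pow_zero, Nat.mod_eq_of_lt hp]
    funext a
    by_cases ha : a = 22
    · subst ha
      simp (disch := omega) only [upd_eq, upd_ne]
    · simp (disch := omega) only [upd_ne]
  · rintro τ ⟨e, he, rfl⟩ h0
    simp only [Expr.eval, upd_eq] at h0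
    refine Wp.seq_store (by simp only [Expr.eval]; omega) ?_ ?_
    · simp (disch := omega) only [Expr.eval, Op.arith_eval, upd_eq, upd_ne]
      exact (Nat.mod_lt _ (by omega)).trans hw
    simp (disch := omega) only [Expr.eval, Op.arith_eval, upd_eq, upd_ne]
    refine Wp.store (by simp only [Expr.eval]; omega) ?_ ?_
    · simp (disch := omega) only [Expr.eval, Op.arith_eval, upd_eq, upd_ne]
      have := hf.1 22
      omega
    simp (disch := omega) only [Expr.eval, Op.arith_eval, upd_eq, upd_ne]
    refine ⟨⟨e - 1, by omega, ?_⟩, by omega⟩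
    funext a
    by_cases ha : a = 22
    · subst ha
      simp (disch := omega) only [upd_eq]
    by_cases ha' : a = 21
    · subst ha'
      simp (disch := omega) only [upd_eq, upd_ne]
      rw [show σ 22 - (e - 1) = σ 22 - e + 1 by omega, pow_succ, Nat.mod_mul_mod]
    · simp (disch := omega) only [upd_ne]
  · rintro τ ⟨e, he, rfl⟩ h0
    simp only [Expr.eval, upd_eq] at h0
    subst h0
    exact h

/-! ### One level -/

/-- Insertion of the candidate into a level of copy `b`. -/
def pushCmd (b : ℕ) : Cmd :=
  .ite (var 14)
    (.ite (get (6 * b))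
      (.ite (.op .eq (get (6 * b)) (.const 1))
        (.seq (.store (arr (6 * b + 3)) (.op .sub (var 15) (get (6 * b + 1)))) <|
          .seq (set 22 (get (6 * b + 3))) <|
          .seq powCmd <|
          .seq (.store (arr (6 * b + 4)) (var 21)) <|
          .seq (.store (arr (6 * b + 5)) (.op .mod (.op .add (var 16) (.op .sub (var 4)
            (.op .mod (.op .mul (get (6 * b + 2)) (get (6 * b + 4))) (var 4)))) (var 4))) <|
          .store (arr (6 * b)) (.const 2))
        (.store (arr (6 * b)) (.op .add (get (6 * b)) (.const 1))))
      (.seq (.store (arr (6 * b + 1)) (var 15)) <|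
        .seq (.store (arr (6 * b + 2)) (var 16)) <|
        .store (arr (6 * b)) (.const 1)))
    .skip

/-- The frame condition exempts cells `21` and `22`, the working cells of `powCmd`; the bound on
`cnt` lets the incremented counter fit in a word. -/
theorem pushCmd_wp {b : ℕ} (hb : b ≤ 1) (hk : cell 15 (σ 13) < k) (hp : 1 < σ 4)
    (hcnt : (lvl σ b (σ 13)).cnt + 1 < 2 ^ w)
    (h : ∀ τ, lvl τ b (σ 13) = (lvl σ b (σ 13)).push (σ 4) (σ 5) ⟨σ 14, σ 15, σ 16⟩ →
      (∀ a, a ≠ 21 → a ≠ 22 → OffLevel b (σ 13) a → τ a = σ a) → Q τ) :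
    Wp E k w (pushCmd b) Q σ := by
  refine Wp.of_fits fun hf => ?_
  have hw := hf.1 4
  simp only [lvl, Level.push] at h hcnt
  simp only [cell] at h hk hcnt
  refine Wp.ite (fun h14 => ?_) (fun h14 => ?_)
  · simp only [Expr.eval] at h14
    simp only [h14, if_false] at h
    refine Wp.ite (fun h0 => ?_) (fun h0 => ?_)
    · simp only [Expr.eval, Op.arith_eval] at h0
      simp only [h0, if_false] at h
      refine Wp.ite (fun h1 => ?_) (fun h1 => ?_)
      · simp only [Expr.eval, Op.arith_eval, ne_eq, Op.eval_eq_eq_zero, not_not] at h1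
        simp only [h1, if_true] at h
        refine Wp.seq_store (by simp only [Expr.eval, Op.arith_eval]; omega) ?_ ?_
        · simp only [Expr.eval, Op.arith_eval]
          have := hf.1 15
          omega
        simp only [Expr.eval, Op.arith_eval]
        refine Wp.seq_store (by simp only [Expr.eval]; omega) ?_ ?_
        · simp (disch := omega) only [Expr.eval, Op.arith_eval, upd_eq, upd_ne]
          have := hf.1 15
          omega
        simp (disch := omega) only [Expr.eval, Op.arith_eval, upd_eq, upd_ne]
        refine Wp.seq (powCmd_wp (by omega) ?_ ?_)
        · simp (disch := omega) only [upd_ne]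
          exact hp
        simp (disch := omega) only [upd_eq, upd_ne]
        refine Wp.seq_store ?_ ?_ ?_
        · simp (disch := omega) only [Expr.eval, Op.arith_eval, upd_ne]
          omega
        · simp (disch := omega) only [Expr.eval, upd_eq, upd_ne]
          exact (Nat.mod_lt _ (by omega)).trans hw
        simp (disch := omega) only [Expr.eval, Op.arith_eval, upd_eq, upd_ne]
        refine Wp.seq_store ?_ ?_ ?_
        · simp (disch := omega) only [Expr.eval, Op.arith_eval, upd_ne]
          omega
        · simp (disch := omega) only [Expr.eval, Op.arith_eval, upd_eq, upd_ne]
          exact (Nat.mod_lt _ (by omega)).trans hw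
        simp (disch := omega) only [Expr.eval, Op.arith_eval, upd_eq, upd_ne]
        refine Wp.store ?_ ?_ ?_
        · simp (disch := omega) only [Expr.eval, Op.arith_eval, upd_ne]
          omega
        · simp only [Expr.eval]
          omega
        simp (disch := omega) only [Expr.eval, Op.arith_eval, upd_ne]
        refine h _ ?_ ?_
        · simp (disch := omega) only [upd_eq, upd_ne]
        · intro a h21 h22 ha
          simp only [OffLevel, cell] at ha
          simp (disch := omega) only [upd_ne]
      · simp only [Expr.eval, Op.arith_eval, Op.eval_eq_eq_zero] at h1
        simp only [h1, if_false] at h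
        refine Wp.store (by simp only [Expr.eval, Op.arith_eval]; omega)
          (by simp only [Expr.eval, Op.arith_eval]; omega) ?_
        simp only [Expr.eval, Op.arith_eval]
        refine h _ ?_ ?_
        · simp (disch := omega) only [upd_eq, upd_ne]
        · intro a _ _ ha
          simp only [OffLevel, cell] at ha
          simp (disch := omega) only [upd_ne]
    · simp only [Expr.eval, Op.arith_eval] at h0
      simp only [h0, if_true] at h
      refine Wp.seq_store (by simp only [Expr.eval, Op.arith_eval]; omega) (hf.1 15) ?_
      simp only [Expr.eval, Op.arith_eval]
      refine Wp.seq_store ?_ ?_ ?_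
      · simp (disch := omega) only [Expr.eval, Op.arith_eval, upd_ne]
        omega
      · simp (disch := omega) only [Expr.eval, upd_ne]
        exact hf.1 16
      simp (disch := omega) only [Expr.eval, Op.arith_eval, upd_ne]
      refine Wp.store ?_ ?_ ?_
      · simp (disch := omega) only [Expr.eval, Op.arith_eval, upd_ne]
        omega
      · simp only [Expr.eval]
        omega
      simp (disch := omega) only [Expr.eval, Op.arith_eval, upd_ne]
      refine h _ ?_ ?_
      · simp (disch := omega) only [upd_eq, upd_ne]
      · intro a _ _ ha
        simp only [OffLevel, cell] at ha
        simp (disch := omega) only [upd_ne]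
  · simp only [Expr.eval] at h14
    exact Wp.skip (h σ (by simp [h14]) fun _ _ _ _ => rfl)

/-- Removal of the first position of a level of copy `b` if it is due. -/
def popCmd (b : ℕ) : Cmd :=
  .ite (.op .mul (.op .lt (.const 0) (get (6 * b)))
      (.op .eq (.op .add (get (6 * b + 1)) (get 12)) (var (9 + 2 * b))))
    (.seq (set 17 (.op .eq (.op .mod (.op .add (.op .mul (get (6 * b + 2)) (get 14)) (get 13))
        (var 4)) (var 20))) <|
      .seq (set 18 (get (6 * b + 1))) <|
      .seq (set 19 (get (6 * b + 2))) <|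
      .seq (.store (arr (6 * b)) (.op .sub (get (6 * b)) (.const 1))) <|
      .seq (.store (arr (6 * b + 1)) (.op .add (get (6 * b + 1)) (get (6 * b + 3)))) <|
      .store (arr (6 * b + 2)) (.op .mod (.op .add (.op .mul (get (6 * b + 2)) (get (6 * b + 4)))
        (get (6 * b + 5))) (var 4)))
    (.seq (set 17 (.const 0)) <| .seq (set 18 (.const 0)) <| set 19 (.const 0))

theorem popCmd_wp {b : ℕ} (hb : b ≤ 1) (hk : cell 15 (σ 13) < k) (hp : 1 < σ 4)
    (hfst : (lvl σ b (σ 13)).fst + (lvl σ b (σ 13)).gap < 2 ^ w)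
    (h : ∀ τ, lvl τ b (σ 13) = (if (lvl σ b (σ 13)).Expires (σ (cell 12 (σ 13))) (σ (9 + 2 * b))
        then (lvl σ b (σ 13)).pop (σ 4) else lvl σ b (σ 13)) →
      (⟨τ 17, τ 18, τ 19⟩ : Cand) = (lvl σ b (σ 13)).out (σ 4) (σ (cell 12 (σ 13)))
        (σ (cell 13 (σ 13))) (σ (cell 14 (σ 13))) (σ 20) (σ (9 + 2 * b)) →
      (∀ a, (a < 17 ∨ 19 < a) → OffLevel b (σ 13) a → τ a = σ a) → Q τ) :
    Wp E k w (popCmd b) Q σ := by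
  refine Wp.of_fits fun hf => ?_
  have hw := hf.1 4
  simp only [lvl, Level.out, Level.Expires, Level.pop, Level.cand] at h hfst
  simp only [cell] at h hk hfst
  refine Wp.ite (fun h0 => ?_) (fun h0 => ?_)
  · have h1 : 0 < σ (32 + 6 * b + 16 * σ 13) ∧
        σ (32 + (6 * b + 1) + 16 * σ 13) + σ (32 + 12 + 16 * σ 13) = σ (9 + 2 * b) := by
      simpa only [Expr.eval, Op.arith_eval, ne_eq, mul_eq_zero, not_or, Op.eval_lt_eq_zero,
        Op.eval_eq_eq_zero, not_le, not_not] using h0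
    simp only [h1, and_self, if_true] at h
    refine Wp.seq_store (by simp only [Expr.eval]; omega) ?_ ?_
    · simp only [Expr.eval, Op.arith_eval]
      exact (Op.eval_eq_le _ _).trans_lt (by omega)
    simp only [Expr.eval, Op.arith_eval]
    refine Wp.seq_store (by simp only [Expr.eval]; omega) ?_ ?_
    · simp (disch := omega) only [Expr.eval, Op.arith_eval, upd_ne]
      exact hf.1 _
    simp (disch := omega) only [Expr.eval, Op.arith_eval, upd_ne]
    refine Wp.seq_store (by simp only [Expr.eval]; omega) ?_ ?_
    · simp (disch := omega) only [Expr.eval, Op.arith_eval, upd_ne]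
      exact hf.1 _
    simp (disch := omega) only [Expr.eval, Op.arith_eval, upd_ne]
    refine Wp.seq_store ?_ ?_ ?_
    · simp (disch := omega) only [Expr.eval, Op.arith_eval, upd_ne]
      omega
    · simp (disch := omega) only [Expr.eval, Op.arith_eval, upd_ne]
      have := hf.1 (32 + 6 * b + 16 * σ 13)
      omega
    simp (disch := omega) only [Expr.eval, Op.arith_eval, upd_ne]
    refine Wp.seq_store ?_ ?_ ?_
    · simp (disch := omega) only [Expr.eval, Op.arith_eval, upd_ne]
      omega
    · simp (disch := omega) only [Expr.eval, Op.arith_eval, upd_ne]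
      exact hfst
    simp (disch := omega) only [Expr.eval, Op.arith_eval, upd_ne]
    refine Wp.store ?_ ?_ ?_
    · simp (disch := omega) only [Expr.eval, Op.arith_eval, upd_ne]
      omega
    · simp (disch := omega) only [Expr.eval, Op.arith_eval, upd_ne]
      exact (Nat.mod_lt _ (by omega)).trans hw
    simp (disch := omega) only [Expr.eval, Op.arith_eval, upd_ne]
    refine h _ ?_ ?_ ?_
    · simp (disch := omega) only [upd_eq, upd_ne]
    · simp (disch := omega) only [upd_eq, upd_ne, Op.eval_eq_eq]
      rfl
    · intro a ha' ha
      simp only [OffLevel, cell] at ha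
      simp (disch := omega) only [upd_ne]
  · have h1 : ¬ (0 < σ (32 + 6 * b + 16 * σ 13) ∧
        σ (32 + (6 * b + 1) + 16 * σ 13) + σ (32 + 12 + 16 * σ 13) = σ (9 + 2 * b)) := by
      simpa only [Expr.eval, Op.arith_eval, mul_eq_zero, Op.eval_lt_eq_zero,
        Op.eval_eq_eq_zero, not_and_or, not_lt] using h0
    simp only [h1, if_false] at h
    refine Wp.seq_store (by simp only [Expr.eval]; omega) (by simp only [Expr.eval]; omega) ?_
    refine Wp.seq_store (by simp only [Expr.eval]; omega) (by simp only [Expr.eval]; omega) ?_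
    refine Wp.store (by simp only [Expr.eval]; omega) (by simp only [Expr.eval]; omega) ?_
    simp only [Expr.eval]
    refine h _ ?_ ?_ ?_
    · simp (disch := omega) only [upd_ne]
    · simp (disch := omega) only [upd_eq, upd_ne]
    · intro a ha' ha
      simp (disch := omega) only [upd_ne]

/-- What copy `b` does at a level. -/
def levelCmd (b : ℕ) : Cmd :=
  .seq (popCmd b) <|
  .seq (pushCmd b) <|
  .seq (set 14 (var 17)) <|
  .seq (set 15 (var 18)) <|
  .seq (set 16 (var 19)) <|
  set 13 (.op .add (var 13) (.const 1))

/-- What level `j` of copy `b` hands on. -/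
def lvlOut (σ : Mem) (b j : ℕ) : Cand :=
  (lvl σ b j).out (σ 4) (σ (cell 12 j)) (σ (cell 13 j)) (σ (cell 14 j)) (σ 20) (σ (9 + 2 * b))

/-- The level `j` of copy `b` after the arrival of the candidate `c`. -/
def lvlNext (σ : Mem) (b j : ℕ) (c : Cand) : Level :=
  (lvl σ b j).next (σ 4) (σ 5) (σ (cell 12 j)) (σ (9 + 2 * b)) c

/-- The outgoing candidate waits in cells `17`–`19` while the incoming one in `14`–`16` is still
needed for the insertion; afterwards it becomes the incoming candidate of the next level. -/
theorem levelCmd_wp {b : ℕ} (hb : b ≤ 1) (hk : cell 15 (σ 13) < k) (hp : 1 < σ 4)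
    (hcnt : (lvl σ b (σ 13)).cnt + 1 < 2 ^ w)
    (hfst : (lvl σ b (σ 13)).fst + (lvl σ b (σ 13)).gap < 2 ^ w)
    (hj : σ 13 + 1 < 2 ^ w)
    (h : ∀ τ, lvl τ b (σ 13) = lvlNext σ b (σ 13) ⟨σ 14, σ 15, σ 16⟩ →
      (⟨τ 14, τ 15, τ 16⟩ : Cand) = lvlOut σ b (σ 13) → τ 13 = σ 13 + 1 →
      (∀ a, (a < 13 ∨ 22 < a) → OffLevel b (σ 13) a → τ a = σ a) → (τ 20 = σ 20) → Q τ) :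
    Wp E k w (levelCmd b) Q σ := by
  refine Wp.seq (popCmd_wp hb hk hp hfst fun τ h1 h2 h3 => ?_)
  have h13 : τ 13 = σ 13 := h3 _ (by omega) (by simp only [OffLevel, cell]; omega)
  have h4 : τ 4 = σ 4 := h3 _ (by omega) (by simp only [OffLevel, cell]; omega)
  have h5 : τ 5 = σ 5 := h3 _ (by omega) (by simp only [OffLevel, cell]; omega)
  have h14 : τ 14 = σ 14 := h3 _ (by omega) (by simp only [OffLevel, cell]; omega)
  have h15 : τ 15 = σ 15 := h3 _ (by omega) (by simp only [OffLevel, cell]; omega)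
  have h16 : τ 16 = σ 16 := h3 _ (by omega) (by simp only [OffLevel, cell]; omega)
  have h20 : τ 20 = σ 20 := h3 _ (by omega) (by simp only [OffLevel, cell]; omega)
  refine Wp.seq (pushCmd_wp hb (by rwa [h13]) (by rwa [h4]) ?_ fun υ h6 h7 => ?_)
  · rw [h13, h1]
    split_ifs
    · simp only [Level.pop]
      omega
    · exact hcnt
  rw [h13] at h6 h7
  rw [h1, h4, h5, h14, h15, h16] at h6
  refine Wp.of_fits fun hf => ?_
  have h13' : υ 13 = σ 13 := by
    rw [h7 _ (by omega) (by omega) (by simp only [OffLevel, cell]; omega), h13]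
  have h17 : υ 17 = τ 17 := h7 _ (by omega) (by omega) (by simp only [OffLevel, cell]; omega)
  have h18 : υ 18 = τ 18 := h7 _ (by omega) (by omega) (by simp only [OffLevel, cell]; omega)
  have h19 : υ 19 = τ 19 := h7 _ (by omega) (by omega) (by simp only [OffLevel, cell]; omega)
  have h20' : υ 20 = τ 20 := h7 _ (by omega) (by omega) (by simp only [OffLevel, cell]; omega)
  simp only [cell] at hk
  refine Wp.seq_store (by simp only [Expr.eval]; omega) (hf.1 _) ?_
  simp only [Expr.eval]
  refine Wp.seq_store (by simp only [Expr.eval]; omega) ?_ ?_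
  · simp (disch := omega) only [Expr.eval, upd_ne]
    exact hf.1 _
  simp (disch := omega) only [Expr.eval, upd_ne]
  refine Wp.seq_store (by simp only [Expr.eval]; omega) ?_ ?_
  · simp (disch := omega) only [Expr.eval, upd_ne]
    exact hf.1 _
  simp (disch := omega) only [Expr.eval, upd_ne]
  refine Wp.store (by simp only [Expr.eval]; omega) ?_ ?_
  · simp (disch := omega) only [Expr.eval, Op.arith_eval, upd_ne]
    omega
  simp (disch := omega) only [Expr.eval, Op.arith_eval, upd_ne]
  refine h _ ?_ ?_ ?_ ?_ ?_
  · rw [lvlNext, Level.next, ← h6]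
    simp only [lvl, cell]
    simp (disch := omega) only [upd_ne]
  · rw [lvlOut, ← h2]
    simp (disch := omega) only [upd_eq, upd_ne, h17, h18, h19]
  · simp only [upd_eq, h13']
  · intro a ha ha'
    simp (disch := omega) only [upd_ne]
    rw [h7 a (by omega) (by omega) ha', h3 a (by omega) ha']
  · simp (disch := omega) only [upd_ne]
    rw [h20', h20]

/-! ### All levels -/

/-- The candidate for level `j` of copy `b`. -/
def lvlCand (σ : Mem) (b : ℕ) : ℕ → Cand
  | 0 => ⟨σ 14, σ 15, σ 16⟩
  | j + 1 => lvlOut σ b j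

/-- What copy `b` does at all levels. -/
def levelsCmd (b : ℕ) : Cmd :=
  .seq (set 13 (.const 0)) <|
  .while (.op .lt (var 13) (var 7)) (levelCmd b)

/-- Everything is expressed through the initial memory `σ`: what a level hands on depends on its
state before the insertion, so all levels act as if simultaneously, and a position passes to the
next level within the same time step. -/
theorem levelsCmd_wp {b : ℕ} (hb : b ≤ 1) (hk : cell 0 (σ 7) ≤ k) (hp : 1 < σ 4)
    (hcnt : ∀ j < σ 7, (lvl σ b j).cnt + 1 < 2 ^ w)
    (hfst : ∀ j < σ 7, (lvl σ b j).fst + (lvl σ b j).gap < 2 ^ w)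
    (h : ∀ τ, (∀ j < σ 7, lvl τ b j = lvlNext σ b j (lvlCand σ b j)) →
      (⟨τ 14, τ 15, τ 16⟩ : Cand) = lvlCand σ b (σ 7) →
      (∀ a, (a < 13 ∨ 22 < a) → (∀ j < σ 7, OffLevel b j a) → τ a = σ a) →
      (τ 20 = σ 20) → Q τ) :
    Wp E k w (levelsCmd b) Q σ := by
  refine Wp.of_fits fun hf => ?_
  have hw := hf.1 4
  have hw7 := hf.1 7
  simp only [cell] at hk
  refine Wp.seq_store (by simp only [Expr.eval]; omega) (by simp only [Expr.eval]; omega) ?_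
  simp only [Expr.eval]
  refine Wp.while (fun τ => τ 13 ≤ σ 7 ∧
    (∀ j < τ 13, lvl τ b j = lvlNext σ b j (lvlCand σ b j)) ∧
    (⟨τ 14, τ 15, τ 16⟩ : Cand) = lvlCand σ b (τ 13) ∧
    (∀ a, (a < 13 ∨ 22 < a) → (∀ j < τ 13, OffLevel b j a) → τ a = σ a) ∧
    τ 20 = σ 20) (fun τ => σ 7 - τ 13) ?_ ?_ ?_
  · refine ⟨by simp, by simp, ?_, ?_, ?_⟩
    · simp (disch := omega) only [upd_eq, upd_ne, lvlCand]
    · intro a ha _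
      simp (disch := omega) only [upd_ne]
    · simp (disch := omega) only [upd_ne]
  · rintro τ ⟨h1, h2, h3, h4, h20⟩ h0
    have hlt : τ 13 < σ 7 := by
      have h5 : τ 7 = σ 7 := h4 7 (by omega) fun j _ => by simp only [OffLevel, cell]; omega
      simpa only [Expr.eval, ne_eq, Op.eval_lt_eq_zero, not_le, h5] using h0
    have e4 : τ 4 = σ 4 := h4 4 (by omega) fun j _ => by simp only [OffLevel, cell]; omega
    have e5 : τ 5 = σ 5 := h4 5 (by omega) fun j _ => by simp only [OffLevel, cell]; omega
    have et : τ (9 + 2 * b) = σ (9 + 2 * b) :=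
      h4 _ (by omega) fun j _ => by simp only [OffLevel, cell]; omega
    have es : ∀ i, 12 ≤ i → i ≤ 14 → τ (cell i (τ 13)) = σ (cell i (τ 13)) := fun i hi hi' =>
      h4 _ (by simp only [cell]; omega) fun j hj => by simp only [OffLevel, cell]; omega
    have el : lvl τ b (τ 13) = lvl σ b (τ 13) := by
      unfold lvl
      congr 1 <;> refine h4 _ (by simp only [cell]; omega) fun j hj => ?_ <;>
        simp only [OffLevel, cell] <;> omega
    have en : ∀ c, lvlNext τ b (τ 13) c = lvlNext σ b (τ 13) c := fun c => by
      simp only [lvlNext, el, e4, e5, et, es 12 (by omega) (by omega)]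
    have eo : lvlOut τ b (τ 13) = lvlOut σ b (τ 13) := by
      simp only [lvlOut, el, e4, et, es 12 (by omega) (by omega), es 13 (by omega) (by omega),
        es 14 (by omega) (by omega), h20]
    refine levelCmd_wp hb (by simp only [cell]; omega) (by omega) (by rw [el]; exact hcnt _ hlt)
      (by rw [el]; exact hfst _ hlt) (by omega) fun υ h5 h6 h7 h8 h9 => ?_
    refine ⟨⟨by omega, ?_, ?_, ?_, by omega⟩, by omega⟩
    · intro j hj
      rw [h7] at hj
      rcases (by omega : j < τ 13 ∨ j = τ 13) with hj' | rfl
      · rw [← h2 j hj']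
        unfold lvl
        congr 1 <;> refine h8 _ (by simp only [cell]; omega) ?_ <;>
          simp only [OffLevel, cell] <;> omega
      · rw [h5, en, h3]
    · rw [h7, h6, eo, lvlCand]
    · intro a ha ha'
      rw [h7] at ha'
      rw [h8 a ha (ha' _ (by omega)), h4 a ha fun j hj => ha' j (by omega)]
  · rintro τ ⟨h1, h2, h3, h4, h20⟩ h0
    have hge : τ 13 = σ 7 := by
      have h5 : τ 7 = σ 7 := h4 7 (by omega) fun j _ => by simp only [OffLevel, cell]; omega
      simp only [Expr.eval, Op.eval_lt_eq_zero, h5] at h0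
      omega
    rw [hge] at h2 h3 h4
    exact h τ h2 h3 h4 h20

/-! ### One copy -/

/-- A restart of copy `b` after `2 * m` symbols. -/
def resetCmd (b : ℕ) : Cmd :=
  .ite (.op .eq (var (9 + 2 * b)) (.op .mul (.const 2) (var 3)))
    (.seq (set (9 + 2 * b) (.const 0)) <|
      .seq (set (10 + 2 * b) (.const 0)) <|
      .seq (set 13 (.const 0)) <|
      .while (.op .lt (var 13) (var 7)) <|
        .seq (.store (arr (6 * b)) (.const 0)) <|
        set 13 (.op .add (var 13) (.const 1)))
    .skip

/-- Only the counters of the levels are cleared. The other fields keep stale values, which are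
harmless for an empty level and still obey their size bounds. -/
theorem resetCmd_wp {b : ℕ} (hb : b ≤ 1) (hk : cell 0 (σ 7) ≤ k)
    (hno : σ (9 + 2 * b) ≠ 2 * σ 3 → Q σ)
    (hyes : σ (9 + 2 * b) = 2 * σ 3 → ∀ τ, τ (9 + 2 * b) = 0 → τ (10 + 2 * b) = 0 →
      (∀ j < σ 7, lvl τ b j = { lvl σ b j with cnt := 0 }) →
      (∀ a, a ≠ 9 + 2 * b → a ≠ 10 + 2 * b → a ≠ 13 → (∀ j < σ 7, a ≠ cell (6 * b) j) →
        τ a = σ a) → Q τ) :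
    Wp E k w (resetCmd b) Q σ := by
  refine Wp.of_fits fun hf => ?_
  have hw7 := hf.1 7
  simp only [cell] at hk
  refine Wp.ite (fun h0 => ?_) (fun h0 => ?_)
  · have h1 : σ (9 + 2 * b) = 2 * σ 3 := by
      simpa only [Expr.eval, Op.arith_eval, ne_eq, Op.eval_eq_eq_zero, not_not] using h0
    refine Wp.seq_store (by simp only [Expr.eval]; omega) (by simp only [Expr.eval]; omega) ?_
    refine Wp.seq_store (by simp only [Expr.eval]; omega) (by simp only [Expr.eval]; omega) ?_
    refine Wp.seq_store (by simp only [Expr.eval]; omega) (by simp only [Expr.eval]; omega) ?_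
    simp only [Expr.eval]
    refine Wp.while (fun τ => τ 13 ≤ σ 7 ∧ τ (9 + 2 * b) = 0 ∧ τ (10 + 2 * b) = 0 ∧
      (∀ j < τ 13, τ (cell (6 * b) j) = 0) ∧
      (∀ a, a ≠ 9 + 2 * b → a ≠ 10 + 2 * b → a ≠ 13 → (∀ j < τ 13, a ≠ cell (6 * b) j) →
        τ a = σ a)) (fun τ => σ 7 - τ 13) ?_ ?_ ?_
    · refine ⟨by simp, ?_, ?_, by simp, ?_⟩
      · simp (disch := omega) only [upd_eq, upd_ne]
      · simp (disch := omega) only [upd_eq, upd_ne]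
      · intro a _ _ _ _
        simp (disch := omega) only [upd_ne]
    · rintro τ ⟨h2, h3, h4, h5, h6⟩ h7
      have hlt : τ 13 < σ 7 := by
        have h8 : τ 7 = σ 7 := h6 7 (by omega) (by omega) (by omega) fun j _ => by
          simp only [cell]; omega
        simpa only [Expr.eval, ne_eq, Op.eval_lt_eq_zero, not_le, h8] using h7
      refine Wp.seq_store (by simp only [Expr.eval, Op.arith_eval]; omega)
        (by simp only [Expr.eval]; omega) ?_
      simp only [Expr.eval, Op.arith_eval]
      refine Wp.store (by simp only [Expr.eval]; omega) ?_ ?_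
      · simp (disch := omega) only [Expr.eval, Op.arith_eval, upd_ne]
        omega
      simp (disch := omega) only [Expr.eval, Op.arith_eval, upd_eq, upd_ne]
      refine ⟨⟨by omega, h3, h4, ?_, ?_⟩, by omega⟩
      · intro j hj
        simp only [cell]
        rcases (by omega : j < τ 13 ∨ j = τ 13) with hj' | rfl
        · simp (disch := omega) only [upd_ne]
          exact h5 j hj'
        · simp (disch := omega) only [upd_eq, upd_ne]
      · intro a ha1 ha2 ha3 ha4
        have := ha4 (τ 13) (by omega)
        simp only [cell] at this
        simp (disch := omega) only [upd_ne]
        exact h6 a ha1 ha2 ha3 fun j hj => ha4 j (by omega)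
    · rintro τ ⟨h2, h3, h4, h5, h6⟩ h7
      have hge : τ 13 = σ 7 := by
        have h8 : τ 7 = σ 7 := h6 7 (by omega) (by omega) (by omega) fun j _ => by
          simp only [cell]; omega
        simp only [Expr.eval, Op.eval_lt_eq_zero, h8] at h7
        omega
      rw [hge] at h5 h6
      refine hyes h1 τ h3 h4 (fun j hj => ?_) h6
      unfold lvl
      rw [h5 j hj]
      congr 1 <;> refine h6 _ ?_ ?_ ?_ ?_ <;> simp only [cell] <;> intros <;> omega
  · refine Wp.skip (hno fun h1 => ?_)
    simp only [Expr.eval, Op.arith_eval, Op.eval_eq_eq_zero] at h0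
    exact h0 h1

end Programs


/-! ### What the memory holds -/

/-- The lengths of the tested prefixes. -/
def len (m j : ℕ) : ℕ := min (2 ^ j) m

/-- The part of the memory that does not change while the text is read: `P` is the coded pattern. -/
structure Static (m nP p r : ℕ) (P : ℕ → ℕ) (σ : Mem) : Prop where
  cell_nP : σ 1 = nP
  cell_m : σ 3 = m
  cell_p : σ 4 = p
  cell_r : σ 5 = r
  cell_fst : σ 6 = P 0
  cell_levels : σ 7 = Nat.clog 2 m
  cell_len : ∀ j < Nat.clog 2 m, σ (cell 12 j) = len m (j + 1)
  cell_fp : ∀ j < Nat.clog 2 m, σ (cell 13 j) = fingerprint p r P (len m (j + 1))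
  cell_pow : ∀ j < Nat.clog 2 m, σ (cell 14 j) = r ^ len m (j + 1) % p

/-- Bounds on the content of copy `b`. -/
structure Bounded (m b : ℕ) (σ : Mem) : Prop where
  time : σ (9 + 2 * b) ≤ 2 * m
  cnt : ∀ j < Nat.clog 2 m, (lvl σ b j).cnt ≤ σ (9 + 2 * b)
  fst : ∀ j < Nat.clog 2 m, (lvl σ b j).fst ≤ 4 * m
  gap : ∀ j < Nat.clog 2 m, (lvl σ b j).gap ≤ 2 * m

/-- Copy `b` has read a prefix of the text `U`. -/
structure Tracks (m p r : ℕ) (P U : ℕ → ℕ) (b : ℕ) (σ : Mem) : Prop where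
  fp : σ (10 + 2 * b) = fingerprint p r U (σ (9 + 2 * b))
  level : ∀ j < Nat.clog 2 m,
    (lvl σ b j).Rep p r U P (Window U P (len m j) (len m (j + 1)) (σ (9 + 2 * b)))

theorem Static.congr {m nP p r : ℕ} {P : ℕ → ℕ} {σ τ : Mem} (h : Static m nP p r P σ)
    (hlow : ∀ a, 1 ≤ a → a ≤ 7 → τ a = σ a)
    (hhigh : ∀ i, 12 ≤ i → i ≤ 14 → ∀ j < Nat.clog 2 m, τ (cell i j) = σ (cell i j)) :
    Static m nP p r P τ where
  cell_nP := by rw [hlow 1 (by omega) (by omega), h.cell_nP]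
  cell_m := by rw [hlow 3 (by omega) (by omega), h.cell_m]
  cell_p := by rw [hlow 4 (by omega) (by omega), h.cell_p]
  cell_r := by rw [hlow 5 (by omega) (by omega), h.cell_r]
  cell_fst := by rw [hlow 6 (by omega) (by omega), h.cell_fst]
  cell_levels := by rw [hlow 7 (by omega) (by omega), h.cell_levels]
  cell_len j hj := by rw [hhigh 12 (by omega) (by omega) j hj, h.cell_len j hj]
  cell_fp j hj := by rw [hhigh 13 (by omega) (by omega) j hj, h.cell_fp j hj]
  cell_pow j hj := by rw [hhigh 14 (by omega) (by omega) j hj, h.cell_pow j hj]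

theorem Bounded.congr {m b : ℕ} {σ τ : Mem} (h : Bounded m b σ)
    (ht : τ (9 + 2 * b) = σ (9 + 2 * b))
    (hl : ∀ j < Nat.clog 2 m, lvl τ b j = lvl σ b j) : Bounded m b τ where
  time := by rw [ht]; exact h.time
  cnt j hj := by rw [ht, hl j hj]; exact h.cnt j hj
  fst j hj := by rw [hl j hj]; exact h.fst j hj
  gap j hj := by rw [hl j hj]; exact h.gap j hj

theorem Tracks.congr {m p r b : ℕ} {P U : ℕ → ℕ} {σ τ : Mem} (h : Tracks m p r P U b σ)
    (ht : τ (9 + 2 * b) = σ (9 + 2 * b)) (hF : τ (10 + 2 * b) = σ (10 + 2 * b))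
    (hl : ∀ j < Nat.clog 2 m, lvl τ b j = lvl σ b j) : Tracks m p r P U b τ where
  fp := by rw [ht, hF, h.fp]
  level j hj := by rw [ht, hl j hj]; exact h.level j hj

/-! ### The prefix lengths, which double until they reach `m`. -/

section Len

variable {m : ℕ}

theorem len_zero (hm : 2 ≤ m) : len m 0 = 1 := by
  unfold len
  omega

theorem len_lt_succ {j : ℕ} (hj : j < Nat.clog 2 m) : len m j < len m (j + 1) := by
  have h1 : 2 ^ j < m := (Nat.lt_clog_iff_pow_lt (by omega)).1 hj
  have h2 : 2 ^ (j + 1) = 2 * 2 ^ j := by ring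
  have h3 : 0 < 2 ^ j := by positivity
  unfold len
  omega

theorem len_succ_le (j : ℕ) : len m (j + 1) ≤ 2 * len m j := by
  have h2 : 2 ^ (j + 1) = 2 * 2 ^ j := by ring
  unfold len
  omega

theorem len_le (j : ℕ) : len m j ≤ m := min_le_right ..

theorem len_clog : len m (Nat.clog 2 m) = m :=
  min_eq_right (Nat.le_pow_clog (by omega) m)

end Len

theorem Level.rep_empty {p r : ℕ} {U P : ℕ → ℕ} {S : ℕ → Prop} {l : Level} (hl : l.cnt = 0)
    (hS : ∀ i, ¬ S i) : l.Rep p r U P S :=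
  ⟨fun i => by simp [hl, hS], by simp [hl], by simp [hl], by simp [hl], by simp [hl]⟩

theorem Level.out_pos_le {p b H R F t : ℕ} (l : Level) : (l.out p b H R F t).pos ≤ t := by
  unfold Level.out
  by_cases he : l.Expires b t
  · rw [if_pos he]
    have := he.2
    simp only [Level.cand]
    omega
  · rw [if_neg he]
    exact Nat.zero_le _

section Programs

variable {E : Env} {k w m nP p r : ℕ} {P : ℕ → ℕ} {Q : Mem → Prop} {σ : Mem}

/-! ### One symbol -/

/-- After a restart the copy tracks every text `U`, whatever happened before, because at time `0`
all windows are empty. This is why an old collision does no lasting damage. -/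
theorem resetCmd_wp' {b : ℕ} (hb : b ≤ 1) (hm : 2 ≤ m) (hk : cell 0 (Nat.clog 2 m) ≤ k)
    (hs : Static m nP p r P σ) (hbd : Bounded m b σ)
    (h : ∀ τ, Static m nP p r P τ → Bounded m b τ →
      τ (9 + 2 * b) = (if σ (9 + 2 * b) = 2 * m then 0 else σ (9 + 2 * b)) →
      (∀ U, (σ (9 + 2 * b) ≠ 2 * m → Tracks m p r P U b σ) → Tracks m p r P U b τ) →
      (∀ a, a ≠ 9 + 2 * b → a ≠ 10 + 2 * b → a ≠ 13 → (∀ j < Nat.clog 2 m, OffLevel b j a) →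
        τ a = σ a) → Q τ) :
    Wp E k w (resetCmd b) Q σ := by
  refine resetCmd_wp hb (by rw [hs.cell_levels]; exact hk) (fun h0 => ?_) (fun h0 τ h1 h2 h3 h4 => ?_)
  · rw [hs.cell_m] at h0
    exact h σ hs hbd (by rw [if_neg h0]) (fun U hU => hU h0) (fun _ _ _ _ _ => rfl)
  · rw [hs.cell_m] at h0
    rw [hs.cell_levels] at h3 h4
    refine h τ (hs.congr ?_ ?_) ⟨by omega, ?_, ?_, ?_⟩ (by rw [if_pos h0, h1]) ?_ ?_
    · intro a _ _
      exact h4 a (by omega) (by omega) (by omega) fun j _ => by simp only [cell]; omega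
    · intro i _ _ j _
      refine h4 _ ?_ ?_ ?_ fun j _ => ?_ <;> simp only [cell] <;> interval_cases b <;> omega
    · intro j hj
      rw [h3 j hj]
      exact Nat.zero_le _
    · intro j hj
      rw [h3 j hj]
      exact hbd.fst j hj
    · intro j hj
      rw [h3 j hj]
      exact hbd.gap j hj
    · intro U _
      refine ⟨by rw [h1, h2]; rfl, fun j hj => Level.rep_empty (by rw [h3 j hj]) ?_⟩
      rintro i ⟨h5, -, -⟩
      have : 0 < len m j := by
        unfold len
        have : 0 < 2 ^ j := by positivity
        omega
      omega
    · intro a h5 h6 h7 h8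
      refine h4 a h5 h6 h7 fun j hj => ?_
      have := h8 j hj
      simp only [OffLevel, cell] at this ⊢
      omega

/-- What copy `b` does when a symbol arrives. -/
def copyCmd (b : ℕ) : Cmd :=
  .seq (resetCmd b) <|
  .seq (set 20 (.op .mod (.op .add (.op .mul (var (10 + 2 * b)) (var 5)) (var 8)) (var 4))) <|
  .seq (set 14 (.op .eq (var 8) (var 6))) <|
  .seq (set 15 (var (9 + 2 * b))) <|
  .seq (set 16 (var (10 + 2 * b))) <|
  .seq (set (9 + 2 * b) (.op .add (var (9 + 2 * b)) (.const 1))) <|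
  .seq (levelsCmd b) <|
  .seq (set (10 + 2 * b) (var 20)) <|
  set 0 (.op .add (var 0) (var 14))

/-- These bounds hold even after a collision, as the space limit must hold for all coin flips. A
position is removed only when `fst + b = t + 1 ≤ 2 * m`, so adding a possibly meaningless `gap ≤ 2 *
m` stays below `4 * m`. -/
theorem Level.next_bounds {p r b t : ℕ} {l : Level} {c : Cand} (hcnt : l.cnt ≤ t)
    (hfst : l.fst ≤ 4 * m) (hgap : l.gap ≤ 2 * m) (hc : c.pos ≤ 2 * m) (ht : t + 1 ≤ 2 * m) :
    (l.next p r b (t + 1) c).cnt ≤ t + 1 ∧ (l.next p r b (t + 1) c).fst ≤ 4 * m ∧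
      (l.next p r b (t + 1) c).gap ≤ 2 * m := by
  have key : ∀ l' : Level, l'.cnt ≤ t → l'.fst ≤ 4 * m → l'.gap ≤ 2 * m →
      (l'.push p r c).cnt ≤ t + 1 ∧ (l'.push p r c).fst ≤ 4 * m ∧
        (l'.push p r c).gap ≤ 2 * m := by
    intro l' h1 h2 h3
    unfold Level.push
    split_ifs <;> refine ⟨?_, ?_, ?_⟩ <;> first | omega | (simp only; omega)
  unfold Level.next
  split_ifs with he
  · refine key _ ?_ ?_ ?_ <;> simp only [Level.pop]
    · omega
    · have := he.2
      omega
    · exact hgap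
  · exact key _ hcnt hfst hgap

/-- The conclusions on size and frame are unconditional; only tracking and the correctness of the
output assume that there is no collision. The text `U` is left open, since the program does not
depend on it beyond the current symbol. -/
theorem copyCmd_wp {b : ℕ} (hb : b ≤ 1) (hm : 2 ≤ m) (hp : 1 < p) (hw : 6 * m + 2 < 2 ^ w)
    (hk : cell 0 (Nat.clog 2 m) ≤ k) (hs : Static m nP p r P σ) (hbd : Bounded m b σ)
    (h0 : σ 0 ≤ 1)
    (h : ∀ τ, Static m nP p r P τ → Bounded m b τ →
      τ (9 + 2 * b) = (if σ (9 + 2 * b) = 2 * m then 0 else σ (9 + 2 * b)) + 1 →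
      (∀ a, 1 ≤ a → a ≠ 9 + 2 * b → a ≠ 10 + 2 * b → (a < 13 ∨ 22 < a) →
        (∀ j < Nat.clog 2 m, OffLevel b j a) → τ a = σ a) →
      τ 0 ≤ σ 0 + 1 →
      (∀ U, (σ (9 + 2 * b) ≠ 2 * m → Tracks m p r P U b σ) → U (τ (9 + 2 * b) - 1) = σ 8 →
        NoCollision p r U P m (2 * m) → Tracks m p r P U b τ ∧ (τ 0 ≠ 0 ↔
          σ 0 ≠ 0 ∨ (m ≤ τ (9 + 2 * b) ∧ Occ U P (τ (9 + 2 * b) - m) m))) → Q τ) :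
    Wp E k w (copyCmd b) Q σ := by
  refine Wp.of_fits fun hf0 => Wp.seq (resetCmd_wp' hb hm hk hs hbd fun σ' hs' hbd' ht' htr' hfr => ?_)
  refine Wp.of_fits fun hf => ?_
  have hlt : σ' (9 + 2 * b) < 2 * m := by
    rw [ht']
    have := hbd.time
    split_ifs <;> omega
  have e8 : σ' 8 = σ 8 := hfr 8 (by omega) (by omega) (by omega) fun j _ => by
    simp only [OffLevel, cell]; omega
  have e0 : σ' 0 = σ 0 := hfr 0 (by omega) (by omega) (by omega) fun j _ => by
    simp only [OffLevel, cell]; omega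
  simp only [cell] at hk
  have hp' := hf.1 4
  rw [hs'.cell_p] at hp'
  refine Wp.seq_store (by simp only [Expr.eval]; omega) ?_ ?_
  · simp only [Expr.eval, Op.arith_eval, hs'.cell_p]
    exact (Nat.mod_lt _ (by omega)).trans hp'
  simp only [Expr.eval, Op.arith_eval]
  refine Wp.seq_store (by simp only [Expr.eval]; omega) ?_ ?_
  · simp only [Expr.eval]
    exact (Op.eval_eq_le _ _).trans_lt (by omega)
  simp (disch := omega) only [Expr.eval, upd_ne]
  refine Wp.seq_store (by simp only [Expr.eval]; omega) ?_ ?_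
  · simp (disch := omega) only [Expr.eval, upd_ne]
    exact hf.1 _
  simp (disch := omega) only [Expr.eval, upd_ne]
  refine Wp.seq_store (by simp only [Expr.eval]; omega) ?_ ?_
  · simp (disch := omega) only [Expr.eval, upd_ne]
    exact hf.1 _
  simp (disch := omega) only [Expr.eval, upd_ne]
  refine Wp.seq_store (by simp only [Expr.eval]; omega) ?_ ?_
  · simp (disch := omega) only [Expr.eval, Op.arith_eval, upd_ne]
    omega
  simp (disch := omega) only [Expr.eval, Op.arith_eval, upd_ne]
  generalize hυ : (Function.update _ (9 + 2 * b) (σ' (9 + 2 * b) + 1) : Mem) = υ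
  have v7 : υ 7 = Nat.clog 2 m := by
    rw [← hυ, ← hs'.cell_levels]
    simp (disch := omega) only [upd_ne]
  have v4 : υ 4 = p := by
    rw [← hυ, ← hs'.cell_p]
    simp (disch := omega) only [upd_ne]
  have v5 : υ 5 = r := by
    rw [← hυ, ← hs'.cell_r]
    simp (disch := omega) only [upd_ne]
  have vt : υ (9 + 2 * b) = σ' (9 + 2 * b) + 1 := by
    rw [← hυ, upd_eq]
  have v20 : υ 20 = (σ' (10 + 2 * b) * r + σ 8) % p := by
    rw [← hυ, ← hs'.cell_r, ← e8, ← hs'.cell_p]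
    simp (disch := omega) only [upd_eq, upd_ne]
  have v14 : υ 14 = Op.eval .eq (σ 8) (P 0) := by
    rw [← hυ, ← e8, ← hs'.cell_fst]
    simp (disch := omega) only [upd_eq, upd_ne]
  have v15 : υ 15 = σ' (9 + 2 * b) := by
    rw [← hυ]
    simp (disch := omega) only [upd_eq, upd_ne]
  have v16 : υ 16 = σ' (10 + 2 * b) := by
    rw [← hυ]
    simp (disch := omega) only [upd_eq, upd_ne]
  have vfr : ∀ a, a ≠ 9 + 2 * b → (a < 13 ∨ 22 < a) → υ a = σ' a := by
    intro a _ _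
    rw [← hυ]
    simp (disch := omega) only [upd_ne]
  have vlvl : ∀ j, lvl υ b j = lvl σ' b j := fun j => by
    unfold lvl
    congr 1 <;> exact vfr _ (by simp only [cell]; omega) (by simp only [cell]; omega)
  have vs : Static m nP p r P υ := hs'.congr (fun a _ _ => vfr a (by omega) (by omega))
    fun i _ _ j _ => vfr _ (by simp only [cell]; omega) (by simp only [cell]; omega)
  clear hυ
  refine Wp.seq (levelsCmd_wp hb (by rw [v7]; exact hk) (by omega) ?_ ?_
    fun τ h1 h2 h3 h4 => Wp.of_fits fun hτf => ?_)
  · intro j hj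
    rw [vlvl]
    have := hbd'.cnt j (v7 ▸ hj)
    omega
  · intro j hj
    rw [vlvl]
    have := hbd'.fst j (v7 ▸ hj)
    have := hbd'.gap j (v7 ▸ hj)
    omega
  rw [v7] at h1 h2 h3
  have t0 : τ 0 = σ 0 := by
    rw [h3 0 (by omega) fun j _ => by simp only [OffLevel, cell]; omega,
      vfr 0 (by omega) (by omega), e0]
  have hflag : (⟨τ 14, τ 15, τ 16⟩ : Cand).flag ≤ 1 := by
    rw [h2]
    cases Nat.clog 2 m with
    | zero =>
      simp only [lvlCand, v14]
      exact Op.eval_eq_le _ _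
    | succ K =>
      simp only [lvlCand, lvlOut, Level.out, Level.cand]
      split_ifs <;> simp
  simp only at hflag
  refine Wp.seq_store (by simp only [Expr.eval]; omega) (hτf.1 _) ?_
  simp only [Expr.eval]
  refine Wp.store (by simp only [Expr.eval]; omega) ?_ ?_
  · simp (disch := omega) only [Expr.eval, Op.arith_eval, upd_ne]
    omega
  simp (disch := omega) only [Expr.eval, Op.arith_eval, upd_ne]
  generalize hπ : (Function.update _ 0 (τ 0 + τ 14) : Mem) = π
  have pF : π (10 + 2 * b) = υ 20 := by
    rw [← hπ, ← h4]
    simp (disch := omega) only [upd_eq, upd_ne]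
  have p0 : π 0 = σ 0 + τ 14 := by
    rw [← hπ, ← t0, upd_eq]
  have pfr : ∀ a, 1 ≤ a → a ≠ 10 + 2 * b → π a = τ a := by
    intro a _ _
    rw [← hπ]
    simp (disch := omega) only [upd_ne]
  have plvl : ∀ j, lvl π b j = lvl τ b j := fun j => by
    unfold lvl
    congr 1 <;> exact pfr _ (by simp only [cell]; omega) (by simp only [cell]; omega)
  have pt : π (9 + 2 * b) = σ' (9 + 2 * b) + 1 := by
    rw [pfr _ (by omega) (by omega), h3 _ (by omega) fun j _ => by
      simp only [OffLevel, cell]; omega, vt]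
  clear hπ
  have hcand : ∀ j ≤ Nat.clog 2 m, (lvlCand υ b j).pos ≤ 2 * m := by
    intro j hj
    cases j with
    | zero =>
      simp only [lvlCand, v15]
      omega
    | succ j =>
      have := (lvl υ b j).out_pos_le (p := υ 4) (b := υ (cell 12 j)) (H := υ (cell 13 j))
        (R := υ (cell 14 j)) (F := υ 20) (t := υ (9 + 2 * b))
      simp only [lvlCand, lvlOut]
      omega
  have hnb : ∀ j < Nat.clog 2 m, (lvl π b j).cnt ≤ σ' (9 + 2 * b) + 1 ∧
      (lvl π b j).fst ≤ 4 * m ∧ (lvl π b j).gap ≤ 2 * m := by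
    intro j hj
    rw [plvl, h1 j hj, lvlNext, vt, vlvl]
    exact Level.next_bounds (hbd'.cnt j hj) (hbd'.fst j hj) (hbd'.gap j hj) (hcand j hj.le)
      (by omega)
  refine h π (vs.congr ?_ ?_) ⟨by omega, ?_, fun j hj => (hnb j hj).2.1,
    fun j hj => (hnb j hj).2.2⟩ (by rw [pt, ht']) ?_ (by omega) ?_
  · intro a ha ha'
    rw [pfr a ha (by omega), h3 a (by omega) fun j _ => by simp only [OffLevel, cell]; omega]
  · intro i _ _ j _
    rw [pfr _ (by simp only [cell]; omega) (by simp only [cell]; omega)]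
    refine h3 _ (by simp only [cell]; omega) fun j _ => ?_
    simp only [OffLevel, cell]
    interval_cases b <;> omega
  · intro j hj
    rw [pt]
    exact (hnb j hj).1
  · intro a ha1 ha2 ha3 ha4 ha5
    rw [pfr a ha1 ha3, h3 a ha4 ha5, vfr a ha2 ha4, hfr a ha2 ha3 (by omega) ha5]
  · intro U hU hUt hno
    have htr := htr' U hU
    rw [pt, Nat.add_sub_cancel] at hUt
    set t := σ' (9 + 2 * b) with ht
    have hp0 : 0 < p := by omega
    have hF : υ 20 = fingerprint p r U (t + 1) := by
      rw [v20, htr.fp, fingerprint, hUt]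
    -- The candidate for level `0` comes from comparing the symbol with the first pattern symbol,
    -- without fingerprints; the others come from the previous level.
    have hrep : ∀ j ≤ Nat.clog 2 m, (lvlCand υ b j).Rep p r U P (t + 1) (len m j) := by
      intro j hj
      cases j with
      | zero =>
        rw [len_zero hm]
        simp only [lvlCand, v14, v15, v16]
        refine ⟨?_, fun _ => rfl, fun _ => htr.fp⟩
        simp only [ne_eq, Op.eval_eq_eq_zero, not_not, ← hUt, Nat.add_sub_cancel]
        refine ⟨fun h5 => ⟨by omega, fun k hk => ?_⟩, fun h5 => h5.2 0 (by omega)⟩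
        rw [show k = 0 by omega]
        exact h5
      | succ j =>
        simp only [lvlCand, lvlOut, vlvl, v4, vs.cell_len j hj, vs.cell_fp j hj, vs.cell_pow j hj, hF, vt]
        exact (htr.level j hj).out hp0 hno (len_lt_succ hj) (len_le _) (by omega)
    refine ⟨⟨by rw [pF, pt, hF], fun j hj => ?_⟩, ?_⟩
    · rw [pt, plvl, h1 j hj, lvlNext, v4, v5, vlvl, vs.cell_len j hj, vt]
      exact (htr.level j hj).next hp0 (hrep j hj.le) (len_lt_succ hj) (len_succ_le j)
    -- The candidate that leaves the last level has passed the test for length `m`, the whole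
    -- pattern.
    · have h5 := (hrep _ le_rfl).flag
      rw [len_clog, ← h2] at h5
      simp only at h5
      rw [pt, p0, ← h5]
      omega

/-- Search for the first `x` below a bound that passes a test. -/
def searchCmd (x : ℕ) (bound test : Expr) : Cmd :=
  .seq (set x (.const 0)) <|
  .while (.op .mul (.op .lt (var x) bound) (.op .eq test (.const 0))) <|
    set x (.op .add (var x) (.const 1))

theorem searchCmd_wp {x n : ℕ} {bound test : Expr} {f : ℕ → ℕ} (hx : x < k) (hn : n < 2 ^ w)
    (hbound : ∀ v, bound.eval E (Function.update σ x v) = n)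
    (htest : ∀ v, test.eval E (Function.update σ x v) = f v)
    (h : Q (Function.update σ x (firstIdx f n))) :
    Wp E k w (searchCmd x bound test) Q σ := by
  refine Wp.seq_store (by simpa only [Expr.eval]) (by simp only [Expr.eval]; positivity) ?_
  simp only [Expr.eval]
  refine Wp.while (fun τ => ∃ v ≤ n, (∀ u < v, f u = 0) ∧ τ = Function.update σ x v)
    (fun τ => n - τ x) ⟨0, by omega, by omega, rfl⟩ ?_ ?_
  · rintro τ ⟨v, hv, hv', rfl⟩ h0
    simp only [Expr.eval, Op.arith_eval, upd_eq, hbound, htest, ne_eq, mul_eq_zero, not_or,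
      Op.eval_lt_eq_zero, Op.eval_eq_eq_zero, not_le, not_not] at h0
    refine Wp.store (by simpa only [Expr.eval]) ?_ ⟨⟨v + 1, by omega, ?_, ?_⟩, ?_⟩
    · simp only [Expr.eval, Op.arith_eval, upd_eq]
      omega
    · intro u hu
      rcases (by omega : u < v ∨ u = v) with h1 | rfl
      · exact hv' u h1
      · exact h0.2
    · simp only [Expr.eval, Op.arith_eval, upd_eq, Function.update_idem]
    · simp only [Expr.eval, Op.arith_eval, upd_eq]
      omega
  · rintro τ ⟨v, hv, hv', rfl⟩ h0
    simp only [Expr.eval, Op.arith_eval, upd_eq, hbound, htest, mul_eq_zero,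
      Op.eval_lt_eq_zero, Op.eval_eq_eq_zero] at h0
    rwa [firstIdx_eq hv hv' h0] at h

/-- The program that is run when a symbol arrives. -/
def stepCmd : Cmd :=
  .seq (searchCmd 8 (var 1) (.rel (var 8) (var 0))) <|
  .seq (set 8 (.op .add (var 8) (.const 1))) <|
  .seq (set 0 (.const 0)) <|
  .seq (copyCmd 0) (copyCmd 1)

/-- The coded text `f` with `m` symbols in front of it that do not match. -/
def extend (m : ℕ) (f : ℕ → ℕ) (k : ℕ) : ℕ := if k < m then 0 else f (k - m)

/-- The text that copy `b` has read after the arrival of `n` symbols, and its continuation. -/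
def localText (m : ℕ) (f : ℕ → ℕ) (n b : ℕ) (σ : Mem) (k : ℕ) : ℕ :=
  extend m f (n + m - σ (9 + 2 * b) + k)

/-- The state of the algorithm after the arrival of `n` symbols of the coded text `f`. -/
structure Invariant (m nP p r : ℕ) (P f : ℕ → ℕ) (n : ℕ) (σ : Mem) : Prop where
  static : Static m nP p r P σ
  bounded : ∀ b ≤ 1, Bounded m b σ
  shift : σ 9 = σ 11 + m ∨ σ 11 = σ 9 + m
  le : ∀ b ≤ 1, σ (9 + 2 * b) ≤ n + m
  tracks : ∀ b ≤ 1, NoCollision p r (localText m f n b σ) P m (2 * m) →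
    Tracks m p r P (localText m f n b σ) b σ
  output : 0 < n → (∀ b ≤ 1, NoCollision p r (localText m f n b σ) P m (2 * m)) →
    (σ 0 ≠ 0 ↔ Occ (extend m f) P n m)

/-- The output cell adds up the flags of both copies. A copy can flag only after at least `m`
symbols, and then it decides the same occurrence as the other one, so their disjunction is correct
as soon as one copy is old enough. -/
theorem stepCmd_wp {f : ℕ → ℕ} {n a : ℕ} {σ₀ : Mem} (hm : 2 ≤ m) (hp : 1 < p)
    (hw : 6 * m + 2 < 2 ^ w) (hnw : nP + 1 < 2 ^ w) (hk : cell 0 (Nat.clog 2 m) ≤ k)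
    (ha : textCode E.rel nP a = f n) (hi : Invariant m nP p r P f n σ₀)
    (hσ : σ = Function.update σ₀ 0 a)
    (h : ∀ τ, Invariant m nP p r P f (n + 1) τ → Q τ) : Wp E k w stepCmd Q σ := by
  simp only [cell] at hk
  have s1 : ∀ a, 1 ≤ a → σ a = σ₀ a := fun b hb => by rw [hσ, upd_ne (by omega)]
  have hsσ : Static m nP p r P σ := hi.static.congr (fun a ha _ => s1 a ha)
    fun i _ _ j _ => s1 _ (by simp only [cell]; omega)
  refine Wp.seq (searchCmd_wp (n := nP) (f := fun x => E.rel x a) (by omega) (by omega) ?_ ?_ ?_)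
  · intro v
    simp (disch := omega) only [Expr.eval, upd_ne, hsσ.cell_nP]
  · intro v
    simp (disch := omega) only [Expr.eval, upd_eq, upd_ne]
    rw [hσ, upd_eq]
  have hle := firstIdx_le (fun x => E.rel x a) nP
  refine Wp.seq_store (by simp only [Expr.eval]; omega) ?_ ?_
  · simp only [Expr.eval, Op.arith_eval, upd_eq]
    omega
  simp only [Expr.eval, Op.arith_eval, upd_eq, Function.update_idem]
  refine Wp.seq_store (by simp only [Expr.eval]; omega) (by simp only [Expr.eval]; omega) ?_
  simp only [Expr.eval]
  generalize hυ : (Function.update (Function.update σ 8 _) 0 0 : Mem) = υ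
  have v8 : υ 8 = f n := by
    rw [← hυ, ← ha]
    simp (disch := omega) only [upd_eq, upd_ne]
    rfl
  have v0 : υ 0 = 0 := by rw [← hυ, upd_eq]
  have vfr : ∀ a, 1 ≤ a → a ≠ 8 → υ a = σ₀ a := by
    intro a ha _
    rw [← hυ, ← s1 a ha]
    simp (disch := omega) only [upd_ne]
  clear hυ
  have vlvl : ∀ b j, lvl υ b j = lvl σ₀ b j := fun b j => by
    unfold lvl
    congr 1 <;> exact vfr _ (by simp only [cell]; omega) (by simp only [cell]; omega)
  have vs : Static m nP p r P υ := hi.static.congr (fun a ha _ => vfr a ha (by omega))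
    fun i _ _ j _ => vfr _ (by simp only [cell]; omega) (by simp only [cell]; omega)
  have v9 : υ 9 = σ₀ 9 := vfr 9 (by omega) (by omega)
  have v11 : υ 11 = σ₀ 11 := vfr 11 (by omega) (by omega)
  have b0 := hi.bounded 0 (by omega)
  have b1 := hi.bounded 1 (by omega)
  refine Wp.seq (copyCmd_wp (b := 0) (by omega) hm hp hw hk vs
    (b0.congr (by rw [vfr _ (by omega) (by omega)]) fun j _ => vlvl 0 j) (by omega)
    fun τ τs τb τt τfr τ0 τU => ?_)
  have tlvl : ∀ j < Nat.clog 2 m, lvl τ 1 j = lvl υ 1 j := fun j hj => by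
    unfold lvl
    congr 1 <;> refine τfr _ ?_ ?_ ?_ ?_ fun j' _ => ?_ <;> simp only [OffLevel, cell] <;> omega
  have t11 : τ 11 = σ₀ 11 := by
    rw [τfr 11 (by omega) (by omega) (by omega) (by omega) fun j _ => by
      simp only [OffLevel, cell]; omega, v11]
  have t12 : τ 12 = σ₀ 12 := by
    rw [τfr 12 (by omega) (by omega) (by omega) (by omega) fun j _ => by
      simp only [OffLevel, cell]; omega, vfr 12 (by omega) (by omega)]
  have t8 : τ 8 = f n := by
    rw [τfr 8 (by omega) (by omega) (by omega) (by omega) fun j _ => by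
      simp only [OffLevel, cell]; omega, v8]
  refine copyCmd_wp (b := 1) (by omega) hm hp hw hk τs
    (b1.congr t11 fun j hj => by rw [tlvl j hj, vlvl]) (by omega)
    fun π πs πb πt πfr π0 πU => ?_
  simp only [Nat.mul_zero, Nat.add_zero, Nat.mul_one, Nat.reduceAdd] at τt πt τU πU πfr τfr
  rw [v9] at τt τU
  rw [t11] at πt πU
  have plvl : ∀ j < Nat.clog 2 m, lvl π 0 j = lvl τ 0 j := fun j hj => by
    unfold lvl
    congr 1 <;> refine πfr _ ?_ ?_ ?_ ?_ fun j' _ => ?_ <;> simp only [OffLevel, cell] <;> omega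
  have p9 : π 9 = τ 9 := πfr 9 (by omega) (by omega) (by omega) (by omega) fun j _ => by
    simp only [OffLevel, cell]; omega
  have p10 : π 10 = τ 10 := πfr 10 (by omega) (by omega) (by omega) (by omega) fun j _ => by
    simp only [OffLevel, cell]; omega
  have l0 := hi.le 0 (by omega)
  have l1 := hi.le 1 (by omega)
  have bt0 := b0.time
  have bt1 := b1.time
  simp only [Nat.mul_zero, Nat.add_zero, Nat.mul_one, Nat.reduceAdd] at l0 l1 bt0 bt1
  have hsh := hi.shift
  -- the local texts do not change unless there is a restart
  have hU0 : NoCollision p r (localText m f (n + 1) 0 π) P m (2 * m) →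
      Tracks m p r P (localText m f (n + 1) 0 π) 0 τ ∧
        (τ 0 ≠ 0 ↔ m ≤ τ 9 ∧ Occ (localText m f (n + 1) 0 π) P (τ 9 - m) m) := by
    intro hno
    have h1 := τU (localText m f (n + 1) 0 π) (fun h2 => ?_) ?_ hno
    · simpa [v0] using h1
    · have h3 : localText m f (n + 1) 0 π = localText m f n 0 σ₀ := by
        funext k
        simp only [localText, Nat.mul_zero, Nat.add_zero]
        rw [p9, τt, if_neg h2]
        congr 2
        omega
      rw [h3] at hno ⊢
      exact (hi.tracks 0 (by omega) hno).congr (by simpa using v9)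
        (vfr _ (by omega) (by omega)) fun j _ => vlvl 0 j
    -- The symbol just read has index `n + m` in the padded text, whether or not there was a
    -- restart.
    · have h3 : n + 1 + m - τ 9 + (τ 9 - 1) = n + m := by
        rw [τt]
        split_ifs <;> omega
      simp only [localText, Nat.mul_zero, Nat.add_zero, p9, h3, extend]
      rw [if_neg (by omega), v8, Nat.add_sub_cancel]
  have hU1 : NoCollision p r (localText m f (n + 1) 1 π) P m (2 * m) →
      Tracks m p r P (localText m f (n + 1) 1 π) 1 π ∧
        (π 0 ≠ 0 ↔ τ 0 ≠ 0 ∨ (m ≤ π 11 ∧ Occ (localText m f (n + 1) 1 π) P (π 11 - m) m)) := by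
    intro hno
    refine πU (localText m f (n + 1) 1 π) (fun h2 => ?_) ?_ hno
    · have h3 : localText m f (n + 1) 1 π = localText m f n 1 σ₀ := by
        funext k
        simp only [localText, Nat.mul_one, Nat.reduceAdd]
        rw [πt, if_neg h2]
        congr 2
        omega
      rw [h3] at hno ⊢
      exact (hi.tracks 1 (by omega) hno).congr t11 t12 fun j hj => by rw [tlvl j hj, vlvl]
    · have h3 : n + 1 + m - π 11 + (π 11 - 1) = n + m := by
        rw [πt]
        split_ifs <;> omega
      simp only [localText, Nat.mul_one, Nat.reduceAdd, h3, extend]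
      rw [if_neg (by omega), t8, Nat.add_sub_cancel]
  refine h π ⟨πs, ?_, ?_, ?_, ?_, ?_⟩
  · intro b hb
    rcases (by omega : b = 0 ∨ b = 1) with rfl | rfl
    · exact τb.congr p9 plvl
    · exact πb
  · rw [p9, τt, πt]
    split_ifs <;> omega
  · intro b hb
    rcases (by omega : b = 0 ∨ b = 1) with rfl | rfl
    · simp only [Nat.mul_zero, Nat.add_zero]
      rw [p9, τt]
      split_ifs <;> omega
    · simp only [Nat.mul_one, Nat.reduceAdd]
      rw [πt]
      split_ifs <;> omega
  · intro b hb hno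
    rcases (by omega : b = 0 ∨ b = 1) with rfl | rfl
    · exact (hU0 hno).1.congr p9 p10 plvl
    · exact (hU1 hno).1
  · intro _ hno
    -- The last `m` symbols of either local text are the same stretch of the padded text, starting
    -- at `n + 1`.
    have hocc : ∀ b t, π (9 + 2 * b) = t → t ≤ n + 1 + m → m ≤ t →
        (Occ (localText m f (n + 1) b π) P (t - m) m ↔ Occ (extend m f) P (n + 1) m) := by
      intro b t ht h1 h2
      unfold Occ localText
      rw [ht]
      refine forall₂_congr fun k _ => ?_
      rw [show n + 1 + m - t + (t - m + k) = n + 1 + k by omega]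
    have h9 : τ 9 ≤ n + 1 + m := by rw [τt]; split_ifs <;> omega
    have h11 : π 11 ≤ n + 1 + m := by rw [πt]; split_ifs <;> omega
    -- The two times differ by exactly `m`, so the larger one is at least `m`.
    have hge : m ≤ τ 9 ∨ m ≤ π 11 := by
      rw [τt, πt]
      split_ifs <;> omega
    rw [(hU1 (hno 1 (by omega))).2, (hU0 (hno 0 (by omega))).2]
    have c0 := hocc 0 (τ 9) p9 h9
    have c1 := hocc 1 (π 11) rfl h11
    constructor
    · rintro (⟨h1, h2⟩ | ⟨h1, h2⟩)
      · exact (c0 h1).1 h2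
      · exact (c1 h1).1 h2
    · intro ho
      rcases hge with h1 | h1
      · exact Or.inl ⟨h1, (c0 h1).2 ho⟩
      · exact Or.inr ⟨h1, (c1 h1).2 ho⟩

end Programs


section Programs

variable {E : Env} {k w m nP nT p r : ℕ} {P : ℕ → ℕ} {Q : Mem → Prop} {σ : Mem}

/-! ### The modulus -/

/-- The number of values among which the evaluation point is chosen is at least this number. -/
def sizeExpr (s : ℕ) : Expr :=
  .op .mul (.op .mul (.op .mul (.const (4 * s)) (var 3)) (var 3)) (var 3)

/-- The value of `sizeExpr s` for patterns of length `m`. -/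
def size (s m : ℕ) : ℕ := 4 * s * m * m * m

/-- The modulus is at least this number. -/
def minModulus (s m nP : ℕ) : ℕ := 2 * size s m + nP + 5

/-- Search for a prime. Cell `5` holds the factorial of the predecessor of the candidate. -/
def primeCmd (s : ℕ) : Cmd :=
  .seq (set 3 (var 0)) <|
  .seq (set 4 (.const 2)) <|
  .seq (set 5 (.const 1)) <|
  .seq (.while (.op .add
      (.op .lt (var 4) (.op .add (.op .add (.op .mul (.const 2) (sizeExpr s)) (var 1)) (.const 5)))
      (.op .eq (.op .mod (.op .mul (var 5) (var 5)) (var 4)) (.const 0))) <|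
    .seq (set 5 (.op .mul (var 5) (var 4))) <|
    set 4 (.op .add (var 4) (.const 1))) <|
  set 5 (.const 0)

/-- For `n = a * b` with `a, b < n` each factor divides `(n - 1)!`. Squaring takes care of squares
of primes; `3!` is not divisible by `4`. -/
theorem prime_of_not_dvd_factorial_sq {n : ℕ} (hn : 2 ≤ n)
    (h : (n - 1).factorial * (n - 1).factorial % n ≠ 0) : n.Prime := by
  by_contra hp
  obtain ⟨a, b, ha, hb, rfl⟩ := (Nat.not_prime_iff_exists_mul_eq hn).1 hp
  refine h (Nat.mod_eq_zero_of_dvd (mul_dvd_mul ?_ ?_))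
  · refine Nat.dvd_factorial ?_ (by omega)
    exact Nat.pos_of_ne_zero fun h0 => by simp [h0] at hn
  · refine Nat.dvd_factorial ?_ (by omega)
    exact Nat.pos_of_ne_zero fun h0 => by simp [h0] at hn

theorem not_dvd_factorial_sq {n : ℕ} (hn : n.Prime) :
    (n - 1).factorial * (n - 1).factorial % n ≠ 0 := fun h => by
  have h1 : n ∣ (n - 1).factorial := (hn.dvd_mul.1 (Nat.dvd_of_mod_eq_zero h)).elim id id
  have := hn.dvd_factorial.1 h1
  have := hn.pos
  omega

/-- The prime `q` is only a bound that makes the search stop and limits the factorial. The words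
here may be as long as `q !` requires, since the space of the preprocessing is not counted. -/
theorem primeCmd_wp {s q : ℕ} (hq : q.Prime) (hqN : minModulus s m nP ≤ q) (h0 : σ 0 = m)
    (h1 : σ 1 = nP) (hk : 6 ≤ k) (hw : q.factorial < 2 ^ w)
    (h : ∀ p, p.Prime → minModulus s m nP ≤ p → p ≤ q →
      Q (Function.update (Function.update (Function.update σ 3 m) 4 p) 5 0)) :
    Wp E k w (primeCmd s) Q σ := by
  have hq2 := hq.two_le
  have hqf := Nat.self_le_factorial q
  refine Wp.of_fits fun hf => ?_
  refine Wp.seq_store (by simp only [Expr.eval]; omega) (hf.1 _) ?_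
  refine Wp.seq_store (by simp only [Expr.eval]; omega) (by simp only [Expr.eval]; omega) ?_
  refine Wp.seq_store (by simp only [Expr.eval]; omega) (by simp only [Expr.eval]; omega) ?_
  simp only [Expr.eval, h0]
  refine Wp.seq (Wp.while (fun τ => ∃ p, 2 ≤ p ∧ p ≤ q ∧ τ = Function.update (Function.update
    (Function.update σ 3 m) 4 p) 5 (p - 1).factorial) (fun τ => q - τ 4) ?_ ?_ ?_)
  · exact ⟨2, le_rfl, hq2, rfl⟩
  · rintro τ ⟨p, hp2, hpq, rfl⟩ hc
    simp (disch := omega) only [Expr.eval, Op.arith_eval, sizeExpr, upd_eq, upd_ne, h1] at hc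
    have hlt : p < q := by
      refine lt_of_le_of_ne hpq ?_
      rintro rfl
      refine hc ?_
      rw [Nat.add_eq_zero_iff, Op.eval_lt_eq_zero, Op.eval_eq_eq_zero]
      exact ⟨hqN, not_dvd_factorial_sq hq⟩
    have hfac : (p - 1).factorial * p = p.factorial := by
      rw [mul_comm, Nat.mul_factorial_pred (by omega)]
    have hple : p.factorial ≤ q.factorial := Nat.factorial_le hpq
    refine Wp.seq_store (by simp only [Expr.eval]; omega) ?_ ?_
    · simp (disch := omega) only [Expr.eval, Op.arith_eval, upd_eq, upd_ne, hfac]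
      omega
    simp (disch := omega) only [Expr.eval, Op.arith_eval, upd_eq, upd_ne, hfac]
    refine Wp.store (by simp only [Expr.eval]; omega) ?_ ?_
    · simp (disch := omega) only [Expr.eval, Op.arith_eval, upd_eq, upd_ne]
      omega
    simp (disch := omega) only [Expr.eval, Op.arith_eval, upd_eq, upd_ne]
    refine ⟨⟨p + 1, by omega, by omega, ?_⟩, by omega⟩
    funext a
    rw [Nat.add_sub_cancel]
    by_cases h4 : a = 4
    · subst h4
      simp (disch := omega) only [upd_eq, upd_ne]
    by_cases h5 : a = 5
    · subst h5
      simp (disch := omega) only [upd_eq, upd_ne]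
    simp (disch := omega) only [upd_ne]
  · rintro τ ⟨p, hp2, hpq, rfl⟩ hc
    simp (disch := omega) only [Expr.eval, Op.arith_eval, sizeExpr, upd_eq, upd_ne, h1,
      Nat.add_eq_zero_iff, Op.eval_lt_eq_zero, Op.eval_eq_eq_zero] at hc
    refine Wp.store (by simp only [Expr.eval]; omega) (by simp only [Expr.eval]; omega) ?_
    simp only [Expr.eval, Function.update_idem]
    exact h p (prime_of_not_dvd_factorial_sq hp2 hc.2) hc.1 hpq

/-! ### The coded pattern and the levels -/

/-- Storing the data of a new level, and the next length. -/
def newLevelCmd : Cmd :=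
  .seq (.store (.op .add (.const 44) (.op .mul (.const 16) (var 7))) (var 18)) <|
  .seq (.store (.op .add (.const 45) (.op .mul (.const 16) (var 7))) (var 16)) <|
  .seq (.store (.op .add (.const 46) (.op .mul (.const 16) (var 7))) (var 17)) <|
  .seq (set 7 (.op .add (var 7) (.const 1))) <|
  .ite (.op .lt (.op .mul (.const 2) (var 18)) (var 3))
    (set 18 (.op .mul (.const 2) (var 18)))
    (set 18 (var 3))

/-- One symbol of the pattern. -/
def patCmd : Cmd :=
  .seq (searchCmd 19 (var 2) (.rel (.pat (var 15)) (var 19))) <|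
  .seq (searchCmd 20 (var 1) (.rel (var 20) (var 19))) <|
  .seq (set 20 (.op .add (.op .add (var 20) (.const 1)) (.op .eq (var 19) (var 2)))) <|
  .seq (.ite (var 15) .skip (set 6 (var 20))) <|
  .seq (set 16 (.op .mod (.op .add (.op .mul (var 16) (var 5)) (var 20)) (var 4))) <|
  .seq (set 17 (.op .mod (.op .mul (var 17) (var 5)) (var 4))) <|
  .seq (set 15 (.op .add (var 15) (.const 1))) <|
  .ite (.op .eq (var 15) (var 18)) newLevelCmd .skip

/-- The coded pattern is read, the data of the levels are stored, and the copies are started. -/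
def tableCmd : Cmd :=
  .seq (set 15 (.const 0)) <|
  .seq (set 16 (.const 0)) <|
  .seq (set 17 (.const 1)) <|
  .seq (set 18 (.const 2)) <|
  .seq (.while (.op .lt (var 15) (var 3)) patCmd) <|
  set 11 (var 3)

theorem newLevelCmd_wp (hk : cell 15 (σ 7) < k) (h7 : σ 7 + 1 < 2 ^ w) (h3 : 2 * σ 3 < 2 ^ w)
    (h : ∀ τ, τ (cell 12 (σ 7)) = σ 18 → τ (cell 13 (σ 7)) = σ 16 → τ (cell 14 (σ 7)) = σ 17 →
      τ 7 = σ 7 + 1 → τ 18 = min (2 * σ 18) (σ 3) →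
      (∀ a, a ≠ 7 → a ≠ 18 → (a < cell 12 (σ 7) ∨ cell 14 (σ 7) < a) → τ a = σ a) → Q τ) :
    Wp E k w newLevelCmd Q σ := by
  refine Wp.of_fits fun hf => ?_
  simp only [cell] at hk h
  refine Wp.seq_store (by simp only [Expr.eval, Op.arith_eval]; omega) (hf.1 _) ?_
  simp only [Expr.eval, Op.arith_eval]
  refine Wp.seq_store ?_ ?_ ?_
  · simp (disch := omega) only [Expr.eval, Op.arith_eval, upd_ne]
    omega
  · simp (disch := omega) only [Expr.eval, upd_ne]
    exact hf.1 _
  simp (disch := omega) only [Expr.eval, Op.arith_eval, upd_ne]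
  refine Wp.seq_store ?_ ?_ ?_
  · simp (disch := omega) only [Expr.eval, Op.arith_eval, upd_ne]
    omega
  · simp (disch := omega) only [Expr.eval, upd_ne]
    exact hf.1 _
  simp (disch := omega) only [Expr.eval, Op.arith_eval, upd_ne]
  refine Wp.seq_store (by simp only [Expr.eval]; omega) ?_ ?_
  · simp (disch := omega) only [Expr.eval, Op.arith_eval, upd_ne]
    omega
  simp (disch := omega) only [Expr.eval, Op.arith_eval, upd_ne]
  refine Wp.ite (fun h0 => ?_) (fun h0 => ?_)
  · simp (disch := omega) only [Expr.eval, Op.arith_eval, upd_ne, ne_eq, Op.eval_lt_eq_zero,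
      not_le] at h0
    refine Wp.store (by simp only [Expr.eval]; omega) ?_ ?_
    · simp (disch := omega) only [Expr.eval, Op.arith_eval, upd_ne]
      omega
    simp (disch := omega) only [Expr.eval, Op.arith_eval, upd_ne]
    refine h _ ?_ ?_ ?_ ?_ ?_ ?_
    · simp (disch := omega) only [upd_eq, upd_ne]
    · simp (disch := omega) only [upd_eq, upd_ne]
    · simp (disch := omega) only [upd_eq, upd_ne]
    · simp (disch := omega) only [upd_eq, upd_ne]
    · simp only [upd_eq]
      omega
    · intro a _ _ _
      simp (disch := omega) only [upd_ne]
  · simp (disch := omega) only [Expr.eval, Op.arith_eval, upd_ne, Op.eval_lt_eq_zero] at h0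
    refine Wp.store (by simp only [Expr.eval]; omega) ?_ ?_
    · simp (disch := omega) only [Expr.eval, upd_ne]
      exact hf.1 _
    simp (disch := omega) only [Expr.eval, upd_ne]
    refine h _ ?_ ?_ ?_ ?_ ?_ ?_
    · simp (disch := omega) only [upd_eq, upd_ne]
    · simp (disch := omega) only [upd_eq, upd_ne]
    · simp (disch := omega) only [upd_eq, upd_ne]
    · simp (disch := omega) only [upd_eq, upd_ne]
    · simp only [upd_eq]
      omega
    · intro a _ _ _
      simp (disch := omega) only [upd_ne]

/-- The state after the first `q` symbols of the coded pattern `P` have been read; the memory was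
`σ` at the beginning. -/
structure Table (m p r : ℕ) (P : ℕ → ℕ) (σ : Mem) (q : ℕ) (τ : Mem) : Prop where
  pos : τ 15 = q
  le : q ≤ m
  fp : τ 16 = fingerprint p r P q
  pow : τ 17 = r ^ q % p
  fst : 0 < q → τ 6 = P 0
  next : (q < τ 18 ∧ τ 18 = len m (τ 7 + 1) ∧ τ 7 < Nat.clog 2 m) ∨ (q = m ∧ τ 7 = Nat.clog 2 m)
  level : ∀ j < τ 7, τ (cell 12 j) = len m (j + 1) ∧
    τ (cell 13 j) = fingerprint p r P (len m (j + 1)) ∧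
    τ (cell 14 j) = r ^ len m (j + 1) % p
  frame : ∀ a, a ≠ 6 → a ≠ 7 → (a < 15 ∨ 20 < a) →
    (∀ j < τ 7, a < cell 12 j ∨ cell 14 j < a) → τ a = σ a

theorem Table.frame_le {q : ℕ} {τ : Mem} (h : Table m p r P σ q τ) {a : ℕ} (h6 : a ≠ 6)
    (h7 : a ≠ 7) (ha : a < 15) : τ a = σ a :=
  h.frame a h6 h7 (Or.inl ha) fun j _ => by simp only [cell]; omega

theorem patCmd_wp {q : ℕ} {σ₀ : Mem} (hm : 2 ≤ m) (hp : 1 < p) (hk : cell 0 (Nat.clog 2 m) ≤ k)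
    (hmw : 2 * m < 2 ^ w) (hnP : nP + 2 < 2 ^ w) (hnT : nT < 2 ^ w)
    (h1 : σ₀ 1 = nP) (h2 : σ₀ 2 = nT) (h3 : σ₀ 3 = m) (h4 : σ₀ 4 = p) (h5 : σ₀ 5 = r)
    (hP : patCode E.rel nP nT (E.pat q) = P q) (ht : Table m p r P σ₀ q σ) (hq : q < m)
    (h : ∀ τ, Table m p r P σ₀ (q + 1) τ → Q τ) : Wp E k w patCmd Q σ := by
  simp only [cell] at hk
  have hnext : q < σ 18 ∧ σ 18 = len m (σ 7 + 1) ∧ σ 7 < Nat.clog 2 m :=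
    ht.next.resolve_right fun h6 => by omega
  have e1 : σ 1 = nP := by rw [ht.frame_le (by omega) (by omega) (by omega), h1]
  have e2 : σ 2 = nT := by rw [ht.frame_le (by omega) (by omega) (by omega), h2]
  have e3 : σ 3 = m := by rw [ht.frame_le (by omega) (by omega) (by omega), h3]
  have e4 : σ 4 = p := by rw [ht.frame_le (by omega) (by omega) (by omega), h4]
  have e5 : σ 5 = r := by rw [ht.frame_le (by omega) (by omega) (by omega), h5]
  refine Wp.of_fits fun hf => ?_
  have hpw := hf.1 4
  have h7w := hf.1 7
  rw [e4] at hpw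
  refine Wp.seq (searchCmd_wp (n := nT) (f := E.rel (E.pat q)) (by omega) hnT ?_ ?_ ?_)
  · intro v
    simp (disch := omega) only [Expr.eval, upd_ne, e2]
  · intro v
    simp (disch := omega) only [Expr.eval, upd_eq, upd_ne, ht.pos]
  set a := firstIdx (E.rel (E.pat q)) nT with ha
  have haT : a ≤ nT := firstIdx_le ..
  refine Wp.seq (searchCmd_wp (n := nP) (f := fun x => E.rel x a) (by omega) (by omega) ?_ ?_ ?_)
  · intro v
    simp (disch := omega) only [Expr.eval, upd_ne, e1]
  · intro v
    simp (disch := omega) only [Expr.eval, upd_eq, upd_ne]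
  have hle := firstIdx_le (fun x => E.rel x a) nP
  have hcode : firstIdx (fun x => E.rel x a) nP + 1 + Op.eval .eq a nT = P q := by
    rw [← hP, patCode, ← ha, textCode, Op.eval_eq_eq]
  have hcle : P q ≤ nP + 2 := hP ▸ patCode_le ..
  refine Wp.seq_store (by simp only [Expr.eval]; omega) ?_ ?_
  · simp (disch := omega) only [Expr.eval, Op.arith_eval, upd_eq, upd_ne, e2, hcode]
    omega
  simp (disch := omega) only [Expr.eval, Op.arith_eval, upd_eq, upd_ne, e2, hcode,
    Function.update_idem]
  set σ₁ : Mem := Function.update (Function.update σ 19 a) 20 (P q) with hσ₁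
  -- The rest of the loop body is treated once for both branches of the conditional that stores the
  -- first symbol.
  have key : ∀ σ₂ : Mem, (∀ b, b ≠ 6 → σ₂ b = σ₁ b) → σ₂ 6 = P 0 →
      Wp E k w (.seq (set 16 (.op .mod (.op .add (.op .mul (var 16) (var 5)) (var 20)) (var 4))) <|
        .seq (set 17 (.op .mod (.op .mul (var 17) (var 5)) (var 4))) <|
        .seq (set 15 (.op .add (var 15) (.const 1))) <|
        .ite (.op .eq (var 15) (var 18)) newLevelCmd .skip) Q σ₂ := by
    intro σ₂ hfr h6
    have f20 : σ₂ 20 = P q := by rw [hfr _ (by omega), hσ₁, upd_eq]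
    have ffr : ∀ b, b ≠ 6 → b ≠ 19 → b ≠ 20 → σ₂ b = σ b := by
      intro b hb1 hb2 hb3
      rw [hfr _ hb1, hσ₁]
      simp (disch := omega) only [upd_ne]
    have f4 : σ₂ 4 = p := by rw [ffr _ (by omega) (by omega) (by omega), e4]
    have f5 : σ₂ 5 = r := by rw [ffr _ (by omega) (by omega) (by omega), e5]
    have f15 : σ₂ 15 = q := by rw [ffr _ (by omega) (by omega) (by omega), ht.pos]
    have f16 : σ₂ 16 = fingerprint p r P q := by
      rw [ffr _ (by omega) (by omega) (by omega), ht.fp]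
    have f17 : σ₂ 17 = r ^ q % p := by rw [ffr _ (by omega) (by omega) (by omega), ht.pow]
    have hfp : (fingerprint p r P q * r + P q) % p = fingerprint p r P (q + 1) := rfl
    have hpow : r ^ q % p * r % p = r ^ (q + 1) % p := by rw [Nat.mod_mul_mod, pow_succ]
    refine Wp.seq_store (by simp only [Expr.eval]; omega) ?_ ?_
    · simp (disch := omega) only [Expr.eval, Op.arith_eval, f16, f5, f20, f4, hfp]
      exact (fingerprint_lt (by omega) ..).trans hpw
    simp only [Expr.eval, Op.arith_eval, f16, f5, f20, f4, hfp]
    refine Wp.seq_store (by simp only [Expr.eval]; omega) ?_ ?_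
    · simp (disch := omega) only [Expr.eval, Op.arith_eval, upd_ne, f17, f5, f4, hpow]
      exact (Nat.mod_lt _ (by omega)).trans hpw
    simp (disch := omega) only [Expr.eval, Op.arith_eval, upd_ne, f17, f5, f4, hpow]
    refine Wp.seq_store (by simp only [Expr.eval]; omega) ?_ ?_
    · simp (disch := omega) only [Expr.eval, Op.arith_eval, upd_ne, f15]
      omega
    simp (disch := omega) only [Expr.eval, Op.arith_eval, upd_ne, f15]
    generalize hυ : (Function.update _ 15 (q + 1) : Mem) = υ
    have v15 : υ 15 = q + 1 := by rw [← hυ, upd_eq]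
    have v16 : υ 16 = fingerprint p r P (q + 1) := by
      rw [← hυ]
      simp (disch := omega) only [upd_eq, upd_ne]
    have v17 : υ 17 = r ^ (q + 1) % p := by
      rw [← hυ]
      simp (disch := omega) only [upd_eq, upd_ne]
    have v6 : υ 6 = P 0 := by
      rw [← hυ, ← h6]
      simp (disch := omega) only [upd_ne]
    have vfr : ∀ b, b ≠ 6 → (b < 15 ∨ b = 18 ∨ 20 < b) → υ b = σ b := by
      intro b hb1 hb2
      rw [← ffr b hb1 (by omega) (by omega), ← hυ]
      simp (disch := omega) only [upd_ne]
    have v7 : υ 7 = σ 7 := vfr 7 (by omega) (by omega)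
    have v18 : υ 18 = σ 18 := vfr 18 (by omega) (by omega)
    have v3 : υ 3 = m := by rw [vfr 3 (by omega) (by omega), e3]
    clear hυ
    refine Wp.ite (fun hc => ?_) (fun hc => ?_)
    · simp only [Expr.eval, ne_eq, Op.eval_eq_eq_zero, not_not, v15, v18] at hc
      refine newLevelCmd_wp (by simp only [cell]; omega) ?_ (by omega)
        fun τ t12 t13 t14 t7 t18 tfr => h τ ?_
      -- The number of levels stays below `m`, so it fits in a word.
      · have : σ 7 < 2 ^ σ 7 := Nat.lt_two_pow_self
        have : 2 ^ σ 7 < m := (Nat.lt_clog_iff_pow_lt (by omega)).1 hnext.2.2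
        omega
      rw [v7] at t12 t13 t14 t7 tfr
      rw [v18, v3] at t18
      have t18' : τ 18 = len m (σ 7 + 2) := by
        rw [t18, hnext.2.1]
        have : 2 ^ (σ 7 + 2) = 2 * 2 ^ (σ 7 + 1) := by ring
        unfold len
        omega
      refine ⟨?_, by omega, ?_, ?_, fun _ => ?_, ?_, ?_, ?_⟩
      · rw [tfr 15 (by omega) (by omega) (by simp only [cell]; omega), v15]
      · rw [tfr 16 (by omega) (by omega) (by simp only [cell]; omega), v16]
      · rw [tfr 17 (by omega) (by omega) (by simp only [cell]; omega), v17]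
      · rw [tfr 6 (by omega) (by omega) (by simp only [cell]; omega), v6]
      · rw [t7]
        rcases (by omega : σ 7 + 1 < Nat.clog 2 m ∨ σ 7 + 1 = Nat.clog 2 m) with h8 | h8
        · refine Or.inl ⟨?_, t18', h8⟩
          rw [hc, t18', hnext.2.1]
          exact len_lt_succ h8
        · refine Or.inr ⟨?_, h8⟩
          rw [hc, hnext.2.1, h8, len_clog]
      · intro j hj
        rcases (by omega : j < σ 7 ∨ j = σ 7) with hj' | rfl
        · have ho : ∀ i, 12 ≤ i → i ≤ 14 → τ (cell i j) = σ (cell i j) := by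
            intro i _ _
            rw [tfr _ (by simp only [cell]; omega) (by simp only [cell]; omega)
              (by simp only [cell]; omega), vfr _ (by simp only [cell]; omega)
              (by simp only [cell]; omega)]
          rw [ho 12 (by omega) (by omega), ho 13 (by omega) (by omega),
            ho 14 (by omega) (by omega)]
          exact ht.level j hj'
        · rw [t12, t13, t14, v18, v16, v17, ← hnext.2.1, hc]
          exact ⟨rfl, rfl, rfl⟩
      · intro b hb1 hb2 hb3 hb4
        rw [tfr b hb2 (by omega) (hb4 _ (by omega)), vfr b hb1 (by omega)]
        exact ht.frame b hb1 hb2 hb3 fun j hj => hb4 j (by omega)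
    · simp only [Expr.eval, Op.eval_eq_eq_zero, v15, v18] at hc
      refine Wp.skip (h υ ⟨v15, by omega, v16, v17, fun _ => v6, Or.inl ?_, ?_, ?_⟩)
      · rw [v18, v7]
        exact ⟨by omega, hnext.2⟩
      · rw [v7]
        intro j hj
        have ho : ∀ i, υ (cell i j) = σ (cell i j) := fun i =>
          vfr _ (by simp only [cell]; omega) (by simp only [cell]; omega)
        rw [ho, ho, ho]
        exact ht.level j hj
      · intro b hb1 hb2 hb3 hb4
        rw [vfr b hb1 (by omega)]
        exact ht.frame b hb1 hb2 hb3 fun j hj => hb4 j (by omega)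
  refine Wp.seq (Wp.ite (fun h0 => Wp.skip (key σ₁ (fun _ _ => rfl) ?_)) fun h0 => ?_)
  · have h00 : σ₁ 15 ≠ 0 := h0
    rw [hσ₁, upd_ne (by omega), upd_ne (by omega), ht.pos] at h00
    rw [hσ₁, upd_ne (by omega), upd_ne (by omega)]
    exact ht.fst (by omega)
  · have h00 : σ₁ 15 = 0 := h0
    rw [hσ₁, upd_ne (by omega), upd_ne (by omega), ht.pos] at h00
    have h20 : σ₁ 20 = P q := by rw [hσ₁, upd_eq]
    refine Wp.store (by simp only [Expr.eval]; omega) (by simp only [Expr.eval, h20]; omega) ?_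
    simp only [Expr.eval, h20]
    refine key _ (fun b hb => upd_ne hb) ?_
    rw [upd_eq, h00]

theorem fingerprint_zero {U : ℕ → ℕ} {n : ℕ} (h : ∀ k < n, U k = 0) :
    fingerprint p r U n = 0 := by
  induction n with
  | zero => rfl
  | succ n ih => rw [fingerprint, ih fun k hk => h k (by omega), h n (by omega)]; simp

/-- Copy `1` starts as if it had read `m` padding symbols `0`, which creates the shift between the
copies. No work is needed for this: the fingerprint of zeros is `0`, and no prefix occurs because
all pattern codes are positive. -/
theorem Table.invariant {f : ℕ → ℕ} {τ : Mem} (hm : 2 ≤ m) (h1 : σ 1 = nP) (h3 : σ 3 = m)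
    (h4 : σ 4 = p) (h5 : σ 5 = r) (h0 : ∀ a, 9 ≤ a → (a < 13 ∨ 32 ≤ a) → σ a = 0)
    (hP : 0 < P 0) (ht : Table m p r P σ m τ) :
    Invariant m nP p r P f 0 (Function.update τ 11 m) := by
  have h7 : τ 7 = Nat.clog 2 m := by
    rcases ht.next with h8 | h8
    · have := len_le (m := m) (τ 7 + 1)
      omega
    · exact h8.2
  have hlow : ∀ a, a ≠ 6 → a ≠ 7 → a ≠ 11 → a < 15 → Function.update τ 11 m a = σ a :=
    fun a ha1 ha2 ha3 ha4 => by rw [upd_ne ha3, ht.frame_le ha1 ha2 ha4]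
  have h9 : Function.update τ 11 m 9 = 0 := by
    rw [hlow 9 (by omega) (by omega) (by omega) (by omega), h0 9 (by omega) (by omega)]
  have h10 : Function.update τ 11 m 10 = 0 := by
    rw [hlow 10 (by omega) (by omega) (by omega) (by omega), h0 10 (by omega) (by omega)]
  have h11 : Function.update τ 11 m 11 = m := upd_eq ..
  have h12 : Function.update τ 11 m 12 = 0 := by
    rw [hlow 12 (by omega) (by omega) (by omega) (by omega), h0 12 (by omega) (by omega)]
  have hcells : ∀ i j, cell i j ≠ 11 := fun i j => by simp only [cell]; omega
  have hlvl : ∀ b ≤ 1, ∀ j, lvl (Function.update τ 11 m) b j = ⟨0, 0, 0, 0, 0, 0⟩ := by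
    intro b hb j
    have hz : ∀ i < 6, Function.update τ 11 m (cell (6 * b + i) j) = 0 := by
      intro i hi
      rw [upd_ne (hcells _ _), ht.frame, h0]
      all_goals simp only [cell]; intros; interval_cases b <;> interval_cases i <;> omega
    unfold lvl
    congr 1
    exacts [hz 0 (by omega), hz 1 (by omega), hz 2 (by omega), hz 3 (by omega), hz 4 (by omega),
      hz 5 (by omega)]
  have hpos : ∀ j, 0 < len m j := fun j => lt_min (by positivity) (by omega)
  refine ⟨⟨?_, ?_, ?_, ?_, ?_, ?_, ?_, ?_, ?_⟩, ?_, ?_, ?_, ?_, by simp⟩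
  · rw [hlow 1 (by omega) (by omega) (by omega) (by omega), h1]
  · rw [hlow 3 (by omega) (by omega) (by omega) (by omega), h3]
  · rw [hlow 4 (by omega) (by omega) (by omega) (by omega), h4]
  · rw [hlow 5 (by omega) (by omega) (by omega) (by omega), h5]
  · rw [upd_ne (by omega), ht.fst (by omega)]
  · rw [upd_ne (by omega), h7]
  · exact fun j hj => by rw [upd_ne (hcells _ _), (ht.level j (h7 ▸ hj)).1]
  · exact fun j hj => by rw [upd_ne (hcells _ _), (ht.level j (h7 ▸ hj)).2.1]
  · exact fun j hj => by rw [upd_ne (hcells _ _), (ht.level j (h7 ▸ hj)).2.2]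
  · intro b hb
    refine ⟨?_, fun j _ => by rw [hlvl b hb]; exact Nat.zero_le _,
      fun j _ => by rw [hlvl b hb]; exact Nat.zero_le _,
      fun j _ => by rw [hlvl b hb]; exact Nat.zero_le _⟩
    rcases (by omega : b = 0 ∨ b = 1) with rfl | rfl
    · simp only [Nat.mul_zero, Nat.add_zero, h9]
      omega
    · simp only [Nat.mul_one, Nat.reduceAdd, h11]
      omega
  · rw [h9, h11]
    omega
  · intro b hb
    rcases (by omega : b = 0 ∨ b = 1) with rfl | rfl
    · simp only [Nat.mul_zero, Nat.add_zero, h9]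
      omega
    · simp only [Nat.mul_one, Nat.reduceAdd, h11]
      omega
  · intro b hb _
    rcases (by omega : b = 0 ∨ b = 1) with rfl | rfl
    · refine ⟨?_, fun j _ => Level.rep_empty (by rw [hlvl 0 hb]) ?_⟩
      · simp only [Nat.mul_zero, Nat.add_zero, h9, h10, fingerprint]
      · simp only [Nat.mul_zero, Nat.add_zero, h9]
        rintro i ⟨h8, -, -⟩
        have := hpos j
        omega
    · have hU : ∀ k < m, localText m f 0 1 (Function.update τ 11 m) k = 0 := by
        intro k hk
        simp only [localText, Nat.mul_one, Nat.reduceAdd, h11, extend]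
        rw [if_pos (by omega)]
      refine ⟨?_, fun j _ => Level.rep_empty (by rw [hlvl 1 hb]) ?_⟩
      · simp only [Nat.mul_one, Nat.reduceAdd, h11, h12]
        exact (fingerprint_zero hU).symm
      · simp only [Nat.mul_one, Nat.reduceAdd, h11]
        rintro i ⟨h8, -, h9⟩
        have := hpos j
        have h10 := h9 0 this
        rw [hU _ (by omega)] at h10
        omega

theorem tableCmd_wp {f : ℕ → ℕ} (hm : 2 ≤ m) (hp : 1 < p) (hk : cell 0 (Nat.clog 2 m) ≤ k)
    (hmw : 2 * m < 2 ^ w) (hnP : nP + 2 < 2 ^ w) (hnT : nT < 2 ^ w)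
    (h1 : σ 1 = nP) (h2 : σ 2 = nT) (h3 : σ 3 = m) (h4 : σ 4 = p) (h5 : σ 5 = r)
    (h7 : σ 7 = 0) (h0 : ∀ a, 9 ≤ a → (a < 13 ∨ 32 ≤ a) → σ a = 0)
    (hP : ∀ q, patCode E.rel nP nT (E.pat q) = P q)
    (h : ∀ τ, Invariant m nP p r P f 0 τ → τ 5 = σ 5 → Q τ) : Wp E k w tableCmd Q σ := by
  simp only [cell] at hk
  refine Wp.seq_store (by simp only [Expr.eval]; omega) (by simp only [Expr.eval]; omega) ?_
  refine Wp.seq_store (by simp only [Expr.eval]; omega) (by simp only [Expr.eval]; omega) ?_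
  refine Wp.seq_store (by simp only [Expr.eval]; omega) (by simp only [Expr.eval]; omega) ?_
  refine Wp.seq_store (by simp only [Expr.eval]; omega) (by simp only [Expr.eval]; omega) ?_
  simp only [Expr.eval]
  refine Wp.seq (Wp.while (fun τ => ∃ q, Table m p r P σ q τ) (fun τ => m - τ 15) ?_ ?_ ?_)
  · have hclog : 0 < Nat.clog 2 m := Nat.clog_pos (by omega) hm
    refine ⟨0, ?_, by omega, ?_, ?_, by simp, Or.inl ?_, ?_, ?_⟩
    · simp (disch := omega) only [upd_eq, upd_ne]
    · simp (disch := omega) only [upd_eq, upd_ne, fingerprint]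
    · simp (disch := omega) only [upd_eq, upd_ne, pow_zero]
      rw [Nat.mod_eq_of_lt hp]
    · simp (disch := omega) only [upd_eq, upd_ne, h7]
      refine ⟨by omega, ?_, hclog⟩
      simp [len, hm]
    · simp (disch := omega) only [upd_ne, h7]
      intro j hj
      omega
    · intro a _ _ _ _
      simp (disch := omega) only [upd_ne]
  · rintro τ ⟨q, hq⟩ hc
    have e3 : τ 3 = m := by rw [hq.frame_le (by omega) (by omega) (by omega), h3]
    simp only [Expr.eval, ne_eq, Op.eval_lt_eq_zero, hq.pos, e3, not_le] at hc
    refine patCmd_wp hm hp (by simpa only [cell]) hmw hnP hnT h1 h2 h3 h4 h5 (hP q) hq hc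
      fun υ hυ => ⟨⟨q + 1, hυ⟩, ?_⟩
    rw [hυ.pos, hq.pos]
    omega
  · rintro τ ⟨q, hq⟩ hc
    have e3 : τ 3 = m := by rw [hq.frame_le (by omega) (by omega) (by omega), h3]
    simp only [Expr.eval, Op.eval_lt_eq_zero, hq.pos, e3] at hc
    obtain rfl : q = m := le_antisymm hq.le hc
    refine Wp.store (by simp only [Expr.eval]; omega) (by simp only [Expr.eval, e3]; omega) ?_
    simp only [Expr.eval, e3]
    refine h _ (hq.invariant hm h1 h3 h4 h5 h0 (hP 0 ▸ patCode_pos ..)) ?_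
    rw [upd_ne (by omega), hq.frame_le (by omega) (by omega) (by omega)]

end Programs


/-! ### The evaluation point -/

theorem toOuterMeasure_apply_le_one {α : Type*} (μ : PMF α) (S : _root_.Set α) :
    μ.toOuterMeasure S ≤ 1 := by
  rw [PMF.toOuterMeasure_apply, ← μ.tsum_coe]
  exact ENNReal.tsum_le_tsum fun x => Set.indicator_le_self _ _ _

/-- The choice of the evaluation point, bit by bit. -/
def bitsCmd (s : ℕ) : Cmd :=
  .while (.op .lt (var 13) (sizeExpr s)) <|
    .seq (.flip (.const 14)) <|
    .seq (set 5 (.op .add (.op .mul (.const 2) (var 5)) (var 14))) <|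
    set 13 (.op .mul (.const 2) (var 13))

section Programs

variable {E : Env} {k w m : ℕ}

/-- Induction on the number `b` of flips still to come. The bits chosen so far stay readable as the
quotient `τ 5 / 2 ^ b`, which separates the outcomes of the next flip. -/
theorem bitsCmd_runs {s : ℕ} (hk : 15 ≤ k) (b : ℕ) : ∀ σ : Mem, Fits k w σ → σ 3 = m →
    size s m ≤ σ 13 * 2 ^ b → (0 < b → σ 13 * 2 ^ (b - 1) < size s m) →
    (σ 5 + 1) * 2 ^ b ≤ 2 ^ w → 2 * size s m ≤ 2 ^ w →
    ∃ μ : PMF Mem, Runs E (Fits k w) (bitsCmd s) σ μ ∧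
      (∀ τ ∈ μ.support, Fits k w τ ∧ τ 5 / 2 ^ b = σ 5 ∧
        ∀ a, a ≠ 5 → a ≠ 13 → a ≠ 14 → τ a = σ a) ∧
      ∀ v, μ.toOuterMeasure {τ | τ 5 = v} ≤ (2 ^ b)⁻¹ := by
  induction b with
  | zero =>
    intro σ hf h3 hS _ _ _
    refine ⟨PMF.pure σ, .while_false _ _ _ ?_, ?_, fun v => ?_⟩
    · simp only [Expr.eval, Op.arith_eval, sizeExpr, Op.eval_lt_eq_zero, h3]
      simpa [size] using hS
    · intro τ hτ
      rw [PMF.support_pure, Set.mem_singleton_iff] at hτ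
      subst hτ
      exact ⟨hf, by simp, fun _ _ _ _ => rfl⟩
    · simpa using toOuterMeasure_apply_le_one (PMF.pure σ) {τ | τ 5 = v}
  | succ b ih =>
    intro σ hf h3 hS hS' hw5 hw
    rw [Nat.add_sub_cancel] at hS'
    have hb1 : 1 ≤ 2 ^ b := Nat.one_le_two_pow
    have h13 : σ 13 * 2 ^ b < size s m := hS' (by omega)
    have h13' : σ 13 ≤ σ 13 * 2 ^ b := Nat.le_mul_of_pos_right _ hb1
    have hw5' : (2 * σ 5 + 2) * 2 ^ b ≤ 2 ^ w := by
      refine le_trans (le_of_eq ?_) hw5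
      ring
    have hw5'' : 2 * σ 5 + 2 ≤ 2 ^ w := (Nat.le_mul_of_pos_right _ hb1).trans hw5'
    have hxle : ∀ x : Bool, x.toNat ≤ 1 := fun x => by cases x <;> simp
    let g : Bool → Mem := fun x => Function.update (Function.update (Function.update σ 14 x.toNat) 5
      (2 * σ 5 + x.toNat)) 13 (2 * σ 13)
    have hf1 : ∀ x : Bool, Fits k w (Function.update σ 14 x.toNat) := fun x =>
      hf.update (by omega) (by have := hxle x; omega)
    have hg : ∀ x, Wp E k w (.seq (set 5 (.op .add (.op .mul (.const 2) (var 5)) (var 14))) <|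
        set 13 (.op .mul (.const 2) (var 13))) (fun τ => τ = g x)
        (Function.update σ 14 x.toNat) := by
      intro x
      have := hxle x
      refine Wp.seq_store (by simp only [Expr.eval]; omega) ?_ ?_
      · simp (disch := omega) only [Expr.eval, Op.arith_eval, upd_eq, upd_ne]
        omega
      simp (disch := omega) only [Expr.eval, Op.arith_eval, upd_eq, upd_ne]
      refine Wp.store (by simp only [Expr.eval]; omega) ?_ ?_
      · simp (disch := omega) only [Expr.eval, Op.arith_eval, upd_ne]
        omega
      simp (disch := omega) only [Expr.eval, Op.arith_eval, upd_ne, g]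
    have hg' : ∀ x, Runs E (Fits k w)
        (.seq (set 5 (.op .add (.op .mul (.const 2) (var 5)) (var 14))) <|
          set 13 (.op .mul (.const 2) (var 13))) (Function.update σ 14 x.toNat)
        (PMF.pure (g x)) ∧ Fits k w (g x) := by
      intro x
      obtain ⟨τ, h1, h2, rfl⟩ := hg x (hf1 x)
      exact ⟨h1, h2⟩
    have g5 : ∀ x, g x 5 = 2 * σ 5 + x.toNat := fun x => by
      simp (disch := omega) only [g, upd_eq, upd_ne]
    have g13 : ∀ x, g x 13 = 2 * σ 13 := fun x => by simp only [g, upd_eq]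
    have g14 : ∀ x, g x 14 = x.toNat := fun x => by
      simp (disch := omega) only [g, upd_eq, upd_ne]
    have gfr : ∀ x a, a ≠ 5 → a ≠ 13 → a ≠ 14 → g x a = σ a := fun x a _ _ _ => by
      simp (disch := omega) only [g, upd_ne]
    have hih := fun x => ih (g x) (hg' x).2 (by rw [gfr x 3 (by omega) (by omega) (by omega), h3])
      (by rw [g13]; refine hS.trans (le_of_eq ?_); ring)
      (fun hb => by
        rw [g13]
        refine lt_of_eq_of_lt ?_ h13
        obtain ⟨c, rfl⟩ : ∃ c, b = c + 1 := ⟨b - 1, by omega⟩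
        rw [Nat.add_sub_cancel]
        ring)
      (by
        rw [g5]
        refine le_trans (Nat.mul_le_mul_right _ ?_) hw5'
        have := hxle x
        omega) hw
    choose μ hμ1 hμ2 hμ3 using hih
    -- `Runs` wants the continuation as a function of the memory; the bit is recovered from cell
    -- `14`.
    let ν : Mem → PMF Mem := fun τ => μ (τ 14 == 1)
    have hν : ∀ x, ν (g x) = μ x := fun x => by
      simp only [ν, g14]
      cases x <;> simp
    let U : PMF Bool := PMF.uniformOfFintype Bool
    have hbody : Runs E (Fits k w) (.seq (.flip (.const 14)) <|
        .seq (set 5 (.op .add (.op .mul (.const 2) (var 5)) (var 14))) <|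
        set 13 (.op .mul (.const 2) (var 13))) σ (U.map g) := by
      have h1 := Runs.seq (.flip (.const 14)) (.seq (set 5 (.op .add (.op .mul (.const 2) (var 5))
        (var 14))) <| set 13 (.op .mul (.const 2) (var 13))) σ _
        (fun τ => PMF.pure (g (τ 14 == 1)))
        (Runs.flip (E := E) (ok := Fits k w) (.const 14) σ fun x => hf1 x) (by
          intro τ hτ
          rw [PMF.support_map] at hτ
          obtain ⟨x, -, rfl⟩ := hτ
          have h2 : (Function.update σ 14 x.toNat 14 == 1) = x := by
            rw [upd_eq]
            cases x <;> simp
          simp only [Expr.eval, h2]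
          exact (hg' x).1)
      have h3 : U.map g = ((PMF.uniformOfFintype Bool).map fun x =>
          Function.update σ ((Expr.const 14).eval E σ) x.toNat).bind
            fun τ => PMF.pure (g (τ 14 == 1)) := by
        rw [PMF.bind_map, ← PMF.bind_pure_comp]
        congr 1
        funext x
        simp only [Function.comp, Expr.eval, upd_eq]
        cases x <;> simp
      rw [h3]
      exact h1
    have hrun : Runs E (Fits k w) (bitsCmd s) σ ((U.map g).bind ν) := by
      refine Runs.while_true _ _ σ (U.map g) ν ?_ hbody ?_
      · simp only [Expr.eval, Op.arith_eval, sizeExpr, ne_eq, Op.eval_lt_eq_zero, h3, not_le]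
        exact h13'.trans_lt h13
      · intro τ hτ
        rw [PMF.support_map] at hτ
        obtain ⟨x, -, rfl⟩ := hτ
        rw [hν]
        exact hμ1 x
    rw [PMF.bind_map, show ν ∘ g = μ from funext hν] at hrun
    refine ⟨_, hrun, ?_, fun v => ?_⟩
    · intro τ hτ
      rw [PMF.mem_support_bind_iff] at hτ
      obtain ⟨x, -, hx⟩ := hτ
      obtain ⟨h1, h2, h4⟩ := hμ2 x τ hx
      refine ⟨h1, ?_, fun a ha1 ha2 ha3 => by rw [h4 a ha1 ha2 ha3, gfr x a ha1 ha2 ha3]⟩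
      rw [g5] at h2
      rw [pow_succ, ← Nat.div_div_eq_div_mul, h2]
      have := hxle x
      omega
    -- The value `v` determines its leading bits, so only one outcome of the flip can lead to it,
    -- and its probability is halved.
    · have hzero : ∀ x, v / 2 ^ b ≠ 2 * σ 5 + x.toNat →
          (μ x).toOuterMeasure {τ | τ 5 = v} = 0 := by
        intro x hx
        rw [PMF.toOuterMeasure_apply_eq_zero_iff, Set.disjoint_left]
        intro τ hτ hτv
        have h1 := (hμ2 x τ hτ).2.1
        rw [show τ 5 = v from hτv, g5] at h1
        exact hx h1
      have hhalf : ((2 : ENNReal) ^ (b + 1))⁻¹ = 2⁻¹ * (2 ^ b)⁻¹ := by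
        rw [pow_succ, mul_comm, ENNReal.mul_inv (by simp) (by simp)]
      rw [PMF.toOuterMeasure_bind_apply, tsum_fintype, Fintype.sum_bool, hhalf]
      simp only [U, PMF.uniformOfFintype_apply, Fintype.card_bool, Nat.cast_ofNat]
      by_cases hv : v / 2 ^ b = 2 * σ 5 + 1
      · rw [hzero false (by simp; omega), mul_zero, add_zero]
        exact mul_le_mul_right (hμ3 true v) _
      · rw [hzero true (by simpa using hv), mul_zero, zero_add]
        exact mul_le_mul_right (hμ3 false v) _

end Programs

/-! ### The algorithm -/

/-- The program that preprocesses the pattern. -/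
def preCmd (s : ℕ) : Cmd :=
  .seq (primeCmd s) <| .seq (set 13 (.const 1)) <| .seq (bitsCmd s) tableCmd

theorem two_pow_clog_le {n : ℕ} (hn : 1 ≤ n) : 2 ^ Nat.clog 2 n ≤ 2 * n := by
  rcases Nat.eq_zero_or_pos (Nat.clog 2 n) with h0 | h0
  · rw [h0, pow_zero]
    omega
  · obtain ⟨c, hc⟩ : ∃ c, Nat.clog 2 n = c + 1 := ⟨Nat.clog 2 n - 1, by omega⟩
    have h1 : 2 ^ c < n := (Nat.lt_clog_iff_pow_lt (by omega)).1 (by omega)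
    rw [hc, pow_succ]
    omega

theorem one_le_size {s m : ℕ} (hs : 0 < s) (hm : 0 < m) : 1 ≤ size s m := by
  unfold size
  exact Nat.succ_le_of_lt (by positivity)

section Algorithm

variable {k w m nP nT s : ℕ} {Δ : Fin nP → Fin nT → Bool}

/-- The coded pattern. -/
def patText (Δ : Fin nP → Fin nT → Bool) (P : Fin m → Fin nP) (q : ℕ) : ℕ :=
  patCode (relFun Δ) nP nT ((preEnv Δ P).pat q)

/-- The distribution of the memory after the arrival of `n` symbols: the evaluation point is
chosen among `2 ^ b` numbers, none with a probability of more than `1 / 2 ^ b`. -/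
structure Distribution (k w m nP p b : ℕ) (P f : ℕ → ℕ) (n : ℕ) (μ : PMF Mem) : Prop where
  fits : ∀ σ ∈ μ.support, Fits k w σ
  inv : ∀ σ ∈ μ.support, Invariant m nP p (σ 5) P f n σ
  lt : ∀ σ ∈ μ.support, σ 5 < 2 ^ b
  le : ∀ v, μ.toOuterMeasure {σ | σ 5 = v} ≤ (2 ^ b)⁻¹

theorem preCmd_runs (P : Fin m → Fin nP) (f : ℕ → ℕ) (hm : 2 ≤ m) (hs : 0 < s)
    (hk : cell 15 (Nat.clog 2 m) < k) (hw : 2 * minModulus s m nP + 2 * m < 2 ^ w)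
    (hnT : nT < 2 ^ w) :
    ∃ p, p.Prime ∧ minModulus s m nP ≤ p ∧ ∃ μ : PMF Mem,
      Runs (preEnv Δ P) (fun _ => True) (preCmd s) (initMem m nP nT) μ ∧
      Distribution k w m nP p (Nat.clog 2 (size s m)) (patText Δ P) f 0 μ := by
  simp only [cell] at hk
  have hN : minModulus s m nP = 2 * size s m + nP + 5 := rfl
  obtain ⟨q, hq, hNq, hqN⟩ := Nat.exists_prime_lt_and_le_two_mul (minModulus s m nP) (by omega)
  have hinit : ∀ a, 3 ≤ a → initMem m nP nT a = 0 := fun a ha => by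
    unfold initMem
    rw [if_neg (by omega), if_neg (by omega), if_neg (by omega)]
  have hinitle : ∀ a, initMem m nP nT a ≤ m + nP + nT := fun a => by
    unfold initMem
    split_ifs <;> omega
  have hF0 : ∀ v, m + nP + nT < 2 ^ v → Fits k v (initMem m nP nT) := fun v hv =>
    ⟨fun a => (hinitle a).trans_lt hv, fun a ha => hinit a (by omega)⟩
  -- The prime search runs with this generous word length; afterwards cell `5` is cleared and the
  -- memory fits in words of `w` bits again.
  have hv : m + nP + nT + q.factorial < 2 ^ (m + nP + nT + q.factorial) := Nat.lt_two_pow_self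
  obtain ⟨σ₁, hrun₁, -, p, hp, hpN, hpq, rfl⟩ := primeCmd_wp (E := preEnv Δ P) (s := s)
    (σ := initMem m nP nT) (k := k) (w := m + nP + nT + q.factorial) (nP := nP) (m := m)
    (Q := fun τ => ∃ p, p.Prime ∧ minModulus s m nP ≤ p ∧ p ≤ q ∧ τ =
      Function.update (Function.update (Function.update (initMem m nP nT) 3 m) 4 p) 5 0)
    hq hNq.le (by simp [initMem]) (by simp [initMem]) (by omega) (by omega)
    (fun p h1 h2 h3 => ⟨p, h1, h2, h3, rfl⟩) (hF0 _ (by omega))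
  refine ⟨p, hp, hpN, ?_⟩
  have hsize := one_le_size hs (show 0 < m by omega)
  generalize hσ₂ : (Function.update (Function.update (Function.update (Function.update
    (initMem m nP nT) 3 m) 4 p) 5 0) 13 1 : Mem) = σ₂
  have a1 : σ₂ 1 = nP := by
    rw [← hσ₂]
    simp (disch := omega) only [upd_ne]
    simp [initMem]
  have a2 : σ₂ 2 = nT := by
    rw [← hσ₂]
    simp (disch := omega) only [upd_ne]
    simp [initMem]
  have a3 : σ₂ 3 = m := by
    rw [← hσ₂]
    simp (disch := omega) only [upd_eq, upd_ne]
  have a4 : σ₂ 4 = p := by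
    rw [← hσ₂]
    simp (disch := omega) only [upd_eq, upd_ne]
  have a5 : σ₂ 5 = 0 := by
    rw [← hσ₂]
    simp (disch := omega) only [upd_eq, upd_ne]
  have a13 : σ₂ 13 = 1 := by rw [← hσ₂, upd_eq]
  have afr : ∀ a, 6 ≤ a → a ≠ 13 → σ₂ a = 0 := fun a ha ha' => by
    rw [← hσ₂]
    simp (disch := omega) only [upd_ne]
    exact hinit a (by omega)
  have hF₂ : Fits k w σ₂ := by
    have h1 : Fits k w (initMem m nP nT) := by
      refine ⟨fun a => ?_, fun a ha => hinit a (by omega)⟩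
      unfold initMem
      split_ifs <;> omega
    rw [← hσ₂]
    exact (((h1.update (by omega) (by omega)).update (by omega) (by omega)).update (by omega)
      (by omega)).update (by omega) (by omega)
  have hrun₂ : Runs (preEnv Δ P) (fun _ => True) (set 13 (.const 1)) _ (PMF.pure σ₂) :=
    hσ₂ ▸ Runs.store (.const 13) (.const 1) (Function.update (Function.update (Function.update
      (initMem m nP nT) 3 m) 4 p) 5 0) trivial
  clear hσ₂
  set b := Nat.clog 2 (size s m) with hb
  have hb1 : size s m ≤ 2 ^ b := Nat.le_pow_clog (by omega) _
  have hb2 : 0 < b → 2 ^ (b - 1) < size s m := fun h0 =>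
    (Nat.lt_clog_iff_pow_lt (by omega)).1 (by omega)
  have hb3 : 2 ^ b ≤ 2 * size s m := two_pow_clog_le hsize
  obtain ⟨μ, hrun₃, hsupp, hmass⟩ := bitsCmd_runs (E := preEnv Δ P) (k := k) (w := w) (m := m)
    (s := s) (by omega) b σ₂ hF₂ a3 (by rw [a13, one_mul]; exact hb1)
    (by rw [a13, one_mul]; exact hb2) (by rw [a5, zero_add, one_mul]; omega) (by omega)
  have htab : ∀ τ ∈ μ.support, ∃ υ, Runs (preEnv Δ P) (Fits k w) tableCmd τ (PMF.pure υ) ∧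
      Fits k w υ ∧ Invariant m nP p (τ 5) (patText Δ P) f 0 υ ∧ υ 5 = τ 5 := by
    intro τ hτ
    obtain ⟨h1, -, h3⟩ := hsupp τ hτ
    refine tableCmd_wp (E := preEnv Δ P) (nT := nT) hm hp.one_lt (by simp only [cell]; omega)
      (by omega) (by omega) hnT ?_ ?_ ?_ ?_ rfl ?_ ?_ (fun q => rfl) (fun υ h4 h5 => ⟨h4, h5⟩) h1
    · rw [h3 1 (by omega) (by omega) (by omega), a1]
    · rw [h3 2 (by omega) (by omega) (by omega), a2]
    · rw [h3 3 (by omega) (by omega) (by omega), a3]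
    · rw [h3 4 (by omega) (by omega) (by omega), a4]
    · rw [h3 7 (by omega) (by omega) (by omega), afr 7 (by omega) (by omega)]
    · intro a ha1 ha2
      rw [h3 a (by omega) (by omega) (by omega), afr a (by omega) (by omega)]
  choose! g hg1 hg2 hg3 hg4 using htab
  have hmap : μ.bind (fun τ => PMF.pure (g τ)) = μ.map g := rfl
  refine ⟨μ.map g, ?_, ?_, ?_, ?_, ?_⟩
  · have h4 := Runs.seq (bitsCmd s) tableCmd σ₂ μ (fun τ => PMF.pure (g τ))
      (hrun₃.mono (ok' := fun _ => True) fun _ _ => trivial)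
      (fun τ hτ => (hg1 τ hτ).mono fun _ _ => trivial)
    have h5 := Runs.seq _ _ _ _ (fun _ => μ.map g) hrun₂ (by
      intro τ hτ
      rw [PMF.support_pure, Set.mem_singleton_iff] at hτ
      rw [hτ]
      exact h4)
    rw [PMF.pure_bind] at h5
    have h6 := Runs.seq _ _ _ _ (fun _ => μ.map g)
      (hrun₁.mono (ok' := fun _ => True) fun _ _ => trivial) (by
      intro τ hτ
      rw [PMF.support_pure, Set.mem_singleton_iff] at hτ
      rw [hτ]
      exact h5)
    rwa [PMF.pure_bind] at h6
  · intro σ hσ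
    rw [PMF.support_map] at hσ
    obtain ⟨τ, hτ, rfl⟩ := hσ
    exact hg2 τ hτ
  · intro σ hσ
    rw [PMF.support_map] at hσ
    obtain ⟨τ, hτ, rfl⟩ := hσ
    rw [hg4 τ hτ]
    exact hg3 τ hτ
  · intro σ hσ
    rw [PMF.support_map] at hσ
    obtain ⟨τ, hτ, rfl⟩ := hσ
    rw [hg4 τ hτ]
    have h1 := (hsupp τ hτ).2.1
    rw [a5] at h1
    exact (Nat.div_eq_zero_iff_lt (by positivity)).1 h1
  · intro v
    rw [PMF.toOuterMeasure_map_apply]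
    refine (PMF.toOuterMeasure_mono _ ?_).trans (hmass v)
    rintro τ ⟨hτ1, hτ2⟩
    exact (hg4 τ hτ2).symm.trans hτ1

/-- The algorithm. -/
def algorithm (s : ℕ) : OnlineAlgorithm := ⟨preCmd s, stepCmd⟩

/-- The coded text. -/
def codedText (Δ : Fin nP → Fin nT → Bool) (T : ℕ → Fin nT) (n : ℕ) : ℕ :=
  textCode (relFun Δ) nP (T n)

/-- Each step is deterministic and leaves cell `5` unchanged, so the distribution is pushed forward
along a map and the bounds for the evaluation point persist. -/
theorem algorithm_reaches (P : Fin m → Fin nP) (T : ℕ → Fin nT) (hm : 2 ≤ m) (hs : 0 < s)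
    (hk : cell 15 (Nat.clog 2 m) < k) (hw : 2 * minModulus s m nP + 6 * m < 2 ^ w)
    (hnT : nT < 2 ^ w) :
    ∃ p, p.Prime ∧ minModulus s m nP ≤ p ∧ ∀ n, ∃ μ : PMF Mem,
      Reaches (algorithm s) Δ P T k w n μ ∧
      Distribution k w m nP p (Nat.clog 2 (size s m)) (patText Δ P) (codedText Δ T) n μ := by
  have hN : minModulus s m nP = 2 * size s m + nP + 5 := rfl
  obtain ⟨p, hp, hpN, μ₀, hrun, hd₀⟩ := preCmd_runs (Δ := Δ) (k := k) (w := w) P (codedText Δ T) hm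
    hs hk (by omega) hnT
  refine ⟨p, hp, hpN, fun n => ?_⟩
  induction n with
  | zero => exact ⟨μ₀, .zero μ₀ hrun hd₀.fits, hd₀⟩
  | succ n ih =>
    obtain ⟨μ, hr, hd⟩ := ih
    have hfits : ∀ σ ∈ μ.support, Fits k w (Function.update σ 0 (T n : ℕ)) := fun σ hσ =>
      (hd.fits σ hσ).update (by simp only [cell] at hk; omega) ((T n).2.trans hnT)
    have hstep : ∀ σ ∈ μ.support, ∃ τ, Runs (stepEnv Δ) (Fits k w) stepCmd
        (Function.update σ 0 (T n : ℕ)) (PMF.pure τ) ∧ Fits k w τ ∧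
        Invariant m nP p (σ 5) (patText Δ P) (codedText Δ T) (n + 1) τ := fun σ hσ =>
      stepCmd_wp (E := stepEnv Δ) (nP := nP) (a := (T n : ℕ))
        (n := n) (f := codedText Δ T) hm hp.one_lt (by omega) (by omega)
        (by simp only [cell] at hk ⊢; omega) rfl (hd.inv σ hσ) rfl (fun τ h => h) (hfits σ hσ)
    choose! g hg1 hg2 hg3 using hstep
    have hg5 : ∀ σ ∈ μ.support, g σ 5 = σ 5 := fun σ hσ => (hg3 σ hσ).static.cell_r
    refine ⟨μ.map g, .succ n μ (fun σ => PMF.pure (g σ)) hr hfits hg1, ?_, ?_, ?_, ?_⟩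
    · intro σ hσ
      rw [PMF.support_map] at hσ
      obtain ⟨τ, hτ, rfl⟩ := hσ
      exact hg2 τ hτ
    · intro σ hσ
      rw [PMF.support_map] at hσ
      obtain ⟨τ, hτ, rfl⟩ := hσ
      rw [hg5 τ hτ]
      exact hg3 τ hτ
    · intro σ hσ
      rw [PMF.support_map] at hσ
      obtain ⟨τ, hτ, rfl⟩ := hσ
      rw [hg5 τ hτ]
      exact hd.lt τ hτ
    · intro v
      rw [PMF.toOuterMeasure_map_apply]
      refine (PMF.toOuterMeasure_mono _ ?_).trans (hd.le v)
      rintro τ ⟨hτ1, hτ2⟩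
      exact (hg5 τ hτ2).symm.trans hτ1

theorem occ_iff_localPMAnd (h : ¬ ContainsWildcard (relMatrix Δ)) (P : Fin m → Fin nP)
    (T : ℕ → Fin nT) (i : ℕ) :
    Occ (extend m (codedText Δ T)) (patText Δ P) (i + m) m ↔ localPMAnd Δ P T i = true := by
  unfold localPMAnd Occ
  rw [decide_eq_true_iff]
  have key : ∀ j : Fin m, extend m (codedText Δ T) (i + m + j) = patText Δ P j ↔
      Δ (P j) (T (i + j)) = true := by
    intro j
    rw [← patCode_eq_textCode_iff h, extend, if_neg (by omega),
      show i + m + (j : ℕ) - m = i + j by omega, eq_comm]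
    simp only [patText, preEnv, codedText, j.2, dif_pos, Fin.eta]
  exact ⟨fun h1 j => (key j).1 (h1 j j.2), fun h1 k hk => (key ⟨k, hk⟩).2 (h1 ⟨k, hk⟩)⟩

-- A wrong output forces the evaluation point into `bad`. Its size is at most `4m³`, and each of its
-- elements has probability at most `1 / 2 ^ b`, where `2 ^ b ≥ 4sm³`.
open Classical in
theorem algorithm_error {p : ℕ} (h : ¬ ContainsWildcard (relMatrix Δ)) (P : Fin m → Fin nP)
    (T : ℕ → Fin nT) (hm : 2 ≤ m) (hs : 0 < s) (hp : p.Prime) (hpN : minModulus s m nP ≤ p)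
    {i : ℕ} {μ : PMF Mem} {ε : ℝ} (hsε : 1 ≤ ε * s)
    (hd : Distribution k w m nP p (Nat.clog 2 (size s m)) (patText Δ P) (codedText Δ T) (i + m) μ) :
    μ.toOuterMeasure {σ | output σ ≠ localPMAnd Δ P T i} ≤ ENNReal.ofReal ε := by
  have hb := two_pow_clog_le (one_le_size hs (show 0 < m by omega))
  set b := Nat.clog 2 (size s m)
  have hN : minModulus s m nP = 2 * size s m + nP + 5 := rfl
  -- After `i + m` symbols the padded text ends before index `i + 2m`. Each copy started at most
  -- `2m` symbols earlier, hence not before `i`, and the condition on its local text looks at `2m`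
  -- symbols, hence not beyond `i + 4m`.
  let V : ℕ → ℕ := fun k => extend m (codedText Δ T) (i + k)
  let bad := (Finset.range (2 ^ b)).filter fun r => ¬ NoCollision p r V (patText Δ P) m (4 * m)
  have hV : ∀ k, V k < p := fun k => by
    have := textCode_le (relFun Δ) nP (T (i + k - m))
    simp only [V, extend, codedText]
    split_ifs <;> omega
  have hP : ∀ k, patText Δ P k < p := fun k => by
    have := patCode_le (relFun Δ) nP nT ((preEnv Δ P).pat k)
    unfold patText
    omega
  have hcard : bad.card ≤ 4 * m * m * m := card_collision_le hp (by omega) hV hP m (4 * m)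
  have hsub : {σ | output σ ≠ localPMAnd Δ P T i} ∩ μ.support ⊆
      ⋃ v ∈ bad, {σ : Mem | σ 5 = v} := by
    rintro σ ⟨hσ1, hσ⟩
    have hi := hd.inv σ hσ
    simp only [Set.mem_iUnion, Set.mem_ofPred_eq, exists_prop, exists_eq_right', bad,
      Finset.mem_filter, Finset.mem_range]
    refine ⟨hd.lt σ hσ, fun hno => hσ1 ?_⟩
    have hout := hi.output (by omega) fun c hc j L hL hLm he => by
      have ht := (hi.bounded c hc).time
      have hU : ∀ k, localText m (codedText Δ T) (i + m) c σ (j + k) =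
          V (2 * m - σ (9 + 2 * c) + j + k) := fun k => by
        simp only [localText, V]
        congr 1
        omega
      simp only [hU] at he
      intro k hk
      rw [hU]
      exact hno _ L (by omega) hLm he k hk
    rw [occ_iff_localPMAnd h] at hout
    unfold output
    rw [Bool.eq_iff_iff, decide_eq_true_iff]
    exact hout
  have hreal : (bad.card : ℝ) ≤ ε * 2 ^ b := by
    have h1 : size s m ≤ 2 ^ b := Nat.le_pow_clog (by omega) _
    have h2 : s * bad.card ≤ 2 ^ b := by
      refine le_trans (le_trans (Nat.mul_le_mul_left s hcard) (le_of_eq ?_)) h1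
      unfold size
      ring
    have h3 : (s : ℝ) * bad.card ≤ 2 ^ b := by exact_mod_cast h2
    have hε : 0 < ε := by
      by_contra h4
      have : ε * s ≤ 0 := mul_nonpos_of_nonpos_of_nonneg (not_lt.1 h4) (Nat.cast_nonneg s)
      linarith
    calc (bad.card : ℝ) = 1 * bad.card := (one_mul _).symm
      _ ≤ ε * s * bad.card := mul_le_mul_of_nonneg_right hsε (Nat.cast_nonneg _)
      _ = ε * (s * bad.card) := by ring
      _ ≤ ε * 2 ^ b := mul_le_mul_of_nonneg_left h3 hε.le
  calc μ.toOuterMeasure {σ | output σ ≠ localPMAnd Δ P T i}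
      ≤ μ.toOuterMeasure (⋃ v ∈ bad, {σ : Mem | σ 5 = v}) := PMF.toOuterMeasure_mono _ hsub
    _ ≤ ∑ v ∈ bad, μ.toOuterMeasure {σ : Mem | σ 5 = v} :=
      MeasureTheory.measure_biUnion_finset_le _ _
    _ ≤ ∑ v ∈ bad, (2 ^ b)⁻¹ := Finset.sum_le_sum fun v _ => hd.le v
    _ = bad.card / 2 ^ b := by rw [Finset.sum_const, nsmul_eq_mul, div_eq_mul_inv]
    _ ≤ ENNReal.ofReal ε := by
      refine ENNReal.div_le_of_le_mul ?_
      rw [show (2 : ENNReal) ^ b = ENNReal.ofReal (2 ^ b) by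
        rw [ENNReal.ofReal_pow (by norm_num), ENNReal.ofReal_ofNat],
        ← ENNReal.ofReal_mul' (by positivity), ← ENNReal.ofReal_natCast]
      exact ENNReal.ofReal_le_ofReal hreal

end Algorithm

end OnlinePM

theorem mainTheorem4 (c : ℕ) (ε : ℝ) (hε : 0 < ε) :
    ∃ (A : OnlinePM.OnlineAlgorithm) (C : ℕ), ∀ m nP nT : ℕ,
      2 ≤ m → nP ≤ m ^ c → nT ≤ m ^ c →
      ∀ Δ : Fin nP → Fin nT → Bool,
        ¬ OnlinePM.ContainsWildcard (OnlinePM.relMatrix Δ) →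
          OnlinePM.SolvesLocalPMAnd A Δ m ε (C * Nat.log 2 m ^ 2) := by
  obtain ⟨s, hs⟩ := exists_nat_gt (1 / ε)
  have hs0 : 0 < s := by
    have : (0 : ℝ) < s := lt_trans (by positivity) hs
    exact_mod_cast this
  have hsε : 1 ≤ ε * s := by
    rw [div_lt_iff₀ hε] at hs
    linarith
  -- There are `48 + 16 * clog m ≤ 64 + 16 * l ≤ 80 * l` words, each of `(s + 2 * c + 16) * l` bits.
  refine ⟨OnlinePM.algorithm s, 80 * (s + 2 * c + 16), fun m nP nT hm hnP hnT Δ hΔ => ?_⟩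
  set l := Nat.log 2 m with hl
  have hl1 : 1 ≤ l := Nat.log_pos (by omega) hm
  have hml : m ≤ 2 ^ (2 * l) :=
    (Nat.lt_pow_succ_log_self (by omega) m).le.trans (Nat.pow_le_pow_right (by omega) (by omega))
  have hclog : Nat.clog 2 m ≤ l + 1 :=
    Nat.clog_le_of_le_pow (Nat.lt_pow_succ_log_self (by omega) m).le
  -- The numbers `s * m ^ 3`, `m ^ c` and `m` are all at most `X = 2 ^ ((s + 2 * c + 10) * l)`. The
  -- machine needs less than `64 * X`, which the six further bits per unit of `l` provide.
  have hX : ∀ e, e ≤ (s + 2 * c + 10) * l → 2 ^ e ≤ 2 ^ ((s + 2 * c + 10) * l) := fun e he =>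
    Nat.pow_le_pow_right (by omega) he
  have hX1 : s * (m * m * m) ≤ 2 ^ ((s + 2 * c + 10) * l) := by
    calc s * (m * m * m) ≤ 2 ^ (s * l) * (2 ^ (2 * l) * 2 ^ (2 * l) * 2 ^ (2 * l)) := by
          gcongr
          exact Nat.lt_two_pow_self.le.trans
            (Nat.pow_le_pow_right (by omega) (Nat.le_mul_of_pos_right s hl1))
      _ = 2 ^ (s * l + (2 * l + 2 * l + 2 * l)) := by rw [pow_add, pow_add, pow_add]
      _ ≤ _ := hX _ (by nlinarith [Nat.zero_le (c * l)])
  have hX2 : m ^ c ≤ 2 ^ ((s + 2 * c + 10) * l) := by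
    calc m ^ c ≤ (2 ^ (2 * l)) ^ c := Nat.pow_le_pow_left hml c
      _ = 2 ^ (2 * l * c) := (pow_mul ..).symm
      _ ≤ _ := hX _ (by nlinarith [Nat.zero_le (s * l)])
  have hX3 : m ≤ 2 ^ ((s + 2 * c + 10) * l) :=
    hml.trans (hX _ (Nat.mul_le_mul_right l (by omega)))
  have hX4 : 1 ≤ 2 ^ ((s + 2 * c + 10) * l) := Nat.one_le_two_pow
  have hX5 : 64 * 2 ^ ((s + 2 * c + 10) * l) ≤ 2 ^ ((s + 2 * c + 16) * l) := by
    calc 64 * 2 ^ ((s + 2 * c + 10) * l) = 2 ^ (6 + (s + 2 * c + 10) * l) := by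
          rw [pow_add]
          norm_num
      _ ≤ _ := Nat.pow_le_pow_right (by omega) (by nlinarith)
  have hsize : OnlinePM.size s m = 4 * (s * (m * m * m)) := by
    unfold OnlinePM.size
    ring
  have hN : OnlinePM.minModulus s m nP = 2 * OnlinePM.size s m + nP + 5 := rfl
  refine ⟨48 + 16 * Nat.clog 2 m, (s + 2 * c + 16) * l, ?_, fun P T i => ?_⟩
  · calc (48 + 16 * Nat.clog 2 m) * ((s + 2 * c + 16) * l)
        ≤ (80 * l) * ((s + 2 * c + 16) * l) := Nat.mul_le_mul_right _ (by omega)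
      _ = _ := by ring
  · obtain ⟨p, hp, hpN, hr⟩ := OnlinePM.algorithm_reaches (Δ := Δ) (s := s)
      (k := 48 + 16 * Nat.clog 2 m) (w := (s + 2 * c + 16) * l) P T hm hs0
      (by simp only [OnlinePM.cell]; omega) (by omega) (by omega)
    obtain ⟨μ, hμ, hd⟩ := hr (i + m)
    exact ⟨μ, hμ, OnlinePM.algorithm_error hΔ P T hm hs0 hp hpN hsε hd⟩
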